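/- Let $\ell$ be a prime, let $E/F$ be a finite Galois extension of fields that are finite extensions of $\mathbb{Q}_\ell$, put $\Gamma=\mathrm{Gal}(E/F)$, and let $I\subseteq\Gamma$ be the inertia subgroup. Let $\mathbb{Q}^c$ be the algebraic closure of $\mathbb{Q}$ in $\mathbb{C}$ and $\widehat\Gamma$ the set of irreducible $\mathbb{Q}^c$-valued characters of $\Gamma$; for $\chi\in\widehat\Gamma$ write $e_\chi=\frac{\chi(1)}{|\Gamma|}\sum_{g\in\Gamma}\chi(g^{-1})g$. Every element of the unit group $\zeta(\mathbb{Q}^c[\Gamma])^\times$ of the centre of $\mathbb{Q}^c[\Gamma]$ is uniquely of the form $x=\sum_{\chi\in\widehat\Gamma} x_\chi e_\chi$ with $x_\chi\in(\mathbb{Q}^c)^\times$; for a virtual character $\xi=\sum_{\mu\in\widehat\Gamma} m_\mu\mu$ put $x_\xi=\prod_\mu x_\mu^{m_\mu}$. Let $\psi_2$ be the second Adams operator, $\psi_2(\chi)(g)=\chi(g^2)$, and let $(1-\psi_{2,*})(x)$ be the element with $\chi$-component $x_\chi\cdot x_{\psi_2(\chi)}^{-1}$ for each $\chi\in\widehat\Gamma$.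 Let $y_{E/F}=\sum_{\chi\in\widehat\Gamma} y(F,\chi)\,e_\chi$, where $y(F,\chi)=1$ if $\chi$ is ramified (not trivial on $I$) and $y(F,\chi)=(-1)^{\chi(1)}\det_\chi(\sigma)$ if $\chi$ is unramified (trivial on $I$), $\sigma\in\Gamma$ being a lift of the Frobenius element of $\Gamma/I$. Then $(1-\psi_{2,*})(y_{E/F})\in\zeta(\mathbb{Q}[\Gamma])^\times\subseteq\zeta(\mathbb{Q}_\ell[\Gamma])^\times$. Let $\mathfrak{c}_{E/F}=\bigl(\partial^1\circ\mathrm{Nrd}^{-1}\bigr)\bigl((1-\psi_{2,*})(y_{E/F})\bigr)$ in the relative algebraic $K$-group $K_0(\mathbb{Z}_\ell[\Gamma],\mathbb{Q}_\ell[\Gamma])$, where $\mathrm{Nrd}\colon K_1(\mathbb{Q}_\ell[\Gamma])\to\zeta(\mathbb{Q}_\ell[\Gamma])^\times$ is the (bijective) reduced norm and $\partial^1\colon K_1(\mathbb{Q}_\ell[\Gamma])\to K_0(\mathbb{Z}_\ell[\Gamma],\mathbb{Q}_\ell[\Gamma])$ is the connecting homomorphism, which sends the class of $M\in\mathrm{GL}_n(\mathbb{Q}_\ell[\Gamma])$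 to $[\mathbb{Z}_\ell[\Gamma]^n,M,\mathbb{Z}_\ell[\Gamma]^n]$. Suppose that $I$ has odd order. Then the following claims are valid. (i) If $\Gamma$ has odd order or is abelian, then, in $\zeta(\mathbb{Q}[\Gamma])^\times$, $$(1-\psi_{2,*})(y_{E/F})=(1-e_I)+\sigma^{-1}e_I,$$ where $\sigma\in\Gamma$ is any lift of the Frobenius element of $\Gamma/I$ and $e_I=|I|^{-1}\sum_{g\in I}g$. (ii) If $E/F$ is tamely ramified, or is totally ramified and of odd degree, then $\mathfrak{c}_{E/F}=0$: that is, $(1-\psi_{2,*})(y_{E/F})$ is the reduced norm of an element of $K_1(\mathbb{Q}_\ell[\Gamma])$ that is annihilated by $\partial^1$. -/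

import Mathlib

namespace LocalExt

open scoped TensorProduct

universe v

/-! ### Finite Galois extensions of `ℓ`-adic fields -/

/-- The ring of integers `𝓞_K` of a finite extension `K` of `ℚ_ℓ`: the integral closure of
the ring `ℤ_ℓ = {x : ‖x‖ ≤ 1}` in `K`. -/
abbrev IntegerRing (ℓ : ℕ) [Fact ℓ.Prime] (K : Type*) [Field K] [Algebra ℚ_[ℓ] K] : Type _ :=
  integralClosure (PadicInt.subring ℓ) K

section LocalFields

variable (ℓ : ℕ) [Fact ℓ.Prime] (F E : Type*) [Field F] [Field E] [Algebra ℚ_[ℓ] F]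
  [Algebra ℚ_[ℓ] E] [Algebra F E] [IsScalarTower ℚ_[ℓ] F E]

noncomputable instance : Algebra (IntegerRing ℓ F) (IntegerRing ℓ E) :=
  RingHom.toAlgebra
    { toFun := fun x => ⟨algebraMap F E x, x.2.algebraMap⟩
      map_one' := by ext; simp
      map_mul' := by intros; ext; simp
      map_zero' := by ext; simp
      map_add' := by intros; ext; simp }

instance : IsScalarTower (IntegerRing ℓ F) (IntegerRing ℓ E) E :=
  IsScalarTower.of_algebraMap_eq' rfl

instance : SMulCommClass (E ≃ₐ[F] E) (IntegerRing ℓ F) (IntegerRing ℓ E) where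
  smul_comm g r x := by
    ext
    change g (algebraMap F E r * (x : E)) = algebraMap F E r * g x
    rw [map_mul, g.commutes]

instance : IsFractionRing (PadicInt.subring ℓ) ℚ_[ℓ] :=
  inferInstanceAs (IsFractionRing ℤ_[ℓ] ℚ_[ℓ])

instance : IsIntegrallyClosed (PadicInt.subring ℓ) :=
  inferInstanceAs (IsIntegrallyClosed ℤ_[ℓ])

variable [FiniteDimensional ℚ_[ℓ] E]

theorem mem_integerRing_iff (x : E) :
    x ∈ integralClosure (PadicInt.subring ℓ) E ↔ spectralNorm ℚ_[ℓ] E x ≤ 1 := by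
  have hx : IsIntegral ℚ_[ℓ] x := Algebra.IsIntegral.isIntegral x
  rw [spectralNorm, spectralValue_le_one_iff (minpoly.monic hx)]
  constructor
  · intro h n
    have h' : IsIntegral (PadicInt.subring ℓ) x := h
    rw [minpoly.isIntegrallyClosed_eq_field_fractions' ℚ_[ℓ] h', Polynomial.coeff_map]
    exact ((minpoly (PadicInt.subring ℓ) x).coeff n).2
  · intro h
    have hl : minpoly ℚ_[ℓ] x ∈ Polynomial.lifts (algebraMap (PadicInt.subring ℓ) ℚ_[ℓ]) := by
      rw [Polynomial.lifts_iff_coeff_lifts]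
      exact fun n => ⟨⟨_, h n⟩, rfl⟩
    obtain ⟨q, hq, -, hm⟩ := Polynomial.lifts_and_natDegree_eq_and_monic hl (minpoly.monic hx)
    refine ⟨q, hm, ?_⟩
    have := minpoly.aeval ℚ_[ℓ] x
    rw [← hq, Polynomial.aeval_map_algebraMap] at this
    exact this

instance : IsLocalRing (IntegerRing ℓ E) := by
  refine IsLocalRing.of_nonunits_add fun a b ha hb => ?_
  have key : ∀ c : IntegerRing ℓ E, c ∈ nonunits (IntegerRing ℓ E) ↔
      spectralNorm ℚ_[ℓ] E (c : E) < 1 := by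
    intro c
    have hc := (mem_integerRing_iff ℓ E c).1 c.2
    rw [mem_nonunits_iff, ← not_le, not_iff_not]
    constructor
    · rintro ⟨u, rfl⟩
      have h1 := (mem_integerRing_iff ℓ E (u⁻¹ : (IntegerRing ℓ E)ˣ)).1 (u⁻¹).1.2
      have h2 := spectralAlgNorm_mul (K := ℚ_[ℓ]) (L := E) (u : IntegerRing ℓ E)
        ((u⁻¹ : (IntegerRing ℓ E)ˣ) : IntegerRing ℓ E)
      have h3 : ((u : IntegerRing ℓ E) : E) * ((u⁻¹ : (IntegerRing ℓ E)ˣ) : IntegerRing ℓ E) = 1 := by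
        exact_mod_cast congrArg Subtype.val u.mul_inv
      rw [h3, spectralAlgNorm_one] at h2
      simp only [spectralAlgNorm_def] at h2
      have h4 := spectralNorm_nonneg (K := ℚ_[ℓ]) ((u : IntegerRing ℓ E) : E)
      nlinarith
    · intro h
      have hc0 : (c : E) ≠ 0 := by
        intro h0
        rw [h0, spectralNorm_zero] at h
        linarith
      have h2 := spectralAlgNorm_mul (K := ℚ_[ℓ]) (L := E) (c : E) (c : E)⁻¹
      rw [mul_inv_cancel₀ hc0, spectralAlgNorm_one] at h2
      simp only [spectralAlgNorm_def] at h2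
      have h4 : (c : E)⁻¹ ∈ integralClosure (PadicInt.subring ℓ) E := by
        rw [mem_integerRing_iff]
        have h5 := spectralNorm_nonneg (K := ℚ_[ℓ]) (c : E)⁻¹
        nlinarith
      exact IsUnit.of_mul_eq_one ⟨_, h4⟩ (Subtype.ext (mul_inv_cancel₀ hc0))
  rw [key] at ha hb ⊢
  exact (isNonarchimedean_spectralNorm (K := ℚ_[ℓ]) (L := E) a b).trans_lt (max_lt ha hb)

instance : Finite (IntegerRing ℓ E ⧸ IsLocalRing.maximalIdeal (IntegerRing ℓ E)) := by
  have : IsNoetherianRing (PadicInt.subring ℓ) := inferInstanceAs (IsNoetherianRing ℤ_[ℓ])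
  have : IsLocalRing (PadicInt.subring ℓ) := inferInstanceAs (IsLocalRing ℤ_[ℓ])
  have : Module.Finite (PadicInt.subring ℓ) (IntegerRing ℓ E) :=
    IsIntegralClosure.finite (PadicInt.subring ℓ) ℚ_[ℓ] E (IntegerRing ℓ E)
  have : FaithfulSMul (PadicInt.subring ℓ) (IntegerRing ℓ E) := by
    rw [faithfulSMul_iff_algebraMap_injective]
    intro x y h
    have h' := congrArg (Subtype.val : IntegerRing ℓ E → E) h
    exact Subtype.ext ((algebraMap ℚ_[ℓ] E).injective h')
  have : IsLocalHom (algebraMap (PadicInt.subring ℓ) (IntegerRing ℓ E)) := inferInstance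
  have hf : Finite (IsLocalRing.ResidueField ℤ_[ℓ]) :=
    Finite.of_equiv _ (PadicInt.residueField (p := ℓ)).symm.toEquiv
  exact IsLocalRing.ResidueField.finite_of_finite
    (R := PadicInt.subring ℓ) (S := IntegerRing ℓ E) hf

instance [FiniteDimensional F E] [IsGalois F E] :
    Algebra.IsInvariant (IntegerRing ℓ F) (IntegerRing ℓ E) (E ≃ₐ[F] E) := by
  refine ⟨fun b hb ↦ ?_⟩
  have : (b : E) ∈ IntermediateField.fixedField (⊤ : Subgroup (E ≃ₐ[F] E)) :=
    fun g => congrArg Subtype.val (hb g)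
  have hg : IsGalois F E := inferInstance
  replace hg := ((IsGalois.tfae (F := F) (E := E)).out 0 1).mp hg
  rw [hg] at this
  obtain ⟨c, hc⟩ := this
  refine ⟨⟨c, ?_⟩, Subtype.ext hc⟩
  have h1 : IsIntegral (PadicInt.subring ℓ) (b:E) := b.2
  rw [← hc] at h1
  exact (isIntegral_algHom_iff (IsScalarTower.toAlgHom (PadicInt.subring ℓ) F E)
    (algebraMap F E).injective).1 h1

/-- The maximal ideal of the ring of integers. -/
noncomputable abbrev maxIdeal : Ideal (IntegerRing ℓ E) :=
  IsLocalRing.maximalIdeal (IntegerRing ℓ E)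

/-- The inertia group `I = Γ₀` of `Γ = Gal(E/F)`: all `g` with `g x ≡ x` modulo the maximal
ideal, for every integer `x` of `E`. -/
noncomputable def inertiaGroup : Subgroup (E ≃ₐ[F] E) :=
  (maxIdeal ℓ E).inertia (E ≃ₐ[F] E)

/-- `σ ∈ Γ` lifts the Frobenius element of `Γ/I`: `σ x ≡ x ^ q` modulo the maximal ideal, for
every integer `x` of `E`, where `q` is the order of the residue field of `F`. -/
def IsFrobeniusLift (σ : E ≃ₐ[F] E) : Prop :=
  IsArithFrobAt (IntegerRing ℓ F) σ (maxIdeal ℓ E)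

/-- A chosen lift to `Γ` of the Frobenius element of `Γ/I`. -/
noncomputable def frobenius [FiniteDimensional F E] [IsGalois F E] : E ≃ₐ[F] E :=
  arithFrobAt (IntegerRing ℓ F) (E ≃ₐ[F] E) (maxIdeal ℓ E)

theorem isFrobeniusLift_frobenius [FiniteDimensional F E] [IsGalois F E] :
    IsFrobeniusLift ℓ F E (frobenius ℓ F E) :=
  IsArithFrobAt.arithFrobAt (IntegerRing ℓ F) (E ≃ₐ[F] E) (maxIdeal ℓ E)

/-- The ramification index of `E/F`. -/
noncomputable def ramificationIndex : ℕ :=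
  (maxIdeal ℓ E).ramificationIdx (IntegerRing ℓ F)

/-- `E/F` is tamely ramified: its ramification index is prime to the residue characteristic
(residue extensions being separable, as the residue fields are finite). -/
def IsTame : Prop := ¬ ℓ ∣ ramificationIndex ℓ F E

/-- `E/F` is totally ramified: its ramification index is its degree. -/
def IsTotallyRamified : Prop := ramificationIndex ℓ F E = Module.finrank F E

end LocalFields

/-! ### Irreducible characters and central elements of group algebras -/

section Characters

variable (K : Type*) [Field K] (Γ : Type*) [Group Γ]

/-- The set of `K`-valued irreducible characters of `Γ`. -/
def IrrChar : Type _ :=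
  {χ : Γ → K // ∃ (n : ℕ) (ρ : Representation K Γ (Fin n → K)), ρ.IsIrreducible ∧ ρ.character = χ}

namespace IrrChar
variable {K Γ} (χ : IrrChar K Γ)

instance : CoeFun (IrrChar K Γ) (fun _ => Γ → K) := ⟨Subtype.val⟩

/-- The degree `χ(1)`, as a natural number. -/
noncomputable def degree : ℕ := χ.2.choose

/-- An irreducible representation with character `χ`. -/
noncomputable def rep : Representation K Γ (Fin χ.degree → K) := χ.2.choose_spec.choose

instance isIrreducible_rep : χ.rep.IsIrreducible := χ.2.choose_spec.choose_spec.1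

theorem character_rep : χ.rep.character = χ := χ.2.choose_spec.choose_spec.2

/-- The linear character `det_χ`. -/
noncomputable def det (g : Γ) : K := LinearMap.det (χ.rep g)

/-- The primitive central idempotent `e_χ = χ(1)/|Γ| ∑ χ(g⁻¹) g` of `K[Γ]`. -/
noncomputable def idempotent [Fintype Γ] : MonoidAlgebra K Γ :=
  (χ 1 / (Fintype.card Γ : K)) • ∑ g : Γ, MonoidAlgebra.single g (χ g⁻¹)

/-- The `χ`-component `x_χ` of a central element `x = ∑ x_χ e_χ` of `K[Γ]`
(the scalar by which `x` acts in a representation with character `χ`). -/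
noncomputable def coeff [Fintype Γ] (z : MonoidAlgebra K Γ) : K :=
  (∑ g : Γ, z.coeff g * χ g) / χ 1

/-- The extension `K[Γ] → M_{χ(1)}(K)` of a matrix representation with character `χ`. -/
noncomputable def toMatrix : MonoidAlgebra K Γ →+* Matrix (Fin χ.degree) (Fin χ.degree) K :=
  (LinearMap.toMatrixAlgEquiv' :
    _ ≃ₐ[K] Matrix (Fin χ.degree) (Fin χ.degree) K).toRingEquiv.toRingHom.comp
      χ.rep.asAlgebraHom.toRingHom

/-- `Det_χ(M)` for `M ∈ GL_n(F[Γ])`: the determinant of the matrix over `K` obtained by applying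
a matrix representation with character `χ` to the entries of `M`. -/
noncomputable def Det (F : Type*) [Field F] [Algebra F K] (n : ℕ) :
    (Matrix (Fin n) (Fin n) (MonoidAlgebra F Γ))ˣ →* Kˣ :=
  Units.map <| Matrix.detMonoidHom.comp <|
    ((Matrix.compRingEquiv (Fin n) (Fin χ.degree) K).toRingHom.comp
      (χ.toMatrix.comp (MonoidAlgebra.mapRingHom Γ (algebraMap F K))).mapMatrix).toMonoidHom

instance [Finite Γ] [CharZero K] [IsAlgClosed K] : Finite (IrrChar K Γ) := by
  classical
  have := Fintype.ofFinite Γ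
  have hc : (Nat.card Γ : K) ≠ 0 := Nat.cast_ne_zero.2 Nat.card_pos.ne'
  let _ : Invertible (Nat.card Γ : K) := invertibleOfNonzero hc
  have orth : ∀ χ μ : IrrChar K Γ,
      (Nat.card Γ : K)⁻¹ * ∑ g : Γ, χ g * μ g⁻¹ = if χ = μ then 1 else 0 := by
    intro χ μ
    have h := Representation.char_orthonormal χ.rep μ.rep
    rw [character_rep, character_rep] at h
    rw [h]
    by_cases hχ : χ = μ
    · subst hχ
      rw [if_pos rfl, if_pos ⟨Representation.Equiv.refl _⟩]
    · rw [if_neg hχ, if_neg]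
      rintro ⟨e⟩
      apply hχ
      apply Subtype.ext
      rw [← character_rep χ, ← character_rep μ]
      exact (Representation.char_iso e).symm
  have li : LinearIndependent K (fun χ : IrrChar K Γ => (χ : Γ → K)) := by
    rw [linearIndependent_iff']
    intro s a h μ hμ
    have h2 : (Nat.card Γ : K)⁻¹ * ∑ g : Γ, (∑ χ ∈ s, a χ • (χ : Γ → K)) g * μ g⁻¹ = a μ := by
      simp only [Finset.sum_apply, Pi.smul_apply, smul_eq_mul, Finset.sum_mul]
      rw [Finset.sum_comm, Finset.mul_sum]
      have : ∀ χ ∈ s, (Nat.card Γ : K)⁻¹ * ∑ g : Γ, a χ * χ g * μ g⁻¹ =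
          a χ * if χ = μ then 1 else 0 := by
        intro χ _
        rw [← orth χ μ, Finset.mul_sum, Finset.mul_sum, Finset.mul_sum]
        exact Finset.sum_congr rfl fun g _ => by ring
      rw [Finset.sum_congr rfl this]
      simp [hμ]
    rw [← h2, h]
    simp
  exact li.finite
end IrrChar

variable {K Γ}

/-- The multiplicity `⟨ξ, μ⟩ ∈ ℤ` of `μ` in the virtual character `ξ`, that is, the integer
whose image in `K` is `|Γ|⁻¹ ∑ ξ(g) μ(g⁻¹)`. -/
noncomputable def multiplicity [Fintype Γ] (ξ : Γ → K) (μ : IrrChar K Γ) : ℤ :=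
  Function.invFun (Int.cast : ℤ → K) ((Fintype.card Γ : K)⁻¹ * ∑ g : Γ, ξ g * μ g⁻¹)

/-- The Adams operator `ψ_k`, `ψ_k(ξ)(g) = ξ(g ^ k)`. -/
def adams (k : ℕ) (ξ : Γ → K) : Γ → K := fun g => ξ (g ^ k)

/-- The value `x_ξ = ∏ x_μ ^ ⟨ξ, μ⟩` at a virtual character `ξ` of a family `x` of nonzero scalars
indexed by the irreducible characters. -/
noncomputable def virtualValue [Fintype Γ] (x : IrrChar K Γ → K) (ξ : Γ → K) : K :=
  ∏ᶠ μ : IrrChar K Γ, x μ ^ multiplicity ξ μ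

/-- The element `∑ x_χ e_χ` of the centre of `K[Γ]`. -/
noncomputable def centralElement [Fintype Γ] (x : IrrChar K Γ → K) : MonoidAlgebra K Γ :=
  ∑ᶠ χ : IrrChar K Γ, x χ • χ.idempotent

/-- The endomorphism `m + n ψ_{k,*}` of the unit group of the centre of `K[Γ]`: the `χ`-component
of the image of `x` is `(x_χ) ^ m * (x_{ψ_k(χ)}) ^ n`. -/
noncomputable def adamsEndo [Fintype Γ] (m n : ℤ) (k : ℕ) (x : MonoidAlgebra K Γ) :
    MonoidAlgebra K Γ :=
  centralElement fun χ =>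
    χ.coeff x ^ m * virtualValue (fun μ : IrrChar K Γ => μ.coeff x) (adams k χ) ^ n
end Characters

/-! ### Algebraic `K`-theory -/

section WhiteheadGroup

variable (A : Type v) [Ring A]

/-- Generators of `K₁(A)`: invertible square matrices over `A`. -/
abbrev K1Gen : Type v := Σ n : ℕ, (Matrix (Fin n) (Fin n) A)ˣ

variable {A} in
/-- The stabilization `M ↦ diag(M, 1)`. -/
def stab {n : ℕ} (M : Matrix (Fin n) (Fin n) A) : Matrix (Fin (n + 1)) (Fin (n + 1)) A :=
  Matrix.reindex finSumFinEquiv finSumFinEquiv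
    (Matrix.fromBlocks M 0 0 (1 : Matrix (Fin 1) (Fin 1) A))

/-- Relations of `K₁(A)`: `[M N] = [M] + [N]` and `[diag(M, 1)] = [M]`. -/
inductive K1Rel : FreeAbelianGroup (K1Gen A) → Prop
  | mul {n : ℕ} (M N : (Matrix (Fin n) (Fin n) A)ˣ) :
      K1Rel (.of ⟨n, M * N⟩ - (.of ⟨n, M⟩ + .of ⟨n, N⟩))
  | stab {n : ℕ} (M : (Matrix (Fin n) (Fin n) A)ˣ) (N : (Matrix (Fin (n + 1)) (Fin (n + 1)) A)ˣ)
      (h : N.val = stab M.val) : K1Rel (.of ⟨n + 1, N⟩ - .of ⟨n, M⟩)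

/-- The Whitehead group `K₁(A) = GL(A)^{ab} = colim_n GL_n(A)^{ab}`, written additively. -/
def K1 : Type v :=
  FreeAbelianGroup (K1Gen A) ⧸ AddSubgroup.closure {x | K1Rel A x}

noncomputable instance : AddCommGroup (K1 A) :=
  inferInstanceAs (AddCommGroup
    (FreeAbelianGroup (K1Gen A) ⧸ AddSubgroup.closure {x | K1Rel A x}))

variable {A} in
/-- A homomorphism out of `K₁(A)` is given by its values on invertible matrices. -/
noncomputable def K1.lift {B : Type*} [AddCommGroup B] (f : K1Gen A → B)
    (hf : ∀ x, K1Rel A x → FreeAbelianGroup.lift f x = 0) : K1 A →+ B :=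
  QuotientAddGroup.lift _ (FreeAbelianGroup.lift f)
    ((AddSubgroup.closure_le _).2 fun x hx => hf x hx)

end WhiteheadGroup

section RelativeK0

variable (R : Type*) [CommRing R] (A : Type v) [Ring A] [Algebra R A] (E : Type*) [CommRing E]
  [Algebra R E]

/-- A finitely generated projective left module over the `R`-algebra `A`. -/
structure ProjMod where
  carrier : Type v
  [addCommGroup : AddCommGroup carrier]
  [moduleBase : Module R carrier]
  [module : Module A carrier]
  [isScalarTower : IsScalarTower R A carrier]
  [finite : Module.Finite A carrier]
  [projective : Module.Projective A carrier]

attribute [instance] ProjMod.addCommGroup ProjMod.moduleBase ProjMod.module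
  ProjMod.isScalarTower ProjMod.finite ProjMod.projective

instance : CoeSort (ProjMod R A) (Type v) := ⟨ProjMod.carrier⟩

variable {R A} in
/-- An isomorphism `P_E ≅ Q_E` of modules over `A_E = E ⊗_R A`, where `P_E = E ⊗_R P`: an `E`-linear
isomorphism that commutes with the action of `A`. -/
@[ext]
structure ScalarExtIso (P Q : ProjMod R A) where
  toEquiv : (E ⊗[R] P) ≃ₗ[E] (E ⊗[R] Q)
  map_smul : ∀ (a : A) (x : E ⊗[R] P),
    toEquiv ((Algebra.lsmul R R P a).baseChange E x) =
      (Algebra.lsmul R R Q a).baseChange E (toEquiv x)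

variable {R A E} in
/-- The composite of two isomorphisms. -/
def ScalarExtIso.trans {P Q S : ProjMod R A} (φ : ScalarExtIso E P Q) (ψ : ScalarExtIso E Q S) :
    ScalarExtIso E P S where
  toEquiv := φ.toEquiv.trans ψ.toEquiv
  map_smul a x := by simp [φ.map_smul, ψ.map_smul]

/-- The symbols `[P, φ, Q]` that generate the relative `K₀`-group. -/
structure K0Gen where
  P : ProjMod R A
  Q : ProjMod R A
  φ : ScalarExtIso E P Q

/-- Relations of the relative `K₀`-group: additivity on short exact sequences of triples, and
`[P, ψ ∘ φ, S] = [P, φ, Q] + [Q, ψ, S]`. -/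
inductive K0Rel : FreeAbelianGroup (K0Gen R A E) → Prop
  | exact (t' t t'' : K0Gen R A E)
      (f : t'.P →ₗ[A] t.P) (g : t.P →ₗ[A] t''.P) (f₁ : t'.Q →ₗ[A] t.Q) (g₁ : t.Q →ₗ[A] t''.Q)
      (hf : Function.Injective f) (hfg : Function.Exact f g) (hg : Function.Surjective g)
      (hf₁ : Function.Injective f₁) (hfg₁ : Function.Exact f₁ g₁) (hg₁ : Function.Surjective g₁)
      (hφf : ∀ x, t.φ.toEquiv ((f.restrictScalars R).baseChange E x) =
        (f₁.restrictScalars R).baseChange E (t'.φ.toEquiv x))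
      (hφg : ∀ x, t''.φ.toEquiv ((g.restrictScalars R).baseChange E x) =
        (g₁.restrictScalars R).baseChange E (t.φ.toEquiv x)) :
      K0Rel (.of t - (.of t' + .of t''))
  | comp (P Q S : ProjMod R A) (φ : ScalarExtIso E P Q) (ψ : ScalarExtIso E Q S) :
      K0Rel (.of ⟨P, S, φ.trans ψ⟩ - (.of ⟨P, Q, φ⟩ + .of ⟨Q, S, ψ⟩))

/-- The relative `K₀`-group `K₀(A, A_E)` of the ring inclusion `A → A_E = E ⊗_R A`. -/
def K0 : Type _ :=
  FreeAbelianGroup (K0Gen R A E) ⧸ AddSubgroup.closure {x | K0Rel R A E x}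

noncomputable instance : AddCommGroup (K0 R A E) :=
  inferInstanceAs (AddCommGroup
    (FreeAbelianGroup (K0Gen R A E) ⧸ AddSubgroup.closure {x | K0Rel R A E x}))

variable {R A E} in
/-- The class of a symbol `[P, φ, Q]`. -/
def K0.mk (t : K0Gen R A E) : K0 R A E := QuotientAddGroup.mk (.of t)

end RelativeK0

section Boundary

variable (R : Type*) [CommRing R] (E : Type*) [CommRing E] [Algebra R E] (Γ : Type*) [Group Γ]

/-- The isomorphism `E ⊗_R R[Γ] ≅ E[Γ]`. -/
noncomputable def groupAlgebraBaseChange : E ⊗[R] MonoidAlgebra R Γ ≃ₗ[E] MonoidAlgebra E Γ :=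
  LinearEquiv.ofLinearMap
    (TensorProduct.AlgebraTensorModule.lift
      { toFun := fun a => a • (MonoidAlgebra.mapAlgHom Γ (Algebra.ofId R E)).toLinearMap
        map_add' := by intros; ext; simp [add_smul]
        map_smul' := by intros; ext; simp [mul_smul] })
    ((Finsupp.lsum E (fun g : Γ => (LinearMap.toSpanSingleton E _
        ((1 : E) ⊗ₜ[R] MonoidAlgebra.single g (1 : R))))) ∘ₗ
      (MonoidAlgebra.coeffLinearEquiv E).toLinearMap)
    (by ext; simp)
    (by ext; simp)

theorem groupAlgebraBaseChange_tmul (a : E) (x : MonoidAlgebra R Γ) :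
    groupAlgebraBaseChange R E Γ (a ⊗ₜ x) = a • MonoidAlgebra.mapAlgHom Γ (Algebra.ofId R E) x :=
  rfl

/-- The isomorphism `E ⊗_R R[Γ]^n ≅ E[Γ]^n`. -/
noncomputable def freeBaseChange (n : ℕ) :
    E ⊗[R] (Fin n → MonoidAlgebra R Γ) ≃ₗ[E] (Fin n → MonoidAlgebra E Γ) :=
  (TensorProduct.piRight R E E fun _ : Fin n => MonoidAlgebra R Γ).trans
    (LinearEquiv.piCongrRight fun _ => groupAlgebraBaseChange R E Γ)

theorem freeBaseChange_tmul (n : ℕ) (a : E) (x : Fin n → MonoidAlgebra R Γ) (i : Fin n) :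
    freeBaseChange R E Γ n (a ⊗ₜ x) i = a • MonoidAlgebra.mapAlgHom Γ (Algebra.ofId R E) (x i) :=
  rfl

theorem freeBaseChange_lsmul (n : ℕ) (a : MonoidAlgebra R Γ)
    (x : E ⊗[R] (Fin n → MonoidAlgebra R Γ)) :
    freeBaseChange R E Γ n ((Algebra.lsmul R R (Fin n → MonoidAlgebra R Γ) a).baseChange E x) =
      MonoidAlgebra.mapAlgHom Γ (Algebra.ofId R E) a • freeBaseChange R E Γ n x := by
  induction x with
  | zero => simp
  | add x y hx hy => simp only [map_add, hx, hy, smul_add]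
  | tmul e x =>
    ext1 i
    rw [LinearMap.baseChange_tmul, freeBaseChange_tmul, Pi.smul_apply, freeBaseChange_tmul]
    simp

variable {E Γ} in
/-- The automorphism `v ↦ v M` of the left module `E[Γ]^n` (row vectors) defined by `M`. -/
noncomputable def rowEquiv {n : ℕ} (M : (Matrix (Fin n) (Fin n) (MonoidAlgebra E Γ))ˣ) :
    (Fin n → MonoidAlgebra E Γ) ≃ₗ[MonoidAlgebra E Γ] (Fin n → MonoidAlgebra E Γ) :=
  LinearEquiv.ofLinearMap (Matrix.vecMulLinear M.val) (Matrix.vecMulLinear M⁻¹.val)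
    (by apply LinearMap.ext; intro x; simp [Matrix.vecMul_vecMul])
    (by apply LinearMap.ext; intro x; simp [Matrix.vecMul_vecMul])

variable {E Γ} in
/-- The automorphism of `E ⊗_R R[Γ]^n ≅ E[Γ]^n` defined by `M`. -/
noncomputable def boundaryIso {n : ℕ} (M : (Matrix (Fin n) (Fin n) (MonoidAlgebra E Γ))ˣ) :
    E ⊗[R] (Fin n → MonoidAlgebra R Γ) ≃ₗ[E] E ⊗[R] (Fin n → MonoidAlgebra R Γ) :=
  (freeBaseChange R E Γ n).trans
    (((rowEquiv M).restrictScalars E).trans (freeBaseChange R E Γ n).symm)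

theorem freeBaseChange_boundaryIso {n : ℕ} (M : (Matrix (Fin n) (Fin n) (MonoidAlgebra E Γ))ˣ)
    (x : E ⊗[R] (Fin n → MonoidAlgebra R Γ)) :
    freeBaseChange R E Γ n (boundaryIso R M x) =
      Matrix.vecMul (freeBaseChange R E Γ n x) M.val := by
  simp [boundaryIso, rowEquiv]

/-- The free module `R[Γ]^n`. -/
noncomputable def freeMod (n : ℕ) : ProjMod R (MonoidAlgebra R Γ) where
  carrier := Fin n → MonoidAlgebra R Γ

variable {E Γ} in
/-- The symbol `[R[Γ]^n, M, R[Γ]^n]` of `M ∈ GL_n(E[Γ])`. -/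
noncomputable def boundaryGen (M : K1Gen (MonoidAlgebra E Γ)) : K0Gen R (MonoidAlgebra R Γ) E where
  P := freeMod R Γ M.1
  Q := freeMod R Γ M.1
  φ :=
    { toEquiv := boundaryIso R M.2
      map_smul := fun a x => by
        apply (freeBaseChange R E Γ M.1).injective
        have h1 := freeBaseChange_boundaryIso R E Γ M.2
        have h2 := freeBaseChange_lsmul R E Γ M.1 a
        exact (h1 _).trans ((congrArg (fun y => Matrix.vecMul y M.2.val) (h2 x)).trans
          ((Matrix.smul_vecMul _ _ _).trans
            ((congrArg _ (h1 x).symm).trans (h2 _).symm))) }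

theorem boundaryGen_mul {n : ℕ} (M N : (Matrix (Fin n) (Fin n) (MonoidAlgebra E Γ))ˣ) :
    K0.mk (boundaryGen R ⟨n, M * N⟩) =
      K0.mk (boundaryGen R ⟨n, M⟩) + K0.mk (boundaryGen R ⟨n, N⟩) := by
  have h : boundaryIso R (M * N) = (boundaryIso R M).trans (boundaryIso R N) := by
    apply LinearEquiv.ext
    intro x
    apply (freeBaseChange R E Γ n).injective
    simp [freeBaseChange_boundaryIso, Matrix.vecMul_vecMul]
  have h2 := (QuotientAddGroup.eq_zero_iff _).2 (AddSubgroup.subset_closure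
    (K0Rel.comp _ _ _ (boundaryGen R ⟨n, M⟩).φ (boundaryGen R ⟨n, N⟩).φ))
  rw [QuotientAddGroup.mk_sub, QuotientAddGroup.mk_add, sub_eq_zero] at h2
  refine Eq.trans ?_ h2
  have h3 : (boundaryGen R ⟨n, M * N⟩).φ =
      (boundaryGen R ⟨n, M⟩).φ.trans (boundaryGen R ⟨n, N⟩).φ :=
    ScalarExtIso.ext h
  exact congrArg (fun φ => K0.mk ⟨freeMod R Γ n, freeMod R Γ n, φ⟩) h3

theorem boundaryGen_one (n : ℕ) :
    K0.mk (boundaryGen R (⟨n, 1⟩ : K1Gen (MonoidAlgebra E Γ))) = 0 := by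
  have h := boundaryGen_mul R E Γ (1 : (Matrix (Fin n) (Fin n) (MonoidAlgebra E Γ))ˣ) 1
  rw [mul_one] at h
  exact left_eq_add.1 h

theorem boundaryGen_stab {n : ℕ} (M : (Matrix (Fin n) (Fin n) (MonoidAlgebra E Γ))ˣ)
    (N : (Matrix (Fin (n + 1)) (Fin (n + 1)) (MonoidAlgebra E Γ))ˣ) (h : N.val = stab M.val) :
    K0.mk (boundaryGen R ⟨n + 1, N⟩) = K0.mk (boundaryGen R ⟨n, M⟩) := by
  let f : (Fin n → MonoidAlgebra R Γ) →ₗ[MonoidAlgebra R Γ] (Fin (n + 1) → MonoidAlgebra R Γ) :=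
    LinearMap.pi (Fin.lastCases 0 fun i => LinearMap.proj i)
  let g : (Fin (n + 1) → MonoidAlgebra R Γ) →ₗ[MonoidAlgebra R Γ] (Fin 1 → MonoidAlgebra R Γ) :=
    LinearMap.pi fun _ => LinearMap.proj (Fin.last n)
  have hfc : ∀ v i, f v (Fin.castSucc i) = v i := fun v i => by simp [f]
  have hfl : ∀ v, f v (Fin.last n) = 0 := fun v => by simp [f]
  have hf : Function.Injective f := fun v w hvw => by
    ext1 i
    rw [← hfc v, ← hfc w, hvw]
  have hg : Function.Surjective g := fun v => ⟨fun _ => v 0, by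
    ext1 i
    rw [Subsingleton.elim i 0]
    rfl⟩
  have hfg : Function.Exact f g := by
    intro v
    constructor
    · intro hv
      refine ⟨fun i => v i.castSucc, ?_⟩
      ext1 i
      refine Fin.lastCases ?_ (fun i => ?_) i
      · rw [hfl]
        exact (congrFun hv 0).symm
      · rw [hfc]
    · rintro ⟨w, rfl⟩
      ext1 i
      exact hfl w
  have bf : ∀ x, (∀ i, freeBaseChange R E Γ (n + 1) ((f.restrictScalars R).baseChange E x)
      (Fin.castSucc i) = freeBaseChange R E Γ n x i) ∧
      freeBaseChange R E Γ (n + 1) ((f.restrictScalars R).baseChange E x) (Fin.last n) = 0 := by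
    intro x
    induction x with
    | zero => simp
    | add x y hx hy =>
      simp only [map_add, Pi.add_apply, hx.1, hy.1, hx.2, hy.2, add_zero, implies_true, and_self]
    | tmul e v =>
      rw [LinearMap.baseChange_tmul]
      simp only [freeBaseChange_tmul, LinearMap.restrictScalars_apply, hfc, hfl]
      simp
  have bg : ∀ x i, freeBaseChange R E Γ 1 ((g.restrictScalars R).baseChange E x) i =
      freeBaseChange R E Γ (n + 1) x (Fin.last n) := by
    intro x i
    induction x with
    | zero => simp
    | add x y hx hy => simp only [map_add, Pi.add_apply, hx, hy]
    | tmul e v => rfl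
  have hN : ∀ v : Fin (n + 1) → MonoidAlgebra E Γ,
      (∀ i, Matrix.vecMul v N.val (Fin.castSucc i) =
        Matrix.vecMul (fun j => v (Fin.castSucc j)) M.val i) ∧
      Matrix.vecMul v N.val (Fin.last n) = v (Fin.last n) := by
    have e1 : ∀ i : Fin n, finSumFinEquiv.symm (Fin.castSucc i) = (Sum.inl i : Fin n ⊕ Fin 1) :=
      fun i => finSumFinEquiv_symm_apply_castAdd i
    have e2 : finSumFinEquiv.symm (Fin.last n) = (Sum.inr 0 : Fin n ⊕ Fin 1) :=
      finSumFinEquiv_symm_apply_natAdd 0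
    intro v
    simp [h, stab, Matrix.vecMul, dotProduct, Fin.sum_univ_castSucc, e1, e2]
  have hr := K0Rel.exact (boundaryGen R ⟨n, M⟩) (boundaryGen R ⟨n + 1, N⟩)
    (boundaryGen R (⟨1, 1⟩ : K1Gen (MonoidAlgebra E Γ))) f g f g hf hfg hg hf hfg hg
    (fun x => by
      apply (freeBaseChange R E Γ (n + 1)).injective
      refine (freeBaseChange_boundaryIso R E Γ N _).trans ?_
      ext1 i
      refine Fin.lastCases ?_ (fun i => ?_) i
      · exact (hN _).2.trans ((bf x).2.trans (bf _).2.symm)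
      · refine ((hN _).1 i).trans (Eq.trans ?_ ((bf _).1 i).symm)
        refine Eq.trans ?_ (congrFun (freeBaseChange_boundaryIso R E Γ M x) i).symm
        congr 1
        ext1 j
        exact (bf x).1 j)
    (fun x => by
      apply (freeBaseChange R E Γ 1).injective
      refine (freeBaseChange_boundaryIso R E Γ 1 _).trans ?_
      rw [Units.val_one, Matrix.vecMul_one]
      ext1 i
      refine (bg x i).trans (Eq.trans ?_ (bg _ i).symm)
      refine Eq.trans ?_ (congrFun (freeBaseChange_boundaryIso R E Γ N x) _).symm
      exact (hN _).2.symm)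
  have h2 := (QuotientAddGroup.eq_zero_iff _).2 (AddSubgroup.subset_closure hr)
  rw [QuotientAddGroup.mk_sub, QuotientAddGroup.mk_add, sub_eq_zero] at h2
  exact h2.trans ((congrArg _ (boundaryGen_one R E Γ 1)).trans (add_zero _))

variable {E Γ} in
/-- The connecting homomorphism `∂¹ : K₁(E[Γ]) → K₀(R[Γ], E[Γ])`,
`[E[Γ]^n, M] ↦ [R[Γ]^n, M, R[Γ]^n]`. -/
noncomputable def boundary : K1 (MonoidAlgebra E Γ) →+ K0 R (MonoidAlgebra R Γ) E :=
  K1.lift (fun M => K0.mk (boundaryGen R M)) fun x hx => by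
    cases hx with
    | mul M N => simp [boundaryGen_mul]
    | stab M N h => simp [boundaryGen_stab R E Γ M N h]
end Boundary

section ReducedNorm

variable (F : Type*) [Field F] (K : Type*) [Field K] [Algebra F K] (Γ : Type*) [Group Γ]

theorem IrrChar.Det_stab (χ : IrrChar K Γ) {n : ℕ}
    (M : (Matrix (Fin n) (Fin n) (MonoidAlgebra F Γ))ˣ)
    (N : (Matrix (Fin (n + 1)) (Fin (n + 1)) (MonoidAlgebra F Γ))ˣ) (h : N.val = stab M.val) :
    χ.Det F (n + 1) N = χ.Det F n M := by
  have key : Matrix.compRingEquiv (Fin (n + 1)) (Fin χ.degree) K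
      ((χ.toMatrix.comp (MonoidAlgebra.mapRingHom Γ (algebraMap F K))).mapMatrix (stab M.val)) =
      Matrix.reindex ((Equiv.sumProdDistrib _ _ _).symm.trans
        (finSumFinEquiv.prodCongr (Equiv.refl (Fin χ.degree))))
        ((Equiv.sumProdDistrib _ _ _).symm.trans
        (finSumFinEquiv.prodCongr (Equiv.refl (Fin χ.degree))))
        (Matrix.fromBlocks (Matrix.compRingEquiv (Fin n) (Fin χ.degree) K
          ((χ.toMatrix.comp (MonoidAlgebra.mapRingHom Γ (algebraMap F K))).mapMatrix M.val)) 0 0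
          (1 : Matrix (Fin 1 × Fin χ.degree) (Fin 1 × Fin χ.degree) K)) := by
    ext ⟨i, a⟩ ⟨j, b⟩
    obtain ⟨i, rfl⟩ := finSumFinEquiv.surjective i
    obtain ⟨j, rfl⟩ := finSumFinEquiv.surjective j
    have hc : ∀ (m : ℕ) (X : Matrix (Fin m) (Fin m) (MonoidAlgebra F Γ)) (p q : Fin m),
        Matrix.compRingEquiv (Fin m) (Fin χ.degree) K
          ((χ.toMatrix.comp (MonoidAlgebra.mapRingHom Γ (algebraMap F K))).mapMatrix X)
          (p, a) (q, b) =
        χ.toMatrix (MonoidAlgebra.mapRingHom Γ (algebraMap F K) (X p q)) a b :=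
      fun _ _ _ _ => rfl
    rw [hc]
    rcases i with i | i <;> rcases j with j | j
    · simp [stab]
    · simp [stab]
    · simp [stab]
    · have hij : i = j := Subsingleton.elim i j
      simp [stab, hij, Matrix.one_apply]
  apply Units.ext
  change Matrix.det (Matrix.compRingEquiv (Fin (n + 1)) (Fin χ.degree) K
      ((χ.toMatrix.comp (MonoidAlgebra.mapRingHom Γ (algebraMap F K))).mapMatrix N.val)) = _
  rw [h, key, Matrix.det_reindex_self, Matrix.det_fromBlocks_zero₂₁, Matrix.det_one, mul_one]
  rfl

/-- The homomorphism `K₁(F[Γ]) → ∏_χ Kˣ`, `[M] ↦ (Det_χ(M))_χ`. -/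
noncomputable def detComponents :
    K1 (MonoidAlgebra F Γ) →+ (IrrChar K Γ → Additive Kˣ) :=
  K1.lift (fun M χ => Additive.ofMul (χ.Det F M.1 M.2)) fun x hx => by
    cases hx with
    | mul M N => ext1 χ; simp
    | stab M N h => ext1 χ; simp [IrrChar.Det_stab F K Γ χ M N h]

/-- The unit group `ζ(F[Γ])ˣ` of the centre of `F[Γ]`. -/
abbrev CenterUnits : Type _ := (Subring.center (MonoidAlgebra F Γ))ˣ

variable {F Γ} in
/-- A central unit of `F[Γ]`, regarded as an element of `K[Γ]`. -/
noncomputable def CenterUnits.extend (z : CenterUnits F Γ) : MonoidAlgebra K Γ :=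
  MonoidAlgebra.mapRingHom Γ (algebraMap F K) (z : Subring.center (MonoidAlgebra F Γ))

variable {F Γ} in
theorem mapRingHom_mem_center {z : MonoidAlgebra F Γ} (hz : z ∈ Subring.center (MonoidAlgebra F Γ)) :
    MonoidAlgebra.mapRingHom Γ (algebraMap F K) z ∈ Subring.center (MonoidAlgebra K Γ) := by
  rw [Subring.mem_center_iff] at hz ⊢
  intro y
  induction y using MonoidAlgebra.induction_linear with
  | zero => simp
  | add x y hx hy => rw [add_mul, mul_add, hx, hy]
  | single g a =>
    have h := congrArg (MonoidAlgebra.mapRingHom Γ (algebraMap F K)) (hz (MonoidAlgebra.single g 1))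
    rw [map_mul, map_mul, MonoidAlgebra.mapRingHom_single, map_one] at h
    have e : MonoidAlgebra.single g a = a • (MonoidAlgebra.single g 1 : MonoidAlgebra K Γ) := by
      simp
    rw [e, smul_mul_assoc, mul_smul_comm, h]

variable {F Γ} in
/-- The inclusion `ζ(F[Γ])ˣ → ζ(K[Γ])ˣ`. -/
noncomputable def CenterUnits.map : CenterUnits F Γ →* CenterUnits K Γ :=
  Units.map (RingHom.toMonoidHom
    (((MonoidAlgebra.mapRingHom Γ (algebraMap F K)).comp (Subring.center _).subtype).codRestrict
      (Subring.center (MonoidAlgebra K Γ)) fun z => mapRingHom_mem_center K z.2))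

/-- The reduced norm `Nrd : K₁(F[Γ]) → ζ(F[Γ])ˣ` for a field `F` of characteristic zero: `Nrd(v)` is
the unique central unit of `F[Γ]` with components `Nrd(v)_χ = Det_χ(v)`, for all irreducible
characters `χ` of `Γ` over the algebraic closure of `F`. -/
noncomputable def reducedNorm [Fintype Γ] (x : K1 (MonoidAlgebra F Γ)) : CenterUnits F Γ :=
  Function.invFun
    (fun (z : CenterUnits F Γ) (χ : IrrChar (AlgebraicClosure F) Γ) =>
      χ.coeff (z.extend (AlgebraicClosure F)))
    (fun χ => ((detComponents F (AlgebraicClosure F) Γ x χ).toMul : AlgebraicClosure F))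

end ReducedNorm

/-! ### The unramified characteristic and its twisted variant -/

section UnramifiedCharacteristic

open scoped Classical in
/-- The composite `δ = ∂¹ ∘ Nrd⁻¹ : ζ(ℚ_ℓ[Γ])ˣ → K₀(ℤ_ℓ[Γ], ℚ_ℓ[Γ])`. The reduced norm over `ℚ_ℓ` is
bijective for every finite group, so that the second case never occurs. -/
noncomputable def deltaMap (ℓ : ℕ) [Fact ℓ.Prime] {Γ : Type*} [Group Γ] [Fintype Γ]
    (z : CenterUnits ℚ_[ℓ] Γ) : K0 ℤ_[ℓ] (MonoidAlgebra ℤ_[ℓ] Γ) ℚ_[ℓ] :=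
  if h : Function.Bijective (reducedNorm ℚ_[ℓ] Γ) then
    boundary ℤ_[ℓ] ((Equiv.ofBijective _ h).symm z)
  else 0

open scoped Classical in
/-- The idempotent `e_I = |I|⁻¹ ∑_{g ∈ I} g` of `ℚ[Γ]`. -/
noncomputable def subgroupIdempotent {Γ : Type*} [Group Γ] [Fintype Γ] (I : Subgroup Γ) :
    MonoidAlgebra ℚ Γ :=
  (Nat.card I : ℚ)⁻¹ • ∑ g : Γ with g ∈ I, MonoidAlgebra.single g 1

/-- The algebraic closure `ℚ^c` of `ℚ` in `ℂ`. -/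
abbrev QBar : Type := algebraicClosure ℚ ℂ

variable (ℓ : ℕ) [Fact ℓ.Prime] (F E : Type*) [Field F] [Field E] [Algebra ℚ_[ℓ] F]
  [Algebra ℚ_[ℓ] E] [Algebra F E] [IsScalarTower ℚ_[ℓ] F E] [FiniteDimensional ℚ_[ℓ] E]
  [FiniteDimensional F E] [IsGalois F E]

open scoped Classical in
/-- The unramified characteristic `y(F, φ)` of an irreducible character `φ` of `Gal(E/F)`:
`(-1)^{φ(1)} det_φ(σ)` if `φ` is unramified (trivial on inertia), and `1` if it is ramified. -/
noncomputable def unramifiedChar (φ : IrrChar QBar (E ≃ₐ[F] E)) : QBar :=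
  if ∀ g ∈ inertiaGroup ℓ F E, φ g = φ 1 then
    (-1) ^ φ.degree * φ.det (frobenius ℓ F E)
  else 1

/-- The equivariant unramified characteristic `y_{E/F} = ∑ y(F, χ) e_χ`. -/
noncomputable def equivariantUnramifiedChar : MonoidAlgebra QBar (E ≃ₐ[F] E) :=
  centralElement (unramifiedChar ℓ F E)

/-- The element `(1 - ψ_{2,*})(y_{E/F})`, in `ℚ^c[Γ]`. -/
noncomputable def twistedCentral : MonoidAlgebra QBar (E ≃ₐ[F] E) :=
  adamsEndo 1 (-1) 2 (equivariantUnramifiedChar ℓ F E)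

/-- The element `(1 - ψ_{2,*})(y_{E/F})` of `ζ(ℚ[Γ])ˣ`: the unique element of this group with the given
image in `ℚ^c[Γ]`. -/
noncomputable def twistedCentralUnit : CenterUnits ℚ (E ≃ₐ[F] E) :=
  Function.invFun (CenterUnits.extend QBar) (twistedCentral ℓ F E)

/-- The image of `(1 - ψ_{2,*})(y_{E/F})` in `ζ(ℚ_ℓ[Γ])ˣ`. -/
noncomputable def twistedCentralUnitPadic : CenterUnits ℚ_[ℓ] (E ≃ₐ[F] E) :=
  CenterUnits.map ℚ_[ℓ] (twistedCentralUnit ℓ F E)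

/-- The twisted unramified characteristic
`𝔠_{E/F} = δ((1 - ψ_{2,*})(y_{E/F})) ∈ K₀(ℤ_ℓ[Γ], ℚ_ℓ[Γ])`. -/
noncomputable def twistedUnramifiedChar :
    K0 ℤ_[ℓ] (MonoidAlgebra ℤ_[ℓ] (E ≃ₐ[F] E)) ℚ_[ℓ] :=
  deltaMap ℓ (twistedCentralUnitPadic ℓ F E)

end UnramifiedCharacteristic

end LocalExt

/-!
Write `y` for the central element with component `-χ(σ)` at the unramified and `1` at the ramified
irreducible characters; this is `y_{E/F}`, because `Γ/I` is generated by the Frobenius lift `σ`,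
so that unramified irreducible characters are linear. At an unramified `χ` the character
`ψ₂ χ = χ²` is again unramified, and `(1 - ψ_{2,*})(y)` has the component `χ(σ)⁻¹`. At a ramified
`χ` the component is the inverse of the product of the values of `y` at the unramified
constituents of `ψ₂ χ`.

If `Γ` is abelian or of odd order, then `ψ₂ χ` has no unramified constituent for ramified `χ`
(`sum_sq_mul_inv_eq_zero_of_comm`, `sum_sq_mul_inv_eq_zero_of_odd`). Hence `(1 - ψ_{2,*})(y)` acts
in each irreducible representation as `(1 - e_I) + σ⁻¹ e_I` does, and both agree by Maschke's
theorem and Schur's lemma (`eq_centralElement`). For a totally ramified extension of odd degree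
`σ` lies in `I`, and this element is `1`.

If `E/F` is tamely ramified, then the tame character shows that `I = ⟨h⟩` is cyclic of order prime
to `ℓ` and that `τ = σ⁻¹` satisfies `τ⁻¹ h τ = h ^ q`, where `q` is the order of the residue field
of `F` (`IsTame.exists_isMetacyclic`). An irreducible representation of such a metacyclic group
has a basis `w i = τ ^ i v`, `i < d`, on which `h` acts by `ζ ^ q ^ i`, where `ζ` has order `f`
and `d` is the order of `q` modulo `f`; moreover `τ ^ d` acts as a scalar `α`
(`nonempty_eigenBasis`). For `f ≠ 1` the character `ψ₂ χ` has unramified constituents only if `-1`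
is a power of `q` modulo `f`. In this case `d = 2 m`, and the constituents are the `μ` with
`μ(τ) ^ m = α`, with multiplicity `1`, and those with `μ(τ) ^ m = -α`, with multiplicity `-1`
(`multiplicity_adams_two`), which makes the component `-1`.

So it suffices to find a unit of `ℤ_ℓ[Γ]` with these components as determinants
(`exists_unit_forall_det_eq`), as the boundary of the class of an integral unit is zero. A
polynomial `U` over `ℤ_ℓ` acts through `U(h)` with determinant `∏ i < d, U(ζ ^ q ^ i)`. The ring
`ℤ_ℓ[X]/(Φ_f)` is unramified over `ℤ_ℓ`, so `-1` is a norm for `X ↦ X ^ q`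
(`exists_polynomial_prod_aeval_eq_neg_one`): norms and traces of finite fields are onto, and one
lifts by successive approximation. As the order of `h` is invertible in `ℤ_ℓ`, the polynomials
obtained for the different `f` can be combined into one (`exists_polynomial_aeval_eq`). The unit
is `((1 - e_I) + τ e_I) U(h)`, and `e_I` is itself integral.
-/

set_option linter.unusedSectionVars false

/-! ### Elements of norm `-1` in unramified extensions of `ℤ_ℓ` -/

section FiniteFields

/-- The norm from a finite field to the fixed field of an automorphism is onto, so `-1` is a norm. -/
theorem exists_prod_pow_ringAut_eq_neg_one {k : Type*} [Field k] [Finite k] (ψ : RingAut k) :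
    ∃ u : k, ∏ i ∈ Finset.range (orderOf ψ), (ψ ^ i) u = -1 := by
  classical
  have hfin : Finite (RingAut k) := Finite.of_injective (fun f : RingAut k => (f : k → k))
    DFunLike.coe_injective
  let G := Subgroup.zpowers ψ
  let k₀ := FixedPoints.subfield G k
  have : Finite G := inferInstance
  have := Fintype.ofFinite G
  obtain ⟨u, hu⟩ := FiniteField.norm_surjective k₀ k (-1)
  refine ⟨u, ?_⟩
  have h := Algebra.norm_eq_prod_automorphisms k₀ u
  rw [hu, map_neg, map_one] at h
  rw [h, ← (FixedPoints.toAlgAut_bijective (G := G) (F := k)).prod_comp,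
    ← (finEquivZPowers (isOfFinOrder_of_finite ψ)).prod_comp, ← Fin.prod_univ_eq_prod_range
      (fun i => (ψ ^ i) u)]
  rfl

/-- By independence of characters, the trace to the fixed field of an automorphism of a field
does not vanish. -/
theorem exists_sum_pow_ringAut_ne_zero {k : Type*} [Field k] (ψ : RingAut k)
    (hψ : 0 < orderOf ψ) :
    ∃ t : k, ∑ i ∈ Finset.range (orderOf ψ), (ψ ^ i) t ≠ 0 := by
  by_contra! h
  have li := linearIndependent_monoidHom k k
  let F : Fin (orderOf ψ) → (k →* k) := fun i => ((ψ ^ (i : ℕ) : RingAut k) : k ≃* k).toMonoidHom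
  have hF : Function.Injective F := fun i j hij => by
    have : ψ ^ (i : ℕ) = ψ ^ (j : ℕ) := RingEquiv.ext fun x => DFunLike.congr_fun hij x
    exact Fin.ext (pow_injOn_Iio_orderOf i.2 j.2 this)
  have li2 := li.comp F hF
  rw [Fintype.linearIndependent_iff] at li2
  refine one_ne_zero (li2 (fun _ => 1) ?_ ⟨0, hψ⟩)
  ext x
  simpa [F, Finset.sum_range] using h x

variable {R : Type*} [CommRing R] [Finite R]

/-- In a finite ring, a product of finite fields, on which the `q`-power map is a
ring homomorphism acting on each residue field with order exactly `d`, there are an element of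
norm `-1` and one whose trace is a unit. -/
theorem exists_norm_trace_of_pow_ringHom (φ : R →+* R) {q d : ℕ} (hq : 2 ≤ q)
    (hφ : ∀ x, φ x = x ^ q) (hd : 0 < d) (hφd : ∀ x : R, x ^ q ^ d = x)
    (hfree : ∀ i, 0 < i → i < d → ∀ M : Ideal R, M.IsMaximal → ∃ x : R, x ^ q ^ i - x ∉ M) :
    (∃ u : R, ∏ i ∈ Finset.range d, u ^ q ^ i = -1) ∧
      ∃ t : R, IsUnit (∑ i ∈ Finset.range d, t ^ q ^ i) := by
  classical
  have hred : IsReduced R := by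
    refine (isReduced_iff_pow_one_lt (q ^ d) (Nat.one_lt_pow hd.ne' hq)).2 fun x hx => ?_
    rw [← hφd x, hx]
  have key : ∀ M : MaximalSpectrum R, ∃ u t : R ⧸ M.asIdeal,
      ∏ i ∈ Finset.range d, u ^ q ^ i = -1 ∧ ∑ i ∈ Finset.range d, t ^ q ^ i ≠ 0 := by
    intro M
    have hM := M.isMaximal
    let _ : Field (R ⧸ M.asIdeal) := Ideal.Quotient.field _
    have : Finite (R ⧸ M.asIdeal) := Finite.of_surjective _ Ideal.Quotient.mk_surjective
    let ψ₀ : (R ⧸ M.asIdeal) →+* (R ⧸ M.asIdeal) := Ideal.quotientMap M.asIdeal φ (by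
      intro x hx
      rw [Ideal.mem_comap, hφ]
      exact Ideal.pow_mem_of_mem _ hx _ (by omega))
    have hψ₀ : ∀ x, ψ₀ x = x ^ q := by
      intro x
      obtain ⟨x, rfl⟩ := Ideal.Quotient.mk_surjective x
      rw [Ideal.quotientMap_mk, hφ, map_pow]
    let ψ : RingAut (R ⧸ M.asIdeal) := RingEquiv.ofBijective ψ₀
      ⟨ψ₀.injective, Finite.surjective_of_injective ψ₀.injective⟩
    have hψ : ∀ i x, (ψ ^ i) x = x ^ q ^ i := by
      intro i
      induction i with
      | zero => simp
      | succ i ih =>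
        intro x
        rw [pow_succ, RingAut.mul_apply, ih]
        change (ψ₀ x) ^ q ^ i = _
        rw [hψ₀, ← pow_mul, pow_succ']
    have hord : orderOf ψ = d := by
      rw [orderOf_eq_iff hd]
      constructor
      · ext x
        obtain ⟨x, rfl⟩ := Ideal.Quotient.mk_surjective x
        rw [hψ, ← map_pow, hφd]
        rfl
      · intro i hi hi0 h
        obtain ⟨x, hx⟩ := hfree i hi0 hi M.asIdeal hM
        apply hx
        rw [← Ideal.Quotient.eq, map_pow, ← hψ, h]
        rfl
    obtain ⟨u, hu⟩ := exists_prod_pow_ringAut_eq_neg_one ψ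
    obtain ⟨t, ht⟩ := exists_sum_pow_ringAut_ne_zero ψ (by omega)
    simp only [hψ, hord] at hu ht
    exact ⟨u, t, hu, ht⟩
  -- a reduced artinian ring is the product of its residue fields
  choose u t hu ht using key
  let e := (IsArtinianRing.equivPi R).toRingEquiv
  refine ⟨⟨e.symm u, ?_⟩, ⟨e.symm t, ?_⟩⟩
  · apply e.injective
    rw [map_prod, map_neg, map_one]
    simp only [map_pow, RingEquiv.apply_symm_apply]
    ext M
    simpa using hu M
  · have : IsUnit (e (∑ i ∈ Finset.range d, e.symm t ^ q ^ i)) := by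
      simp only [map_sum, map_pow, RingEquiv.apply_symm_apply]
      rw [Pi.isUnit_iff]
      intro M
      have hM := M.isMaximal
      let _ : Field (R ⧸ M.asIdeal) := Ideal.Quotient.field _
      refine isUnit_iff_ne_zero.2 ?_
      simpa using ht M
    exact (isUnit_map_iff e _).1 this

end FiniteFields

section Lifting

theorem exists_prod_one_add_mul {B ι : Type*} [CommRing B] (s : Finset ι) (x : B) (a : ι → B) :
    ∃ c, ∏ i ∈ s, (1 + x * a i) = 1 + x * ∑ i ∈ s, a i + x ^ 2 * c := by
  classical
  induction s using Finset.induction_on with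
  | empty => exact ⟨0, by simp⟩
  | insert j s hj ih =>
    obtain ⟨c, hc⟩ := ih
    refine ⟨c + a j * ∑ i ∈ s, a i + x * a j * c, ?_⟩
    rw [Finset.prod_insert hj, Finset.sum_insert hj, hc]
    ring

variable {B : Type*} [CommRing B]

theorem map_prod_range_pow (φ : B →+* B) {d : ℕ} (hφd : φ ^ d = 1) (x : B) :
    φ (∏ i ∈ Finset.range d, (φ ^ i) x) = ∏ i ∈ Finset.range d, (φ ^ i) x := by
  rw [map_prod]
  have h : ∀ i, φ ((φ ^ i) x) = (φ ^ (i + 1)) x := fun i => by rw [pow_succ']; rfl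
  simp only [h]
  rcases d with _ | d
  · simp
  · rw [Finset.prod_range_succ, Finset.prod_range_succ' _ d, hφd, pow_zero]

theorem map_sum_range_pow (φ : B →+* B) {d : ℕ} (hφd : φ ^ d = 1) (x : B) :
    φ (∑ i ∈ Finset.range d, (φ ^ i) x) = ∑ i ∈ Finset.range d, (φ ^ i) x := by
  rw [map_sum]
  have h : ∀ i, φ ((φ ^ i) x) = (φ ^ (i + 1)) x := fun i => by rw [pow_succ']; rfl
  simp only [h]
  rcases d with _ | d
  · simp
  · rw [Finset.sum_range_succ, Finset.sum_range_succ' _ d, hφd, pow_zero]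

/-- Successive approximation: if `φ` is an automorphism of order `d` of an `ℓ`-adically complete
ring, some element has trace `1` and some element has norm `-1` modulo `ℓ`, then some element
has norm `-1`. -/
theorem exists_norm_eq_neg_one_of_mod (ℓ : B) [IsAdicComplete (Ideal.span {ℓ}) B] (φ : B →+* B)
    (hℓ : φ ℓ = ℓ) {d : ℕ} {t u₀ : B}
    (ht : ∑ i ∈ Finset.range d, (φ ^ i) t = 1) (hu₀ : ℓ ∣ ∏ i ∈ Finset.range d, (φ ^ i) u₀ + 1)
    (hφd : φ ^ d = 1) :
    ∃ u : B, ∏ i ∈ Finset.range d, (φ ^ i) u = -1 := by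
  have hfix : ∀ y, φ y = y → ∀ i, (φ ^ i) y = y := by
    intro y hy i
    induction i with
    | zero => rfl
    | succ i ih =>
      rw [pow_succ]
      change (φ ^ i) (φ y) = y
      rw [hy, ih]
  have step : ∀ k, 1 ≤ k → ∀ u, ℓ ^ k ∣ ∏ i ∈ Finset.range d, (φ ^ i) u + 1 →
      ∃ u', ℓ ^ k ∣ u' - u ∧ ℓ ^ (k + 1) ∣ ∏ i ∈ Finset.range d, (φ ^ i) u' + 1 := by
    rintro k hk u ⟨y, hy⟩
    -- if the norm of `u` is `-1 + ℓ ^ k y`, then `u (1 + ℓ ^ k y t)` is a better approximation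
    refine ⟨u * (1 + ℓ ^ k * (y * t)), ⟨u * (y * t), by ring⟩, ?_⟩
    have hy' : φ (ℓ ^ k * y) = ℓ ^ k * y := by
      rw [← hy, map_add, map_one, map_prod_range_pow φ hφd]
    have h1 : ∀ i, (φ ^ i) (u * (1 + ℓ ^ k * (y * t))) =
        (φ ^ i) u * (1 + ℓ ^ k * (φ ^ i) (y * t)) := by
      intro i
      have : (φ ^ i) (ℓ ^ k) = ℓ ^ k := hfix _ (by rw [map_pow, hℓ]) i
      rw [map_mul, map_add, map_one, map_mul (φ ^ i) (ℓ ^ k), this]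
    have h2 : ℓ ^ k * ∑ i ∈ Finset.range d, (φ ^ i) (y * t) = ℓ ^ k * y := by
      have h3 : ∀ i, ℓ ^ k * (φ ^ i) (y * t) = ℓ ^ k * y * (φ ^ i) t := by
        intro i
        have h4 : (φ ^ i) (ℓ ^ k) = ℓ ^ k := hfix _ (by rw [map_pow, hℓ]) i
        have h5 := hfix _ hy' i
        rw [map_mul, h4] at h5
        rw [map_mul, ← mul_assoc, h5]
      rw [Finset.mul_sum]
      simp only [h3]
      rw [← Finset.mul_sum, ht, mul_one]
    obtain ⟨c, hc⟩ := exists_prod_one_add_mul (Finset.range d) (ℓ ^ k) fun i => (φ ^ i) (y * t)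
    simp only [h1]
    rw [Finset.prod_mul_distrib, hc, h2, eq_sub_of_add_eq hy]
    refine Dvd.dvd.trans (pow_dvd_pow ℓ (show k + 1 ≤ k * 2 by omega)) ?_
    rw [pow_mul]
    exact ⟨y ^ 2 + (ℓ ^ k * y - 1) * c, by ring⟩
  let U : ∀ n : ℕ, {u : B // ℓ ^ (n + 1) ∣ ∏ i ∈ Finset.range d, (φ ^ i) u + 1} := fun n =>
    Nat.rec ⟨u₀, by simpa using hu₀⟩
      (fun n u => ⟨(step (n + 1) (by omega) u.1 u.2).choose,
        (step (n + 1) (by omega) u.1 u.2).choose_spec.2⟩) n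
  have hU : ∀ n, ℓ ^ (n + 1) ∣ (U (n + 1)).1 - (U n).1 := fun n =>
    (step (n + 1) (by omega) (U n).1 (U n).2).choose_spec.1
  have hmem : ∀ n (x : B), x ∈ (Ideal.span {ℓ} ^ n • ⊤ : Submodule B B) ↔ ℓ ^ n ∣ x := by
    intro n x
    rw [smul_eq_mul, Ideal.mul_top, Ideal.span_singleton_pow, Ideal.mem_span_singleton]
  -- the approximations form a Cauchy sequence, and its limit has norm `-1`
  have hU2 : ∀ {m n}, m ≤ n → ℓ ^ m ∣ (U n).1 - (U m).1 := by
    intro m n hmn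
    induction n, hmn using Nat.le_induction with
    | base => simp
    | succ n hn ih =>
      have := ((pow_dvd_pow ℓ (by omega : m ≤ n + 1)).trans (hU n)).add ih
      simpa using this
  obtain ⟨u, hu⟩ := IsPrecomplete.prec (I := Ideal.span {ℓ}) (M := B) inferInstance
    (f := fun n => (U n).1) fun {m n} hmn => by
      rw [SModEq.comm, SModEq.sub_mem, hmem]
      exact hU2 hmn
  refine ⟨u, ?_⟩
  rw [← sub_eq_zero, sub_neg_eq_add]
  refine IsHausdorff.haus (I := Ideal.span {ℓ}) (M := B) inferInstance _ fun n => ?_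
  rw [SModEq.zero, hmem]
  have h1 := hu n
  rw [SModEq.sub_mem, hmem] at h1
  have h2 := (pow_dvd_pow ℓ (by omega : n ≤ n + 1)).trans (U n).2
  rw [← Ideal.mem_span_singleton, ← Ideal.Quotient.eq_zero_iff_mem, map_add, map_prod] at h2 ⊢
  rw [← h2]
  congr 1
  refine Finset.prod_congr rfl fun i _ => ?_
  rw [Ideal.Quotient.eq, Ideal.mem_span_singleton, ← map_sub]
  have h3 : (φ ^ i) (ℓ ^ n) = ℓ ^ n := hfix _ (by rw [map_pow, hℓ]) i
  rw [← h3]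
  exact map_dvd _ ((dvd_neg.2 h1).trans (by simp))

/-- An unramified automorphism of order `d` of an `ℓ`-adically complete ring, which lifts the
`q`-power map, has an element of norm `-1`. -/
theorem exists_norm_eq_neg_one (ℓ : B) [IsAdicComplete (Ideal.span {ℓ}) B]
    [Finite (B ⧸ Ideal.span {ℓ})] (φ : B →+* B) (hℓ : φ ℓ = ℓ) {q d : ℕ} (hq : 2 ≤ q) (hd : 0 < d)
    (hφ : ∀ x, ℓ ∣ φ x - x ^ q) (hφd : φ ^ d = 1)
    (hfree : ∀ i, 0 < i → i < d → ∀ M : Ideal B, M.IsMaximal → ∃ x : B, (φ ^ i) x - x ∉ M) :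
    ∃ u : B, ∏ i ∈ Finset.range d, (φ ^ i) u = -1 := by
  let π := Ideal.Quotient.mk (Ideal.span {ℓ})
  have hπ : ∀ x y, π x = π y ↔ ℓ ∣ x - y := fun x y => by
    rw [Ideal.Quotient.eq, Ideal.mem_span_singleton]
  let φ' : (B ⧸ Ideal.span {ℓ}) →+* (B ⧸ Ideal.span {ℓ}) := Ideal.quotientMap _ φ (by
    rw [Ideal.span_singleton_le_iff_mem, Ideal.mem_comap, hℓ]
    exact Ideal.mem_span_singleton_self ℓ)
  have hφ' : ∀ x, φ' x = x ^ q := by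
    intro x
    obtain ⟨x, rfl⟩ := Ideal.Quotient.mk_surjective x
    rw [Ideal.quotientMap_mk, ← map_pow]
    exact (hπ _ _).2 (hφ x)
  have hpow : ∀ i x, π ((φ ^ i) x) = π x ^ q ^ i := by
    intro i
    induction i with
    | zero => simp
    | succ i ih =>
      intro x
      rw [pow_succ]
      change π ((φ ^ i) (φ x)) = _
      rw [ih, (hπ _ _).2 (hφ x), map_pow, ← pow_mul, pow_succ']
  obtain ⟨⟨u, hu⟩, ⟨t, ht⟩⟩ := exists_norm_trace_of_pow_ringHom φ' hq hφ' hd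
    (fun x => by
      obtain ⟨x, rfl⟩ := Ideal.Quotient.mk_surjective x
      rw [← hpow, hφd]
      rfl)
    (fun i hi hid M hM => by
      obtain ⟨x, hx⟩ := hfree i hi hid (M.comap π)
        (Ideal.comap_isMaximal_of_surjective _ Ideal.Quotient.mk_surjective)
      refine ⟨π x, ?_⟩
      rwa [← hpow, ← map_sub])
  obtain ⟨u, rfl⟩ := Ideal.Quotient.mk_surjective u
  obtain ⟨t, rfl⟩ := Ideal.Quotient.mk_surjective t
  change ∏ i ∈ Finset.range d, π u ^ q ^ i = -1 at hu
  change IsUnit (∑ i ∈ Finset.range d, π t ^ q ^ i) at ht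
  simp only [← hpow, ← map_prod, ← map_sum] at hu ht
  -- the trace of `t` is a unit that is fixed by `φ`, so that `t` can be scaled to have trace `1`
  have htu : IsUnit (∑ i ∈ Finset.range d, (φ ^ i) t) := by
    obtain ⟨w, hw⟩ := ht.exists_right_inv
    obtain ⟨w, rfl⟩ := Ideal.Quotient.mk_surjective w
    have h1 : (∑ i ∈ Finset.range d, (φ ^ i) t) * w - 1 ∈ Ideal.span {ℓ} := by
      rw [← Ideal.Quotient.eq, map_mul, map_one]
      exact hw
    have h2 := IsAdicComplete.le_jacobson_bot (Ideal.span {ℓ}) h1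
    rw [Ideal.mem_jacobson_bot] at h2
    have h3 := h2 1
    rw [mul_one, sub_add_cancel] at h3
    exact isUnit_of_mul_isUnit_left h3
  obtain ⟨T, hT⟩ := htu
  have hTinv : ∀ i, (φ ^ i) (T⁻¹ : Bˣ) = (T⁻¹ : Bˣ) := by
    have h1 : φ T = T := by rw [hT, map_sum_range_pow φ hφd]
    have h2 : Units.map (φ : B →* B) T = T := Units.ext h1
    intro i
    induction i with
    | zero => rfl
    | succ i ih =>
      rw [pow_succ]
      change (φ ^ i) (φ (T⁻¹ : Bˣ)) = _
      have h3 : φ (T⁻¹ : Bˣ) = (T⁻¹ : Bˣ) := by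
        have := congrArg Units.val (congrArg (·⁻¹) h2)
        simpa using this
      rw [h3, ih]
  refine exists_norm_eq_neg_one_of_mod ℓ φ hℓ (t := t * (T⁻¹ : Bˣ)) (u₀ := u) ?_ ?_ hφd
  · simp only [map_mul, hTinv]
    rw [← Finset.sum_mul, ← hT, Units.mul_inv]
  · rw [← sub_neg_eq_add, ← hπ, map_neg, map_one, hu]

end Lifting

section PadicCyclotomic

open Polynomial

/-- A finite module over an `I`-adically complete noetherian ring is `I`-adically complete, since
its completion is the base change to the completed ring. -/
theorem isAdicComplete_of_finite {R M : Type} [CommRing R] [IsNoetherianRing R] (I : Ideal R)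
    [IsAdicComplete I R] [AddCommGroup M] [Module R M] [Module.Finite R M] :
    IsAdicComplete I M := by
  rw [← AdicCompletion.of_bijective_iff]
  have h1 := AdicCompletion.ofTensorProduct_bijective_of_finite_of_isNoetherian I M
  let e : M ≃ₗ[R] TensorProduct R (AdicCompletion I R) M :=
    (TensorProduct.lid R M).symm.trans
      (LinearEquiv.rTensor M (AdicCompletion.ofLinearEquiv I R))
  have h2 : ⇑(AdicCompletion.of I M) = AdicCompletion.ofTensorProduct I M ∘ e := by
    ext1 x
    have he : e x = (1 : AdicCompletion I R) ⊗ₜ[R] x := by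
      simp only [e, LinearEquiv.trans_apply, TensorProduct.lid_symm_apply,
        LinearEquiv.rTensor_tmul]
      rfl
    rw [Function.comp_apply, he, AdicCompletion.ofTensorProduct_tmul, one_smul]
  rw [h2]
  exact h1.comp e.bijective

variable (ℓ : ℕ) [hℓ : Fact ℓ.Prime]

theorem isAdicComplete_span_natCast (B : Type) [CommRing B] [Algebra ℤ_[ℓ] B]
    [Module.Finite ℤ_[ℓ] B] : IsAdicComplete (Ideal.span {(ℓ : B)}) B := by
  have h : Ideal.span {(ℓ : B)} =
      (IsLocalRing.maximalIdeal ℤ_[ℓ]).map (algebraMap ℤ_[ℓ] B) := by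
    rw [PadicInt.maximalIdeal_eq_span_p, Ideal.map_span, Set.image_singleton, map_natCast]
  rw [h, IsAdicComplete.map_algebraMap_iff]
  exact isAdicComplete_of_finite _

theorem finite_quotient_span_natCast (B : Type*) [CommRing B] [Algebra ℤ_[ℓ] B]
    [Module.Finite ℤ_[ℓ] B] : Finite (B ⧸ Ideal.span {(ℓ : B)}) := by
  have hk : ∀ x : IsLocalRing.maximalIdeal ℤ_[ℓ], ∀ y : B ⧸ Ideal.span {(ℓ : B)},
      (x : ℤ_[ℓ]) • y = 0 := by
    rintro ⟨x, hx⟩ y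
    rw [PadicInt.maximalIdeal_eq_span_p, Ideal.mem_span_singleton] at hx
    obtain ⟨x, rfl⟩ := hx
    obtain ⟨y, rfl⟩ := Ideal.Quotient.mk_surjective y
    rw [Algebra.smul_def, IsScalarTower.algebraMap_apply ℤ_[ℓ] B, Ideal.Quotient.algebraMap_eq,
      ← map_mul, Ideal.Quotient.eq_zero_iff_mem, Ideal.mem_span_singleton, map_mul, map_natCast,
      mul_assoc]
    exact dvd_mul_right _ _
  have htor : Module.IsTorsionBySet ℤ_[ℓ] (B ⧸ Ideal.span {(ℓ : B)})
      (IsLocalRing.maximalIdeal ℤ_[ℓ] : Set ℤ_[ℓ]) := fun y x => hk x y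
  let _ : Module (ℤ_[ℓ] ⧸ IsLocalRing.maximalIdeal ℤ_[ℓ]) (B ⧸ Ideal.span {(ℓ : B)}) :=
    htor.module
  have : IsScalarTower ℤ_[ℓ] (ℤ_[ℓ] ⧸ IsLocalRing.maximalIdeal ℤ_[ℓ])
      (B ⧸ Ideal.span {(ℓ : B)}) := htor.isScalarTower
  have : Module.Finite (ℤ_[ℓ] ⧸ IsLocalRing.maximalIdeal ℤ_[ℓ]) (B ⧸ Ideal.span {(ℓ : B)}) :=
    Module.Finite.of_restrictScalars_finite ℤ_[ℓ] _ _
  have hf : Finite (ℤ_[ℓ] ⧸ IsLocalRing.maximalIdeal ℤ_[ℓ]) :=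
    Finite.of_equiv _ (PadicInt.residueField (p := ℓ)).symm.toEquiv
  exact Module.finite_of_finite (ℤ_[ℓ] ⧸ IsLocalRing.maximalIdeal ℤ_[ℓ])

theorem natCast_mem_of_isMaximal {B : Type*} [CommRing B] [Algebra ℤ_[ℓ] B]
    [IsAdicComplete (Ideal.span {(ℓ : B)}) B] {M : Ideal B} (hM : M.IsMaximal) : (ℓ : B) ∈ M := by
  have h := IsAdicComplete.le_jacobson_bot (Ideal.span {(ℓ : B)})
    (Ideal.mem_span_singleton_self _)
  rw [Ideal.jacobson, Submodule.mem_sInf] at h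
  exact h M ⟨bot_le, hM⟩

theorem padicInt_dvd_pow_sub (a : ℤ_[ℓ]) : (ℓ : ℤ_[ℓ]) ∣ a - a ^ ℓ := by
  rw [← Ideal.mem_span_singleton, ← PadicInt.maximalIdeal_eq_span_p, ← PadicInt.ker_toZMod,
    RingHom.mem_ker, map_sub, map_pow, ZMod.pow_card, sub_self]

/-- The endomorphism of the `ℤ_ℓ`-algebra `ℤ_ℓ[X]/(Φ_f)` with `X ↦ X ^ ℓ`, for `f` prime to `ℓ`. It
is well defined as `Φ_f` divides `Φ_f(X ^ ℓ)`. -/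
noncomputable def cyclotomicFrobenius {f : ℕ} (hf : ¬ ℓ ∣ f) :
    AdjoinRoot (cyclotomic f ℤ_[ℓ]) →+* AdjoinRoot (cyclotomic f ℤ_[ℓ]) :=
  AdjoinRoot.lift (AdjoinRoot.of _) (AdjoinRoot.root _ ^ ℓ) (by
    have h := congrArg (eval₂ (AdjoinRoot.of _) (AdjoinRoot.root (cyclotomic f ℤ_[ℓ])))
      (cyclotomic_expand_eq_cyclotomic_mul hℓ.out hf ℤ_[ℓ])
    rw [eval₂_mul, AdjoinRoot.eval₂_root, mul_zero, eval₂_eq_eval_map,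
      map_expand, expand_eval, eval_map] at h
    exact h)

theorem cyclotomicFrobenius_pow_root {f : ℕ} (hf : ¬ ℓ ∣ f) (i : ℕ) :
    (cyclotomicFrobenius ℓ hf ^ i) (AdjoinRoot.root _) = AdjoinRoot.root _ ^ ℓ ^ i := by
  induction i with
  | zero => simp
  | succ i ih =>
    rw [pow_succ']
    change cyclotomicFrobenius ℓ hf ((cyclotomicFrobenius ℓ hf ^ i) _) = _
    rw [ih, map_pow, cyclotomicFrobenius, AdjoinRoot.lift_root, ← pow_mul, pow_succ']

theorem cyclotomicFrobenius_pow_of {f : ℕ} (hf : ¬ ℓ ∣ f) (i : ℕ) (a : ℤ_[ℓ]) :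
    (cyclotomicFrobenius ℓ hf ^ i) (AdjoinRoot.of _ a) = AdjoinRoot.of _ a := by
  induction i with
  | zero => simp
  | succ i ih =>
    rw [pow_succ']
    change cyclotomicFrobenius ℓ hf ((cyclotomicFrobenius ℓ hf ^ i) _) = _
    rw [ih, cyclotomicFrobenius, AdjoinRoot.lift_of]

/-- The endomorphism `X ↦ X ^ ℓ` of `ℤ_ℓ[X]/(Φ_f)` lifts the Frobenius endomorphism modulo `ℓ`. -/
theorem natCast_dvd_cyclotomicFrobenius_sub_pow {f : ℕ} (hf : ¬ ℓ ∣ f) (i : ℕ)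
    (x : AdjoinRoot (cyclotomic f ℤ_[ℓ])) :
    (ℓ : AdjoinRoot (cyclotomic f ℤ_[ℓ])) ∣ (cyclotomicFrobenius ℓ hf ^ i) x - x ^ ℓ ^ i := by
  let π := Ideal.Quotient.mk (Ideal.span {(ℓ : AdjoinRoot (cyclotomic f ℤ_[ℓ]))})
  have hπ : ∀ x y, π x = π y ↔ (ℓ : AdjoinRoot (cyclotomic f ℤ_[ℓ])) ∣ x - y := fun x y => by
    rw [Ideal.Quotient.eq, Ideal.mem_span_singleton]
  rw [← hπ, map_pow]
  have hc : (ℓ : AdjoinRoot (cyclotomic f ℤ_[ℓ]) ⧸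
      Ideal.span {(ℓ : AdjoinRoot (cyclotomic f ℤ_[ℓ]))}) = 0 := by
    rw [← map_natCast π, Ideal.Quotient.eq_zero_iff_mem]
    exact Ideal.mem_span_singleton_self _
  rcases subsingleton_or_nontrivial (AdjoinRoot (cyclotomic f ℤ_[ℓ]) ⧸
    Ideal.span {(ℓ : AdjoinRoot (cyclotomic f ℤ_[ℓ]))}) with hs | hn
  · exact Subsingleton.elim _ _
  have : CharP (AdjoinRoot (cyclotomic f ℤ_[ℓ]) ⧸
      Ideal.span {(ℓ : AdjoinRoot (cyclotomic f ℤ_[ℓ]))}) ℓ :=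
    (CharP.charP_iff_prime_eq_zero hℓ.out).2 hc
  have hfr : ∀ x, π x ^ ℓ ^ i = ((iterateFrobenius _ ℓ i).comp π) x := fun x => rfl
  rw [hfr]
  change (π.comp (cyclotomicFrobenius ℓ hf ^ i)) x = _
  congr 1
  refine AdjoinRoot.ringHom_ext (RingHom.ext fun a => ?_) ?_
  · simp only [RingHom.comp_apply, cyclotomicFrobenius_pow_of, iterateFrobenius_def]
    induction i with
    | zero => simp
    | succ i ih =>
      rw [pow_succ, pow_mul, ← ih (fun _ => rfl), ← map_pow, hπ, ← map_pow, ← map_sub,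
        ← map_natCast (AdjoinRoot.of (cyclotomic f ℤ_[ℓ]))]
      exact map_dvd _ (padicInt_dvd_pow_sub ℓ a)
  · simp only [RingHom.comp_apply, cyclotomicFrobenius_pow_root, iterateFrobenius_def, map_pow]

/-- The ring `ℤ_ℓ[X]/(Φ_f)`, with `f` prime to `ℓ`, is unramified over `ℤ_ℓ`, so that `-1` is a
norm for the action of `X ↦ X ^ q`. The result is stated in terms of the values at
primitive roots of unity of a representing polynomial. -/
theorem exists_polynomial_prod_aeval_eq_neg_one {f : ℕ} (hf0 : f ≠ 0) (hf : ¬ ℓ ∣ f) {a : ℕ}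
    (ha : 0 < a) :
    ∃ p : ℤ_[ℓ][X], ∀ {K : Type*} [CommRing K] [IsDomain K] [Algebra ℤ_[ℓ] K] (ζ : K),
      IsPrimitiveRoot ζ f →
        ∏ i ∈ Finset.range (orderOf ((ℓ ^ a : ℕ) : ZMod f)), aeval (ζ ^ (ℓ ^ a) ^ i) p = -1 := by
  have : NeZero f := ⟨hf0⟩
  set d := orderOf ((ℓ ^ a : ℕ) : ZMod f) with hd
  have hcop : (ℓ ^ a).Coprime f := ((Nat.Prime.coprime_iff_not_dvd hℓ.out).2 hf).pow_left a
  have hd0 : 0 < d := by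
    rw [hd, ← ZMod.coe_unitOfCoprime _ hcop, orderOf_units]
    exact orderOf_pos _
  have hmod : ∀ i, f ∣ (ℓ ^ a) ^ i - 1 ↔ ((ℓ ^ a : ℕ) : ZMod f) ^ i = 1 := by
    intro i
    rw [← Nat.modEq_iff_dvd' (Nat.one_le_pow _ _ (pow_pos hℓ.out.pos a)),
      ← ZMod.natCast_eq_natCast_iff, eq_comm]
    simp
  let B := AdjoinRoot (cyclotomic f ℤ_[ℓ])
  have : Module.Finite ℤ_[ℓ] B := (cyclotomic.monic f _).finite_adjoinRoot
  have hcomp : IsAdicComplete (Ideal.span {(ℓ : B)}) B := isAdicComplete_span_natCast ℓ B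
  have hfin := finite_quotient_span_natCast ℓ B
  let φ : B →+* B := cyclotomicFrobenius ℓ hf ^ a
  have hroot : ∀ i, (φ ^ i) (AdjoinRoot.root _) = AdjoinRoot.root _ ^ (ℓ ^ a) ^ i := fun i => by
    rw [← pow_mul, cyclotomicFrobenius_pow_root, pow_mul]
  have hof : ∀ i x, (φ ^ i) (AdjoinRoot.of _ x) = AdjoinRoot.of _ x := fun i x => by
    rw [← pow_mul, cyclotomicFrobenius_pow_of]
  have hroot1 : (AdjoinRoot.root (cyclotomic f ℤ_[ℓ])) ^ f = 1 := by
    have h : (cyclotomic f ℤ_[ℓ]) ∣ X ^ f - 1 := cyclotomic.dvd_X_pow_sub_one f _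
    have h2 := AdjoinRoot.mk_eq_zero.2 h
    rwa [map_sub, map_pow, map_one, AdjoinRoot.mk_X, sub_eq_zero] at h2
  obtain ⟨u, hu⟩ := exists_norm_eq_neg_one (ℓ : B) φ (map_natCast φ ℓ) (q := ℓ ^ a) (d := d)
    (Nat.one_lt_pow ha.ne' hℓ.out.one_lt) hd0
    (natCast_dvd_cyclotomicFrobenius_sub_pow ℓ hf a)
    (by
      refine AdjoinRoot.ringHom_ext (RingHom.ext fun x => hof d x) ?_
      rw [hroot]
      obtain ⟨c, hc⟩ := (hmod d).2 (pow_orderOf_eq_one _)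
      have : (ℓ ^ a) ^ d = f * c + 1 := by
        have := Nat.one_le_pow d _ (pow_pos hℓ.out.pos a)
        omega
      rw [this, pow_succ, pow_mul, hroot1, one_pow, one_mul]
      rfl)
    (by
      -- `X` is still a primitive `f`-th root of unity modulo each maximal ideal `M`, so `φ ^ i` is
      -- the identity modulo `M` only if `f` divides `ℓ ^ (a i) - 1`
      intro i hi hid M hM
      refine ⟨AdjoinRoot.root _, fun hmem => ?_⟩
      let _ : Field (B ⧸ M) := Ideal.Quotient.field M
      have hℓM : ((ℓ : ℕ) : B ⧸ M) = 0 := by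
        rw [← map_natCast (Ideal.Quotient.mk M), Ideal.Quotient.eq_zero_iff_mem]
        exact natCast_mem_of_isMaximal ℓ hM
      have : CharP (B ⧸ M) ℓ := (CharP.charP_iff_prime_eq_zero hℓ.out).2 hℓM
      have : NeZero ((f : ℕ) : B ⧸ M) := ⟨fun h => hf ((CharP.cast_eq_zero_iff _ ℓ f).1 h)⟩
      have hprim : IsPrimitiveRoot (Ideal.Quotient.mk M (AdjoinRoot.root _)) f := by
        rw [← isRoot_cyclotomic_iff, IsRoot.def,
          ← map_cyclotomic f ((Ideal.Quotient.mk M).comp (AdjoinRoot.of _)), eval_map,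
          ← hom_eval₂, AdjoinRoot.eval₂_root, map_zero]
      rw [hroot, ← Ideal.Quotient.eq, map_pow] at hmem
      have h1 : Ideal.Quotient.mk M (AdjoinRoot.root (cyclotomic f ℤ_[ℓ])) ^ ((ℓ ^ a) ^ i - 1) =
          1 := by
        have h0 := hprim.ne_zero hf0
        refine mul_right_cancel₀ h0 ?_
        rw [← pow_succ, Nat.sub_add_cancel (Nat.one_le_pow _ _ (pow_pos hℓ.out.pos a)), hmem,
          one_mul]
      have h2 := (hmod i).1 (hprim.dvd_of_pow_eq_one _ h1)
      exact absurd (orderOf_dvd_of_pow_eq_one h2) (Nat.not_dvd_of_pos_of_lt hi hid))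
  -- evaluation at `ζ` carries the conjugates of the class of `p` to the values at `ζ ^ ℓ ^ (a i)`
  obtain ⟨p, rfl⟩ := AdjoinRoot.mk_surjective u
  refine ⟨p, fun {K} _ _ _ ζ hζ => ?_⟩
  let ev : B →+* K := AdjoinRoot.lift (algebraMap ℤ_[ℓ] K) ζ (by
    rw [← eval_map, map_cyclotomic]
    exact hζ.isRoot_cyclotomic (Nat.pos_of_ne_zero hf0))
  have hev : ∀ i, ev ((φ ^ i) (AdjoinRoot.mk _ p)) = aeval (ζ ^ (ℓ ^ a) ^ i) p := by
    intro i
    have h1 : (ev.comp (φ ^ i)).comp (AdjoinRoot.mk _) =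
        (aeval (ζ ^ (ℓ ^ a) ^ i) : ℤ_[ℓ][X] →ₐ[ℤ_[ℓ]] K).toRingHom := by
      refine ringHom_ext (fun x => ?_) ?_
      · change ev ((φ ^ i) (AdjoinRoot.mk _ (C x))) = aeval _ (C x)
        rw [AdjoinRoot.mk_C, hof, aeval_C]
        exact AdjoinRoot.lift_of _
      · change ev ((φ ^ i) (AdjoinRoot.mk _ X)) = aeval _ X
        rw [AdjoinRoot.mk_X, hroot, map_pow, aeval_X]
        exact congrArg (· ^ _) (AdjoinRoot.lift_root _)
    exact RingHom.congr_fun h1 p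
  have := congrArg ev hu
  simpa only [map_prod, hev, map_neg, map_one] using this

end PadicCyclotomic

/-! ### Inertia groups of local rings -/

section LocalRing

open IsLocalRing

variable {S G : Type*} [CommRing S] [IsLocalRing S] [Group G] [MulSemiringAction G S]

theorem smul_mem_maximalIdeal_iff (g : G) (x : S) :
    g • x ∈ maximalIdeal S ↔ x ∈ maximalIdeal S := by
  rw [mem_maximalIdeal, mem_maximalIdeal, mem_nonunits_iff, mem_nonunits_iff, not_iff_not]
  exact isUnit_map_iff (MulSemiringAction.toRingEquiv G S g) x

theorem normal_inertia_maximalIdeal : ((maximalIdeal S).inertia G).Normal := by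
  refine ⟨fun h hh g x => ?_⟩
  have h1 := (smul_mem_maximalIdeal_iff g _).2 (hh (g⁻¹ • x))
  rw [smul_sub, smul_inv_smul, ← mul_smul, ← mul_smul] at h1
  exact h1

variable [IsDomain S] {π : S} (hπ0 : π ≠ 0) (hπ : maximalIdeal S = Ideal.span {π})

omit [IsDomain S] in
include hπ in
theorem exists_smul_uniformizer (g : G) : ∃ c, g • π = c * π := by
  have h : g • π ∈ maximalIdeal S :=
    (smul_mem_maximalIdeal_iff g π).2 (hπ ▸ Ideal.mem_span_singleton_self π)
  rw [hπ, Ideal.mem_span_singleton'] at h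
  obtain ⟨c, hc⟩ := h
  exact ⟨c, hc.symm⟩

include hπ0 in
theorem choose_smul_uniformizer {g : G} {c : S} (hc : g • π = c * π) :
    (exists_smul_uniformizer hπ g).choose = c :=
  mul_right_cancel₀ hπ0 ((exists_smul_uniformizer hπ g).choose_spec.symm.trans hc)

/-- The tame character `g ↦ g(π)/π`, with values in the residue field, of the inertia
group of a local ring with principal maximal ideal `(π)`. -/
noncomputable def tameCharacter : (maximalIdeal S).inertia G →* ResidueField S where
  toFun g := residue S (exists_smul_uniformizer hπ (g : G)).choose
  map_one' := by
    rw [choose_smul_uniformizer hπ0 hπ (c := 1) (by simp), map_one]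
  map_mul' g h := by
    obtain ⟨b, hb⟩ := exists_smul_uniformizer hπ (g : G)
    obtain ⟨c, hc⟩ := exists_smul_uniformizer hπ (h : G)
    have hgh : ((g * h : (maximalIdeal S).inertia G) : G) • π = ((g : G) • c * b) * π := by
      rw [Subgroup.coe_mul, mul_smul, hc, smul_mul', hb, mul_assoc]
    rw [choose_smul_uniformizer hπ0 hπ hgh, choose_smul_uniformizer hπ0 hπ hb,
      choose_smul_uniformizer hπ0 hπ hc, map_mul, mul_comm]
    congr 1
    exact Ideal.Quotient.eq.2 (g.2 c)

theorem tameCharacter_eq (g : (maximalIdeal S).inertia G) {c : S} (hc : (g : G) • π = c * π) :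
    tameCharacter hπ0 hπ g = residue S c :=
  congrArg (residue S) (choose_smul_uniformizer hπ0 hπ hc)

/-- Conjugation by an element that induces the `q`-power map on the residue field raises the tame
character to the `q`-th power. -/
theorem tameCharacter_conj {σ : G} {q : ℕ}
    (hσ : ∀ x : S, σ • x - x ^ q ∈ maximalIdeal S) (g g' : (maximalIdeal S).inertia G)
    (hg' : (g' : G) = σ * g * σ⁻¹) :
    tameCharacter hπ0 hπ g' = tameCharacter hπ0 hπ g ^ q := by
  obtain ⟨w, hw⟩ := exists_smul_uniformizer hπ σ⁻¹
  obtain ⟨c, hc⟩ := exists_smul_uniformizer hπ (g : G)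
  obtain ⟨c', hc'⟩ := exists_smul_uniformizer hπ (g' : G)
  rw [tameCharacter_eq hπ0 hπ g hc, tameCharacter_eq hπ0 hπ g' hc']
  have h1 : π = σ • w * σ • π := by rw [← smul_mul', ← hw, smul_inv_smul]
  have hw' : σ • w ∉ maximalIdeal S := by
    intro h
    rw [hπ, Ideal.mem_span_singleton'] at h
    obtain ⟨a, ha⟩ := h
    obtain ⟨b, hb⟩ := exists_smul_uniformizer hπ σ
    rw [← ha, hb] at h1
    have h2 : π * 1 = π * (a * b * π) := by linear_combination h1
    have h3 := mul_left_cancel₀ hπ0 h2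
    have h4 : π ∈ maximalIdeal S := hπ ▸ Ideal.mem_span_singleton_self π
    exact (mem_maximalIdeal π).1 h4 (IsUnit.of_mul_eq_one (a * b) (by rw [h3]; ring))
  -- compute `(σ g σ⁻¹) π` with `σ⁻¹ π = w π` and `g π = c π`
  have h2 : c' * σ • w = σ • ((g : G) • w) * σ • c := by
    refine mul_right_cancel₀ hπ0 ?_
    have h3 : (g' : G) • π = σ • ((g : G) • w) * (σ • c * σ • π) := by
      rw [hg', mul_smul, mul_smul, hw, smul_mul', smul_mul', hc, smul_mul']
    calc c' * σ • w * π = (g' : G) • π * σ • w := by rw [hc']; ring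
      _ = σ • ((g : G) • w) * σ • c * (σ • w * σ • π) := by rw [h3]; ring
      _ = _ := by rw [← h1]
  have h3 : residue S (σ • ((g : G) • w)) = residue S (σ • w) := by
    refine Ideal.Quotient.eq.2 ?_
    rw [← smul_sub]
    exact (smul_mem_maximalIdeal_iff σ _).2 (g.2 w)
  have h4 : residue S (σ • c) = residue S c ^ q := by
    rw [← map_pow]
    exact Ideal.Quotient.eq.2 (hσ c)
  have h5 := congrArg (residue S) h2
  rw [map_mul, map_mul, h3, h4, mul_comm] at h5
  exact mul_left_cancel₀ (fun h => hw' ((residue_eq_zero_iff _).1 h)) h5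

/-- If the order of the inertia group is invertible, then the tame character is injective:
an element of its kernel acts unipotently on each quotient by a power of the maximal ideal. -/
theorem tameCharacter_injective [IsNoetherianRing S] [FaithfulSMul G S]
    (hN : (Nat.card ((maximalIdeal S).inertia G) : S) ∉ maximalIdeal S) :
    Function.Injective (tameCharacter (G := G) hπ0 hπ) := by
  set N := Nat.card ((maximalIdeal S).inertia G) with hNdef
  rw [injective_iff_map_eq_one]
  intro g hg
  obtain ⟨c, hc⟩ := exists_smul_uniformizer hπ (g : G)
  rw [tameCharacter_eq hπ0 hπ g hc] at hg
  have hc1 : ∀ i, c ^ i - 1 ∈ maximalIdeal S := fun i => by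
    rw [← residue_eq_zero_iff, map_sub, map_pow, hg, one_pow, map_one, sub_self]
  have hgrade : ∀ i, ∀ y ∈ maximalIdeal S ^ i, (g : G) • y - y ∈ maximalIdeal S ^ (i + 1) := by
    intro i y hy
    rw [hπ, Ideal.span_singleton_pow, Ideal.mem_span_singleton'] at hy
    obtain ⟨z, rfl⟩ := hy
    have h1 : (g : G) • (z * π ^ i) - z * π ^ i =
        π ^ i * ((c ^ i - 1) * (g : G) • z + ((g : G) • z - z)) := by
      rw [smul_mul', smul_pow', hc]
      ring
    rw [h1, pow_succ]
    refine Ideal.mul_mem_mul (Ideal.pow_mem_pow (hπ ▸ Ideal.mem_span_singleton_self π) i) ?_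
    exact add_mem (Ideal.mul_mem_right _ _ (hc1 i)) (g.2 z)
  have hunit : IsUnit (N : S) := by simpa using hN
  have hk : ∀ k, ∀ x : S, (g : G) • x - x ∈ maximalIdeal S ^ k := by
    intro k
    induction k with
    | zero => simp
    | succ k ih =>
      intro x
      -- modulo the next power of the maximal ideal `(g - 1)² x` vanishes, so `(g ^ j - 1) x` is
      -- `j (g - 1) x`, and `j = N` gives the claim as `g ^ N = 1`
      have hj : ∀ j : ℕ, (g : G) ^ j • x - x - j * ((g : G) • x - x) ∈
          maximalIdeal S ^ (k + 1) := by
        intro j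
        induction j with
        | zero => simp
        | succ j ihj =>
          have h1 : (g : G) ^ j • x - x ∈ maximalIdeal S ^ k := by
            have h2 := add_mem (Ideal.pow_le_pow_right (Nat.le_succ k) ihj)
              (Ideal.mul_mem_left _ (j : S) (ih x))
            rwa [sub_add_cancel] at h2
          have h3 := add_mem (hgrade k _ h1) ihj
          rw [smul_sub, ← mul_smul, ← pow_succ'] at h3
          convert h3 using 1
          push_cast
          ring
      have h1 := hj N
      have h2 : (g : G) ^ N = 1 := by
        rw [← Subgroup.coe_pow, hNdef, pow_card_eq_one', Subgroup.coe_one]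
      rw [h2, one_smul, sub_self, zero_sub, neg_mem_iff] at h1
      exact (Ideal.unit_mul_mem_iff_mem _ hunit).1 h1
  have hfix : ∀ x : S, (g : G) • x = x := by
    intro x
    rw [← sub_eq_zero, ← Submodule.mem_bot S,
      ← Ideal.iInf_pow_eq_bot_of_isLocalRing (maximalIdeal S) Ideal.IsPrime.ne_top',
      Submodule.mem_iInf]
    exact fun k => hk k x
  exact Subtype.ext (FaithfulSMul.eq_of_smul_eq_smul (M := G) (α := S) fun x => by
    rw [hfix, Subgroup.coe_one, one_smul])

end LocalRing

/-! ### Inertia groups of extensions of `ℓ`-adic fields -/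

namespace LocalExt

section

variable (ℓ : ℕ) [hℓ : Fact ℓ.Prime] (F E : Type*) [Field F] [Field E] [Algebra ℚ_[ℓ] F]
  [Algebra ℚ_[ℓ] E] [Algebra F E] [IsScalarTower ℚ_[ℓ] F E] [FiniteDimensional ℚ_[ℓ] E]
  [FiniteDimensional F E] [IsGalois F E]

omit [Algebra F E] [IsScalarTower ℚ_[ℓ] F E] [FiniteDimensional F E] [IsGalois F E] in
theorem natCast_mem_maxIdeal : (ℓ : IntegerRing ℓ E) ∈ maxIdeal ℓ E := by
  rw [IsLocalRing.mem_maximalIdeal, mem_nonunits_iff]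
  intro h
  obtain ⟨u, hu⟩ := h.exists_right_inv
  have h1 := (mem_integerRing_iff ℓ E _).1 u.2
  have hℓ0 : (ℓ : ℚ_[ℓ]) ≠ 0 := Nat.cast_ne_zero.2 hℓ.out.ne_zero
  have h2 : (u : E) = algebraMap ℚ_[ℓ] E (ℓ : ℚ_[ℓ])⁻¹ := by
    have h3 : (ℓ : E) * (u : E) = 1 := by exact_mod_cast congrArg Subtype.val hu
    rw [map_inv₀, map_natCast]
    exact eq_inv_of_mul_eq_one_right h3
  rw [h2, spectralNorm_extends, norm_inv, Padic.norm_p, inv_inv] at h1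
  have : (1 : ℝ) < ℓ := by exact_mod_cast hℓ.out.one_lt
  linarith

omit [Algebra F E] [IsScalarTower ℚ_[ℓ] F E] [FiniteDimensional F E] [IsGalois F E] in
theorem natCast_mem_maxIdeal_iff (n : ℕ) : (n : IntegerRing ℓ E) ∈ maxIdeal ℓ E ↔ ℓ ∣ n := by
  constructor
  · intro h
    by_contra hn
    have hc := (Nat.Prime.coprime_iff_not_dvd hℓ.out).2 hn
    rw [← Nat.isCoprime_iff_coprime] at hc
    obtain ⟨a, b, hab⟩ := hc
    have h1 : (1 : IntegerRing ℓ E) ∈ maxIdeal ℓ E := by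
      have h2 : (1 : IntegerRing ℓ E) = a * ℓ + b * n := by
        have := congrArg (Int.cast : ℤ → IntegerRing ℓ E) hab.symm
        simpa using this
      rw [h2]
      exact add_mem (Ideal.mul_mem_left _ _ (natCast_mem_maxIdeal ℓ E)) (Ideal.mul_mem_left _ _ h)
    exact (Ideal.ne_top_iff_one _).1 (Ideal.IsPrime.ne_top inferInstance) h1
  · rintro ⟨m, rfl⟩
    rw [Nat.cast_mul]
    exact Ideal.mul_mem_right _ _ (natCast_mem_maxIdeal ℓ E)

omit [Algebra F E] [IsScalarTower ℚ_[ℓ] F E] [FiniteDimensional F E] [IsGalois F E] in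
theorem isDedekindDomain_integerRing : IsDedekindDomain (IntegerRing ℓ E) := by
  have : IsDedekindDomain (PadicInt.subring ℓ) := inferInstanceAs (IsDedekindDomain ℤ_[ℓ])
  exact integralClosure.isDedekindDomain (PadicInt.subring ℓ) ℚ_[ℓ] E

omit [Algebra F E] [IsScalarTower ℚ_[ℓ] F E] [FiniteDimensional F E] [IsGalois F E] in
theorem exists_uniformizer :
    ∃ π : IntegerRing ℓ E, π ≠ 0 ∧ maxIdeal ℓ E = Ideal.span {π} := by
  have := isDedekindDomain_integerRing ℓ E
  have hf : ¬ IsField (IntegerRing ℓ E) := by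
    rw [IsLocalRing.isField_iff_maximalIdeal_eq]
    intro h
    have h1 := natCast_mem_maxIdeal ℓ E
    rw [maxIdeal, h, Ideal.mem_bot] at h1
    have h2 : (ℓ : E) = 0 := congrArg Subtype.val h1
    have h3 : CharZero E := charZero_of_injective_algebraMap (algebraMap ℚ_[ℓ] E).injective
    exact hℓ.out.ne_zero (Nat.cast_eq_zero.1 h2)
  have hp := ((IsDiscreteValuationRing.TFAE (IntegerRing ℓ E) hf).out 2 4).1 this
  obtain ⟨π, hπ⟩ := hp.principal
  refine ⟨π, ?_, hπ⟩
  rintro rfl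
  apply hf
  rw [IsLocalRing.isField_iff_maximalIdeal_eq, hπ]
  simp

omit [FiniteDimensional F E] [IsGalois F E] in
instance : FaithfulSMul (E ≃ₐ[F] E) (IntegerRing ℓ E) := by
  refine ⟨fun {g h} hgh => AlgEquiv.ext fun x => ?_⟩
  have := integralClosure.isFractionRing_of_finite_extension (A := PadicInt.subring ℓ) ℚ_[ℓ] E
  obtain ⟨a, b, -, hab⟩ := IsFractionRing.div_surjective (A := IntegerRing ℓ E) x
  have h1 := fun y : IntegerRing ℓ E => congrArg Subtype.val (hgh y)
  change ∀ y : IntegerRing ℓ E, g (y : E) = h (y : E) at h1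
  rw [← hab, map_div₀, map_div₀]
  exact congrArg₂ _ (h1 a) (h1 b)

instance : IsGaloisGroup (E ≃ₐ[F] E) (IntegerRing ℓ F) (IntegerRing ℓ E) where
  faithful := inferInstance
  commutes := inferInstance
  isInvariant := inferInstance

instance inertiaGroup_normal : (inertiaGroup ℓ F E).Normal := normal_inertia_maximalIdeal

omit [FiniteDimensional F E] [IsGalois F E] in
theorem finite_quotient_under :
    Finite (IntegerRing ℓ F ⧸ (maxIdeal ℓ E).under (IntegerRing ℓ F)) :=
  Finite.of_injective _ (Ideal.algebraMap_quotient_injective (I := maxIdeal ℓ E))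

omit [FiniteDimensional F E] [IsGalois F E] in
theorem isMaximal_under : ((maxIdeal ℓ E).under (IntegerRing ℓ F)).IsMaximal :=
  have := finite_quotient_under ℓ F E
  Ideal.Quotient.maximal_of_isField _
    (Finite.isField_of_domain (IntegerRing ℓ F ⧸ (maxIdeal ℓ E).under (IntegerRing ℓ F)))

/-- The order of the residue field of `F`, that is, of the quotient of `𝓞_F` by the prime below the
maximal ideal of `𝓞_E`. -/
noncomputable def residueCard : ℕ :=
  Nat.card (IntegerRing ℓ F ⧸ (maxIdeal ℓ E).under (IntegerRing ℓ F))

omit [FiniteDimensional F E] [IsGalois F E] in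
theorem exists_residueCard_eq_pow : ∃ a, 0 < a ∧ residueCard ℓ F E = ℓ ^ a := by
  have := finite_quotient_under ℓ F E
  have := isMaximal_under ℓ F E
  let _ : Field (IntegerRing ℓ F ⧸ (maxIdeal ℓ E).under (IntegerRing ℓ F)) :=
    Ideal.Quotient.field _
  let _ := Fintype.ofFinite (IntegerRing ℓ F ⧸ (maxIdeal ℓ E).under (IntegerRing ℓ F))
  have h0 : ((ℓ : ℕ) : IntegerRing ℓ F ⧸ (maxIdeal ℓ E).under (IntegerRing ℓ F)) = 0 := by
    rw [← map_natCast (Ideal.Quotient.mk _), Ideal.Quotient.eq_zero_iff_mem, Ideal.mem_comap,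
      map_natCast]
    exact natCast_mem_maxIdeal ℓ E
  have : CharP (IntegerRing ℓ F ⧸ (maxIdeal ℓ E).under (IntegerRing ℓ F)) ℓ :=
    (CharP.charP_iff_prime_eq_zero hℓ.out).2 h0
  obtain ⟨a, -, ha⟩ :=
    FiniteField.card (IntegerRing ℓ F ⧸ (maxIdeal ℓ E).under (IntegerRing ℓ F)) ℓ
  exact ⟨a, a.pos, by rw [residueCard, Nat.card_eq_fintype_card, ha]⟩

open scoped Pointwise in
/-- The quotient `Γ/I` is generated by the class of a Frobenius lift: it embeds into the Galois
group of the residue fields, which is generated by the Frobenius automorphism. -/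
theorem exists_pow_mul_of_isFrobeniusLift {σ : E ≃ₐ[F] E} (hσ : IsFrobeniusLift ℓ F E σ)
    (g : E ≃ₐ[F] E) : ∃ k : ℕ, ∃ h ∈ inertiaGroup ℓ F E, g = σ ^ k * h := by
  have := finite_quotient_under ℓ F E
  have := isMaximal_under ℓ F E
  let _ : Field (IntegerRing ℓ E ⧸ maxIdeal ℓ E) := Ideal.Quotient.field _
  let _ : Field (IntegerRing ℓ F ⧸ (maxIdeal ℓ E).under (IntegerRing ℓ F)) :=
    Ideal.Quotient.field _
  let _ := Fintype.ofFinite (IntegerRing ℓ F ⧸ (maxIdeal ℓ E).under (IntegerRing ℓ F))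
  have hstab : g ∈ MulAction.stabilizer (E ≃ₐ[F] E) (maxIdeal ℓ E) := by
    rw [MulAction.mem_stabilizer_iff]
    ext x
    rw [Ideal.mem_pointwise_smul_iff_inv_smul_mem]
    exact smul_mem_maximalIdeal_iff g⁻¹ x
  let f := Ideal.Quotient.stabilizerHom (maxIdeal ℓ E) ((maxIdeal ℓ E).under (IntegerRing ℓ F))
    (E ≃ₐ[F] E) ⟨g, hstab⟩
  obtain ⟨k, hk⟩ := (FiniteField.bijective_frobeniusAlgEquivOfAlgebraic_pow
    (IntegerRing ℓ F ⧸ (maxIdeal ℓ E).under (IntegerRing ℓ F))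
    (IntegerRing ℓ E ⧸ maxIdeal ℓ E)).2 f
  have hσk : ∀ (j : ℕ) (y : IntegerRing ℓ E), Ideal.Quotient.mk (maxIdeal ℓ E) (σ ^ j • y) =
      Ideal.Quotient.mk (maxIdeal ℓ E) y ^ residueCard ℓ F E ^ j := by
    intro j
    induction j with
    | zero => simp
    | succ j ih =>
      intro y
      rw [pow_succ, mul_smul, ih, pow_succ', pow_mul]
      congr 1
      rw [← map_pow]
      exact Ideal.Quotient.eq.2 (hσ y)
  have h1 : ∀ y : IntegerRing ℓ E, g • y - σ ^ (k : ℕ) • y ∈ maxIdeal ℓ E := by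
    intro y
    rw [← Ideal.Quotient.eq, hσk]
    have h2 : f (Ideal.Quotient.mk _ y) = Ideal.Quotient.mk _ (g • y) :=
      Ideal.Quotient.stabilizerHom_apply ..
    rw [← h2, ← hk, AlgEquiv.coe_pow, FiniteField.coe_frobeniusAlgEquivOfAlgebraic_iterate,
      residueCard, Nat.card_eq_fintype_card]
  refine ⟨k, (σ ^ (k : ℕ))⁻¹ * g, fun x => ?_, by group⟩
  have h2 := (smul_mem_maximalIdeal_iff (σ ^ (k : ℕ))⁻¹ _).2 (h1 x)
  rw [smul_sub, inv_smul_smul, ← mul_smul] at h2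
  exact h2

theorem card_inertiaGroup : Nat.card (inertiaGroup ℓ F E) = ramificationIndex ℓ F E := by
  have : FiniteDimensional ℚ_[ℓ] F := FiniteDimensional.left ℚ_[ℓ] F E
  have h1 := isDedekindDomain_integerRing ℓ F
  have : IsDedekindDomain (PadicInt.subring ℓ) := inferInstanceAs (IsDedekindDomain ℤ_[ℓ])
  have : IsScalarTower (PadicInt.subring ℓ) (IntegerRing ℓ F) (IntegerRing ℓ E) :=
    IsScalarTower.of_algebraMap_eq fun x => Subtype.ext
      (IsScalarTower.algebraMap_apply ℚ_[ℓ] F E (x : ℚ_[ℓ]))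
  have : Module.Finite (PadicInt.subring ℓ) (IntegerRing ℓ E) :=
    IsIntegralClosure.finite (PadicInt.subring ℓ) ℚ_[ℓ] E (IntegerRing ℓ E)
  have : Module.Finite (IntegerRing ℓ F) (IntegerRing ℓ E) :=
    Module.Finite.of_restrictScalars_finite (PadicInt.subring ℓ) _ _
  have : FaithfulSMul (IntegerRing ℓ F) (IntegerRing ℓ E) := by
    rw [faithfulSMul_iff_algebraMap_injective]
    intro x y h
    exact Subtype.ext ((algebraMap F E).injective (congrArg Subtype.val h))
  have : Module.IsTorsionFree (IntegerRing ℓ F) (IntegerRing ℓ E) := inferInstance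
  have : Module.Flat (IntegerRing ℓ F) (IntegerRing ℓ E) := inferInstance
  have hfin := finite_quotient_under ℓ F E
  have := isMaximal_under ℓ F E
  have : Finite ((maxIdeal ℓ E).under (IntegerRing ℓ F)).ResidueField := Finite.of_surjective _
    (Ideal.bijective_algebraMap_quotient_residueField _).2
  refine (Ideal.card_inertia_eq_ramificationIdxIn (G := E ≃ₐ[F] E)
    ((maxIdeal ℓ E).under (IntegerRing ℓ F)) (maxIdeal ℓ E)).trans ?_
  exact Ideal.ramificationIdxIn_eq_ramificationIdx _ (maxIdeal ℓ E) (E ≃ₐ[F] E)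

/-- For tame ramification the inertia group embeds into the multiplicative group of the residue
field, and a Frobenius lift acts on its image by the `q`-power map. -/
theorem exists_tameCharacter (hN : ¬ ℓ ∣ Nat.card (inertiaGroup ℓ F E)) :
    ∃ κ : inertiaGroup ℓ F E →* IsLocalRing.ResidueField (IntegerRing ℓ E),
      Function.Injective κ ∧ ∀ σ, IsFrobeniusLift ℓ F E σ → ∀ g g' : inertiaGroup ℓ F E,
        (g' : E ≃ₐ[F] E) = σ * g * σ⁻¹ → κ g' = κ g ^ residueCard ℓ F E := by
  have := isDedekindDomain_integerRing ℓ E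
  obtain ⟨π, hπ0, hπ⟩ := exists_uniformizer ℓ E
  exact ⟨tameCharacter hπ0 hπ,
    tameCharacter_injective hπ0 hπ (fun h => hN ((natCast_mem_maxIdeal_iff ℓ E _).1 h)),
    fun σ hσ g g' hg => tameCharacter_conj hπ0 hπ hσ g g' hg⟩

theorem isCyclic_inertiaGroup (hN : ¬ ℓ ∣ Nat.card (inertiaGroup ℓ F E)) :
    IsCyclic (inertiaGroup ℓ F E) := by
  obtain ⟨κ, hκ, -⟩ := exists_tameCharacter ℓ F E hN
  exact isCyclic_of_injective_ringHom κ hκ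

theorem conj_eq_pow_residueCard (hN : ¬ ℓ ∣ Nat.card (inertiaGroup ℓ F E)) {σ : E ≃ₐ[F] E}
    (hσ : IsFrobeniusLift ℓ F E σ) {h : E ≃ₐ[F] E} (hh : h ∈ inertiaGroup ℓ F E) :
    σ * h * σ⁻¹ = h ^ residueCard ℓ F E := by
  obtain ⟨κ, hκ, hκσ⟩ := exists_tameCharacter ℓ F E hN
  have h1 := hκσ σ hσ ⟨h, hh⟩ ⟨σ * h * σ⁻¹, (inertiaGroup_normal ℓ F E).conj_mem h hh σ⟩ rfl
  rw [← map_pow] at h1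
  exact congrArg Subtype.val (hκ h1)

theorem inertiaGroup_eq_top (h : IsTotallyRamified ℓ F E) : inertiaGroup ℓ F E = ⊤ := by
  apply Subgroup.eq_top_of_card_eq
  rw [card_inertiaGroup, h, IsGalois.card_aut_eq_finrank]

theorem inv_mul_mem_inertiaGroup {σ σ' : E ≃ₐ[F] E} (hσ : IsFrobeniusLift ℓ F E σ)
    (hσ' : IsFrobeniusLift ℓ F E σ') : σ⁻¹ * σ' ∈ inertiaGroup ℓ F E := by
  have h1 := IsArithFrobAt.mul_inv_mem_inertia hσ' hσ
  exact (inertiaGroup_normal ℓ F E).mem_comm h1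

end

end LocalExt

/-! ### Central elements of group algebras and their components -/

namespace LocalExt

section Schur

variable {K : Type*} [Field K] [IsAlgClosed K] {Γ : Type*} [Group Γ]
  {V : Type*} [AddCommGroup V] [Module K V] [FiniteDimensional K V]

theorem asAlgebraHom_commute (ρ : Representation K Γ V) {z : MonoidAlgebra K Γ}
    (hz : z ∈ Subring.center (MonoidAlgebra K Γ)) (g : Γ) :
    ρ g * ρ.asAlgebraHom z = ρ.asAlgebraHom z * ρ g := by
  rw [← ρ.asAlgebraHom_single_one, ← map_mul, ← map_mul, Subring.mem_center_iff.1 hz]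

/-- Schur's lemma: an endomorphism that commutes with an irreducible representation is a scalar. -/
theorem exists_eq_smul_one_of_commute (ρ : Representation K Γ V) [ρ.IsIrreducible]
    {f : Module.End K V} (hf : ∀ g, ρ g * f = f * ρ g) : ∃ c : K, f = c • 1 := by
  let F : Representation.IntertwiningMap ρ ρ :=
    ⟨f, fun g => (hf g).symm⟩
  obtain ⟨c, hc⟩ :=
    (Representation.IsIrreducible.algebraMap_intertwiningMap_bijective_of_isAlgClosed
      (ρ := ρ)).2 F
  refine ⟨c, ?_⟩
  have := congrArg Representation.IntertwiningMap.toLinearMap hc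
  rw [Algebra.algebraMap_eq_smul_one] at this
  exact this.symm

omit [IsAlgClosed K] [FiniteDimensional K V] in
theorem trace_asAlgebraHom [Fintype Γ] (ρ : Representation K Γ V) (z : MonoidAlgebra K Γ) :
    LinearMap.trace K V (ρ.asAlgebraHom z) = ∑ g, z.coeff g * ρ.character g := by
  induction z using MonoidAlgebra.induction_linear with
  | zero => simp
  | add x y hx hy => simp [hx, hy, add_mul, Finset.sum_add_distrib]
  | single g a =>
    classical
    simp [Representation.character, MonoidAlgebra.coeff_single, Finsupp.single_apply]

omit [IsAlgClosed K] [FiniteDimensional K V] in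
theorem nontrivial_of_isIrreducible (ρ : Representation K Γ V) [h : ρ.IsIrreducible] :
    Nontrivial V := by
  by_contra hn
  rw [not_nontrivial_iff_subsingleton] at hn
  obtain ⟨x, y, hxy⟩ := h.exists_pair_ne
  exact hxy (Subrepresentation.toSubmodule_injective (Subsingleton.elim _ _))

variable [CharZero K] [Fintype Γ]

theorem finrank_ne_zero_of_isIrreducible (ρ : Representation K Γ V) [ρ.IsIrreducible] :
    (Module.finrank K V : K) ≠ 0 := by
  have := nontrivial_of_isIrreducible ρ
  exact Nat.cast_ne_zero.2 Module.finrank_pos.ne'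

/-- A central element acts in an irreducible representation by its component. -/
theorem asAlgebraHom_eq_smul_one (ρ : Representation K Γ V) [ρ.IsIrreducible]
    {z : MonoidAlgebra K Γ} (hz : z ∈ Subring.center (MonoidAlgebra K Γ)) :
    ρ.asAlgebraHom z = ((∑ g, z.coeff g * ρ.character g) / Module.finrank K V) • 1 := by
  obtain ⟨c, hc⟩ := exists_eq_smul_one_of_commute ρ (asAlgebraHom_commute ρ hz)
  have h := trace_asAlgebraHom ρ z
  rw [hc, map_smul, LinearMap.trace_one, smul_eq_mul] at h
  rw [hc, ← h, mul_div_cancel_right₀ _ (finrank_ne_zero_of_isIrreducible ρ)]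

omit [IsAlgClosed K] [FiniteDimensional K V] [CharZero K] [Fintype Γ] in
theorem isIrreducible_of_equiv {W : Type*} [AddCommGroup W] [Module K W]
    {ρ : Representation K Γ V} {ρ' : Representation K Γ W} (φ : ρ.Equiv ρ') [h : ρ.IsIrreducible] :
    ρ'.IsIrreducible := by
  rw [Representation.irreducible_iff_isSimpleModule_asModule] at h ⊢
  let f := Representation.IntertwiningMap.equivLinearMapAsModule ρ ρ' φ.toIntertwiningMap
  have hf : Function.Bijective f := φ.toLinearEquiv.bijective
  exact IsSimpleModule.congr (LinearEquiv.ofBijective f hf).symm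

omit [IsAlgClosed K] [CharZero K] [Fintype Γ] in
theorem exists_irrChar_eq_character (ρ : Representation K Γ V) [h : ρ.IsIrreducible] :
    ∃ χ : IrrChar K Γ, (χ : Γ → K) = ρ.character := by
  let e : V ≃ₗ[K] (Fin (Module.finrank K V) → K) := (Module.finBasis K V).equivFun
  let ρ' : Representation K Γ (Fin (Module.finrank K V) → K) :=
    { toFun := fun g => e.conj (ρ g)
      map_one' := by ext; simp
      map_mul' := fun g h => by
        rw [map_mul]
        exact LinearEquiv.conj_comp e _ _ }
  let φ : Representation.Equiv ρ ρ' := .mk e fun g => by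
    ext x
    simp [ρ', LinearEquiv.conj_apply]
  exact ⟨⟨ρ'.character, _, ρ', isIrreducible_of_equiv φ, rfl⟩, (Representation.char_iso φ).symm⟩

end Schur

namespace IrrChar

variable {K : Type*} [Field K] {Γ : Type*} [Group Γ] (χ : IrrChar K Γ)

theorem apply_one : χ 1 = (χ.degree : K) := by
  rw [← χ.character_rep, Representation.char_one, Module.finrank_fin_fun]

theorem apply_conj (g h : Γ) : χ (h * g * h⁻¹) = χ g := by
  rw [← χ.character_rep, Representation.char_conj]

section CharZero

variable [CharZero K]

theorem degree_ne_zero : χ.degree ≠ 0 := by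
  intro h
  obtain ⟨x, y, hxy⟩ := χ.isIrreducible_rep.exists_pair_ne
  have : IsEmpty (Fin χ.degree) := by rw [h]; infer_instance
  exact hxy (Subrepresentation.toSubmodule_injective (Subsingleton.elim _ _))

instance : Nonempty (Fin χ.degree) := ⟨⟨0, Nat.pos_of_ne_zero χ.degree_ne_zero⟩⟩

theorem apply_one_ne_zero : χ 1 ≠ 0 := by
  rw [apply_one]
  exact Nat.cast_ne_zero.2 χ.degree_ne_zero

variable [Fintype Γ]

theorem coeff_eq_of_asAlgebraHom_eq {z : MonoidAlgebra K Γ} {c : K}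
    (h : χ.rep.asAlgebraHom z = c • 1) : χ.coeff z = c := by
  have h1 := trace_asAlgebraHom χ.rep z
  rw [h, map_smul, LinearMap.trace_one, Module.finrank_fin_fun, character_rep, smul_eq_mul,
    ← apply_one] at h1
  rw [coeff, ← h1, mul_div_cancel_right₀ _ χ.apply_one_ne_zero]

/-- The map `z ↦ z_χ`, as a linear form on `K[Γ]`. -/
noncomputable def coeffLinear : MonoidAlgebra K Γ →ₗ[K] K where
  toFun := χ.coeff
  map_add' x y := by simp [coeff, add_mul, Finset.sum_add_distrib, add_div]
  map_smul' c x := by simp [coeff, mul_assoc, ← Finset.mul_sum, mul_div_assoc]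

theorem coeff_one : χ.coeff 1 = 1 := χ.coeff_eq_of_asAlgebraHom_eq (by simp)

variable [IsAlgClosed K]

theorem asAlgebraHom_rep {z : MonoidAlgebra K Γ} (hz : z ∈ Subring.center (MonoidAlgebra K Γ)) :
    χ.rep.asAlgebraHom z = χ.coeff z • 1 := by
  rw [asAlgebraHom_eq_smul_one χ.rep hz, character_rep, Module.finrank_fin_fun, ← apply_one]
  rfl

/-- Orthogonality of the irreducible characters. -/
theorem card_inv_mul_sum_mul (χ μ : IrrChar K Γ) [Decidable (χ = μ)] :
    (Fintype.card Γ : K)⁻¹ * ∑ g : Γ, χ g * μ g⁻¹ = if χ = μ then 1 else 0 := by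
  have hc : (Nat.card Γ : K) ≠ 0 := Nat.cast_ne_zero.2 Nat.card_pos.ne'
  let _ : Invertible (Nat.card Γ : K) := invertibleOfNonzero hc
  have h := Representation.char_orthonormal χ.rep μ.rep
  rw [character_rep, character_rep] at h
  rw [Fintype.card_eq_nat_card, h]
  by_cases hχ : χ = μ
  · subst hχ
    rw [if_pos rfl, if_pos ⟨Representation.Equiv.refl _⟩]
  · rw [if_neg hχ, if_neg]
    rintro ⟨e⟩
    apply hχ
    apply Subtype.ext
    rw [← character_rep χ, ← character_rep μ]
    exact (Representation.char_iso e).symm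

theorem coeff_idempotent (χ μ : IrrChar K Γ) [Decidable (χ = μ)] :
    χ.coeff μ.idempotent = if χ = μ then 1 else 0 := by
  classical
  have h := card_inv_mul_sum_mul χ μ
  have h1 : ∀ g, μ.idempotent.coeff g = μ 1 / (Fintype.card Γ : K) * μ g⁻¹ := fun g => by
    rw [idempotent, MonoidAlgebra.coeff_smul, Finsupp.smul_apply, MonoidAlgebra.coeff_sum,
      Finsupp.finsetSum_apply]
    simp [MonoidAlgebra.coeff_single, Finsupp.single_apply]
  have h2 : χ.coeff μ.idempotent =
      μ 1 / χ 1 * ((Fintype.card Γ : K)⁻¹ * ∑ g : Γ, χ g * μ g⁻¹) := by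
    rw [coeff, Finset.mul_sum, Finset.mul_sum, Finset.sum_div]
    refine Finset.sum_congr rfl fun g _ => ?_
    rw [h1]
    ring
  rw [h2, h]
  split_ifs with hχ
  · rw [hχ, mul_one, div_self μ.apply_one_ne_zero]
  · rw [mul_zero]

omit [IsAlgClosed K] [CharZero K] in
theorem idempotent_mem_center : χ.idempotent ∈ Subring.center (MonoidAlgebra K Γ) := by
  rw [Subring.mem_center_iff]
  intro y
  induction y using MonoidAlgebra.induction_linear with
  | zero => simp
  | add x y hx hy => rw [add_mul, mul_add, hx, hy]
  | single g a =>
    rw [idempotent, mul_smul_comm, smul_mul_assoc, Finset.mul_sum, Finset.sum_mul]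
    congr 1
    refine Fintype.sum_equiv (MulAut.conj g).toEquiv _ _ fun h => ?_
    have h1 : χ (MulAut.conj g h)⁻¹ = χ h⁻¹ := by
      rw [← map_inv, MulAut.conj_apply, apply_conj]
    rw [MonoidAlgebra.single_mul_single, MonoidAlgebra.single_mul_single]
    change _ = MonoidAlgebra.single (MulAut.conj g h * g) (χ (MulAut.conj g h)⁻¹ * a)
    rw [h1, MulAut.conj_apply, inv_mul_cancel_right, mul_comm a]

theorem coeff_centralElement (x : IrrChar K Γ → K) : χ.coeff (centralElement x) = x χ := by
  classical
  have := Fintype.ofFinite (IrrChar K Γ)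
  rw [centralElement, finsum_eq_sum_of_fintype]
  change χ.coeffLinear _ = _
  rw [map_sum, Finset.sum_eq_single χ]
  · rw [map_smul]
    change _ • χ.coeff _ = _
    rw [coeff_idempotent, if_pos rfl, smul_eq_mul, mul_one]
  · intro μ _ hμ
    rw [map_smul]
    change _ • χ.coeff _ = _
    rw [coeff_idempotent, if_neg hμ.symm, smul_zero]
  · simp

end CharZero

end IrrChar

section Components

variable {K : Type*} [Field K] [CharZero K] [IsAlgClosed K] {Γ : Type*} [Group Γ] [Fintype Γ]

theorem smul_mem_center (c : K) {z : MonoidAlgebra K Γ}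
    (hz : z ∈ Subring.center (MonoidAlgebra K Γ)) :
    c • z ∈ Subring.center (MonoidAlgebra K Γ) := by
  rw [Subring.mem_center_iff] at hz ⊢
  intro y
  rw [mul_smul_comm, smul_mul_assoc, hz]

theorem centralElement_mem_center (x : IrrChar K Γ → K) :
    centralElement x ∈ Subring.center (MonoidAlgebra K Γ) := by
  have := Fintype.ofFinite (IrrChar K Γ)
  rw [centralElement, finsum_eq_sum_of_fintype]
  exact sum_mem fun χ _ => smul_mem_center _ χ.idempotent_mem_center

theorem asAlgebraHom_ofModule' (M : Type*) [AddCommGroup M] [Module K M]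
    [Module (MonoidAlgebra K Γ) M] [IsScalarTower K (MonoidAlgebra K Γ) M]
    (a : MonoidAlgebra K Γ) (m : M) :
    (Representation.ofModule' (k := K) (G := Γ) M).asAlgebraHom a m = a • m := by
  have h : (Representation.ofModule' (k := K) (G := Γ) M).asAlgebraHom = Algebra.lsmul K K M :=
    (MonoidAlgebra.lift K (M →ₗ[K] M) Γ).apply_symm_apply _
  rw [h]
  rfl

theorem isIrreducible_ofModule' (M : Type*) [AddCommGroup M] [Module K M]
    [Module (MonoidAlgebra K Γ) M] [IsScalarTower K (MonoidAlgebra K Γ) M]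
    [h : IsSimpleModule (MonoidAlgebra K Γ) M] :
    (Representation.ofModule' (k := K) (G := Γ) M).IsIrreducible := by
  rw [Representation.irreducible_iff_isSimpleModule_asModule]
  let e : M ≃+ (Representation.ofModule' (k := K) (G := Γ) M).asModule := AddEquiv.refl M
  exact IsSimpleModule.congr (LinearEquiv.symm
    { e with map_smul' := fun a m => (asAlgebraHom_ofModule' M a m).symm })

/-- Irreducible representations with the same character are isomorphic. -/
theorem nonempty_equiv_of_character_eq {V W : Type*} [AddCommGroup V] [Module K V]
    [FiniteDimensional K V] [AddCommGroup W] [Module K W] [FiniteDimensional K W]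
    (ρ : Representation K Γ V) (ρ' : Representation K Γ W) [ρ.IsIrreducible] [ρ'.IsIrreducible]
    (h : ρ.character = ρ'.character) : Nonempty (ρ.Equiv ρ') := by
  have hc : (Nat.card Γ : K) ≠ 0 := Nat.cast_ne_zero.2 Nat.card_pos.ne'
  let _ : Invertible (Nat.card Γ : K) := invertibleOfNonzero hc
  have h1 := Representation.char_orthonormal ρ ρ
  rw [if_pos ⟨Representation.Equiv.refl _⟩] at h1
  have h2 := Representation.char_orthonormal ρ' ρ
  rw [← h, h1] at h2
  by_contra hn
  rw [if_neg hn] at h2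
  exact one_ne_zero h2

theorem asAlgebraHom_equiv {V W : Type*} [AddCommGroup V] [Module K V]
    [AddCommGroup W] [Module K W] {ρ : Representation K Γ V} {ρ' : Representation K Γ W}
    (φ : ρ.Equiv ρ') (z : MonoidAlgebra K Γ) (v : V) :
    φ (ρ.asAlgebraHom z v) = ρ'.asAlgebraHom z (φ v) := by
  induction z using MonoidAlgebra.induction_linear with
  | zero => simp
  | add x y hx hy => simp [hx, hy]
  | single g a =>
    rw [Representation.asAlgebraHom_single, Representation.asAlgebraHom_single,
      LinearMap.smul_apply, LinearMap.smul_apply, map_smul]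
    exact congrArg _ (Representation.IntertwiningMap.isIntertwining _ _ φ.toIntertwiningMap g v)

/-- An element that acts as zero in every irreducible representation vanishes: by Maschke's
theorem the regular representation is a sum of irreducible ones. -/
theorem eq_zero_of_asAlgebraHom_rep_eq_zero {z : MonoidAlgebra K Γ}
    (h : ∀ χ : IrrChar K Γ, χ.rep.asAlgebraHom z = 0) : z = 0 := by
  have hc : (Nat.card Γ : K) ≠ 0 := Nat.cast_ne_zero.2 Nat.card_pos.ne'
  have : NeZero (Nat.card Γ : K) := ⟨hc⟩
  have hfin : Module.Finite K (MonoidAlgebra K Γ) :=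
    Module.Finite.equiv (MonoidAlgebra.coeffLinearEquiv K).symm
  have hnoeth : IsNoetherian (MonoidAlgebra K Γ) (MonoidAlgebra K Γ) :=
    isNoetherian_of_tower K inferInstance
  have hker : ∀ N : Submodule (MonoidAlgebra K Γ) (MonoidAlgebra K Γ),
      IsSimpleModule (MonoidAlgebra K Γ) N → ∀ x ∈ N, z * x = 0 := by
    intro N hN x hx
    have hirr := isIrreducible_ofModule' (K := K) (Γ := Γ) N
    have hfd : FiniteDimensional K N := Module.Finite.trans (MonoidAlgebra K Γ) _
    obtain ⟨χ, hχ⟩ := exists_irrChar_eq_character (Representation.ofModule' (k := K) (G := Γ) N)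
    obtain ⟨φ⟩ := nonempty_equiv_of_character_eq (Representation.ofModule' (k := K) (G := Γ) N)
      χ.rep (by rw [← hχ, χ.character_rep])
    have h1 := asAlgebraHom_equiv φ z ⟨x, hx⟩
    rw [h χ, LinearMap.zero_apply] at h1
    have h2 : z • (⟨x, hx⟩ : N) = 0 :=
      (asAlgebraHom_ofModule' (K := K) (Γ := Γ) N z ⟨x, hx⟩).symm.trans
        (φ.toLinearEquiv.injective (h1.trans (map_zero φ.toLinearEquiv).symm))
    exact congrArg Subtype.val h2
  have h1 : ∀ x ∈ (⊤ : Submodule (MonoidAlgebra K Γ) (MonoidAlgebra K Γ)), z * x = 0 := by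
    intro x hx
    rw [← IsSemisimpleModule.sSup_simples_eq_top, sSup_eq_iSup'] at hx
    induction hx using Submodule.iSup_induction' with
    | mem N y hy => exact hker N.1 N.2 y hy
    | zero => exact mul_zero z
    | add y w _ _ hy hw => rw [mul_add, hy, hw, add_zero]
  simpa using h1 1 trivial

theorem ext_of_asAlgebraHom_rep {z w : MonoidAlgebra K Γ}
    (h : ∀ χ : IrrChar K Γ, χ.rep.asAlgebraHom z = χ.rep.asAlgebraHom w) : z = w := by
  rw [← sub_eq_zero]
  refine eq_zero_of_asAlgebraHom_rep_eq_zero fun χ => ?_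
  rw [map_sub, h, sub_self]

theorem ext_of_coeff {z w : MonoidAlgebra K Γ} (hz : z ∈ Subring.center (MonoidAlgebra K Γ))
    (hw : w ∈ Subring.center (MonoidAlgebra K Γ)) (h : ∀ χ : IrrChar K Γ, χ.coeff z = χ.coeff w) :
    z = w :=
  ext_of_asAlgebraHom_rep fun χ => by
    rw [χ.asAlgebraHom_rep hz, χ.asAlgebraHom_rep hw, h]

/-- A central element is determined by the scalars by which it acts in the irreducible
representations. -/
theorem eq_centralElement {z : MonoidAlgebra K Γ} {c : IrrChar K Γ → K}
    (h : ∀ χ : IrrChar K Γ, χ.rep.asAlgebraHom z = c χ • 1) : z = centralElement c :=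
  ext_of_asAlgebraHom_rep fun χ => by
    rw [h, χ.asAlgebraHom_rep (centralElement_mem_center c), χ.coeff_centralElement]

omit [IsAlgClosed K] in
theorem multiplicity_eq {ξ : Γ → K} {μ : IrrChar K Γ} {m : ℤ}
    (h : (Fintype.card Γ : K)⁻¹ * ∑ g : Γ, ξ g * μ g⁻¹ = m) : multiplicity ξ μ = m := by
  rw [multiplicity, h]
  exact Function.leftInverse_invFun Int.cast_injective m

theorem multiplicity_self (χ μ : IrrChar K Γ) [Decidable (χ = μ)] :
    multiplicity χ μ = if χ = μ then 1 else 0 := by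
  apply multiplicity_eq
  rw [IrrChar.card_inv_mul_sum_mul]
  split_ifs <;> simp

theorem virtualValue_irrChar (x : IrrChar K Γ → K) (χ : IrrChar K Γ) :
    virtualValue x χ = x χ := by
  classical
  rw [virtualValue, finprod_eq_single _ χ, multiplicity_self, if_pos rfl, zpow_one]
  intro μ hμ
  rw [multiplicity_self, if_neg hμ.symm, zpow_zero]

end Components

section Descent

variable {F : Type*} [Field F] {K : Type*} [Field K] [Algebra F K] {Γ : Type*} [Group Γ]

theorem CenterUnits.extend_injective :
    Function.Injective (CenterUnits.extend K : CenterUnits F Γ → MonoidAlgebra K Γ) := by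
  intro z w h
  apply Units.ext
  apply Subtype.ext
  have : Function.Injective (MonoidAlgebra.mapRingHom Γ (algebraMap F K)) :=
    MonoidAlgebra.map_injective (algebraMap F K).toAddMonoidHom (algebraMap F K).injective
  exact this h

variable [Fintype Γ]

/-- An element of `F[Γ]` that acts by nonzero scalars in all irreducible representations over an
algebraically closed extension field of `F` is a central unit of `F[Γ]`. -/
theorem exists_centerUnits_eq [CharZero K] [IsAlgClosed K] {x : MonoidAlgebra F Γ}
    {c : IrrChar K Γ → K} (hc : ∀ χ, c χ ≠ 0)
    (h : ∀ χ : IrrChar K Γ, χ.rep.asAlgebraHom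
      (MonoidAlgebra.mapRingHom Γ (algebraMap F K) x) = c χ • 1) :
    ∃ z : CenterUnits F Γ, ((z : Subring.center (MonoidAlgebra F Γ)) : MonoidAlgebra F Γ) = x ∧
      z.extend K = centralElement c := by
  have hinj : Function.Injective (MonoidAlgebra.mapRingHom Γ (algebraMap F K)) :=
    MonoidAlgebra.map_injective (algebraMap F K).toAddMonoidHom (algebraMap F K).injective
  have hx := eq_centralElement h
  have hmap : ∀ y, MonoidAlgebra.mapRingHom Γ (algebraMap F K) y ∈
      Subring.center (MonoidAlgebra K Γ) → y ∈ Subring.center (MonoidAlgebra F Γ) := by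
    intro y hy
    rw [Subring.mem_center_iff] at hy ⊢
    intro w
    apply hinj
    rw [map_mul, map_mul, hy]
  have hxc : x ∈ Subring.center (MonoidAlgebra F Γ) := hmap x (by
    rw [hx]
    exact centralElement_mem_center c)
  -- multiplication by `x` is injective, hence surjective for reasons of dimension
  let m : MonoidAlgebra F Γ →ₗ[F] MonoidAlgebra F Γ := LinearMap.mulLeft F x
  have hfin : Module.Finite F (MonoidAlgebra F Γ) :=
    Module.Finite.equiv (MonoidAlgebra.coeffLinearEquiv F).symm
  have hm : Function.Injective m := by
    rw [← LinearMap.ker_eq_bot, LinearMap.ker_eq_bot']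
    intro y hy
    apply hinj
    rw [map_zero]
    refine eq_zero_of_asAlgebraHom_rep_eq_zero fun χ => ?_
    have h1 := congrArg
      (fun t => χ.rep.asAlgebraHom (MonoidAlgebra.mapRingHom Γ (algebraMap F K) t))
      (show x * y = 0 from hy)
    simp only [map_mul, map_zero, h, smul_mul_assoc, one_mul] at h1
    exact (smul_eq_zero.1 h1).resolve_left (hc χ)
  obtain ⟨y, hy⟩ := LinearMap.injective_iff_surjective.1 hm 1
  have hxy : x * y = 1 := hy
  have hyx : y * x = 1 := by rw [Subring.mem_center_iff.1 hxc, hxy]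
  have hyc : y ∈ Subring.center (MonoidAlgebra F Γ) := by
    rw [Subring.mem_center_iff] at hxc ⊢
    intro w
    calc w * y = y * x * (w * y) := by rw [hyx, one_mul]
      _ = y * (w * (x * y)) := by rw [mul_assoc, ← mul_assoc x, ← hxc, mul_assoc]
      _ = y * w := by rw [hxy, mul_one]
  exact ⟨⟨⟨x, hxc⟩, ⟨y, hyc⟩, Subtype.ext hxy, Subtype.ext hyx⟩, rfl, hx⟩

variable [CharZero F]

/-- The reduced norm is determined by its components. -/
theorem reducedNorm_eq {v : K1 (MonoidAlgebra F Γ)} {z : CenterUnits F Γ}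
    (h : ∀ χ : IrrChar (AlgebraicClosure F) Γ, χ.coeff (z.extend (AlgebraicClosure F)) =
      ((detComponents F (AlgebraicClosure F) Γ v χ).toMul : AlgebraicClosure F)) :
    reducedNorm F Γ v = z := by
  have : CharZero (AlgebraicClosure F) := charZero_of_injective_algebraMap
    (algebraMap F (AlgebraicClosure F)).injective
  rw [reducedNorm, ← funext h]
  refine Function.leftInverse_invFun (f := fun (z : CenterUnits F Γ)
    (χ : IrrChar (AlgebraicClosure F) Γ) => χ.coeff (z.extend (AlgebraicClosure F))) ?_ z
  intro z w hzw
  refine CenterUnits.extend_injective (K := AlgebraicClosure F) (ext_of_coeff ?_ ?_ (congrFun hzw))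
  · exact mapRingHom_mem_center _ z.1.2
  · exact mapRingHom_mem_center _ w.1.2

end Descent

instance : IsAlgClosed QBar := (algebraicClosure.isAlgClosure ℚ ℂ).isAlgClosed

end LocalExt

/-! ### Unramified characters -/

namespace LocalExt

open Finset

namespace IrrChar

variable {K : Type*} [Field K] [CharZero K] [IsAlgClosed K] {Γ : Type*} [Group Γ]

/-- A homomorphism to the multiplicative group is an irreducible character. -/
theorem exists_eq_monoidHom (f : Γ →* K) : ∃ χ : IrrChar K Γ, ∀ g, χ g = f g := by
  let ρ : Representation K Γ K :=
    { toFun := fun g => LinearMap.mulLeft K (f g)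
      map_one' := by ext; simp
      map_mul' := fun g h => by ext; simp }
  have : ρ.IsIrreducible := by
    have : Nontrivial (Subrepresentation ρ) :=
      ⟨⟨⊤, fun _ _ _ => trivial⟩, ⟨⊥, fun g v hv => by
        rw [Submodule.mem_bot] at hv ⊢
        rw [hv, map_zero]⟩, fun h =>
          top_ne_bot (α := Submodule K K) (congrArg Subrepresentation.toSubmodule h)⟩
    refine ⟨fun a => ?_⟩
    rcases eq_bot_or_eq_top a.toSubmodule with h | h
    · exact Or.inl (Subrepresentation.toSubmodule_injective (h.trans rfl))
    · exact Or.inr (Subrepresentation.toSubmodule_injective (h.trans rfl))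
  obtain ⟨χ, hχ⟩ := exists_irrChar_eq_character ρ
  refine ⟨χ, fun g => ?_⟩
  rw [hχ, Representation.character]
  change LinearMap.trace K K (LinearMap.mulLeft K (f g)) = f g
  have : LinearMap.mulLeft K (f g) = f g • 1 := by ext; simp
  rw [this, map_smul, LinearMap.trace_one, Module.finrank_self, Nat.cast_one, smul_eq_mul, mul_one]

variable (χ : IrrChar K Γ)

/-- A representation that is irreducible and abelian is one-dimensional. -/
theorem degree_eq_one_of_commute (h : ∀ g h, χ.rep g * χ.rep h = χ.rep h * χ.rep g) :
    χ.degree = 1 ∧ ∀ g, χ.rep g = χ g • 1 := by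
  have hs : ∀ g, ∃ c : K, χ.rep g = c • 1 := fun g =>
    exists_eq_smul_one_of_commute χ.rep fun k => h k g
  have hd : χ.degree = 1 := by
    obtain ⟨v, hv⟩ := exists_ne (0 : Fin χ.degree → K)
    let W : Subrepresentation χ.rep := ⟨K ∙ v, fun g w hw => by
      obtain ⟨c, hc⟩ := hs g
      rw [hc]
      exact Submodule.smul_mem _ c hw⟩
    have hW : W = ⊤ := (χ.isIrreducible_rep.eq_bot_or_eq_top W).resolve_left fun hb => hv <| by
      have h1 : v ∈ W.toSubmodule := Submodule.mem_span_singleton_self v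
      rw [hb] at h1
      exact h1
    have h2 : (K ∙ v) = ⊤ := congrArg Subrepresentation.toSubmodule hW
    have h3 := finrank_span_singleton (K := K) hv
    rw [h2, finrank_top, Module.finrank_fin_fun] at h3
    exact h3
  refine ⟨hd, fun g => ?_⟩
  obtain ⟨c, hc⟩ := hs g
  have h1 : χ g = c := by
    rw [← χ.character_rep, Representation.character, hc, map_smul, LinearMap.trace_one,
      Module.finrank_fin_fun, hd, Nat.cast_one, smul_eq_mul, mul_one]
  rw [hc, h1]

theorem map_mul_of_rep_eq (h : ∀ g, χ.rep g = χ g • 1) (g k : Γ) : χ (g * k) = χ g * χ k := by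
  have h1 := map_mul χ.rep g k
  rw [h, h, h, smul_mul_smul_comm, one_mul] at h1
  exact smul_left_injective K (one_ne_zero (α := Module.End K (Fin χ.degree → K))) h1

variable [Fintype Γ] (I : Subgroup Γ)

/-- The condition that `χ` is trivial on `I`. -/
def IsTrivialOn : Prop := ∀ g ∈ I, χ g = χ 1

theorem finrank_invariants_restrict :
    (Nat.card I : K)⁻¹ * ∑ᶠ g : I, χ g =
      Module.finrank K (Representation.invariants (χ.rep.comp I.subtype)) := by
  have := Fintype.ofFinite I
  have hc : (Nat.card I : K) ≠ 0 := Nat.cast_ne_zero.2 Nat.card_pos.ne'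
  let _ : Invertible (Nat.card I : K) := invertibleOfNonzero hc
  rw [← Representation.card_inv_mul_sum_char_eq_finrank (χ.rep.comp I.subtype),
    finsum_eq_sum_of_fintype]
  congr 1
  refine Finset.sum_congr rfl fun g _ => ?_
  rw [← χ.character_rep]
  rfl

variable {I}

/-- If the character `χ` is trivial on `I`, then so is the representation: its invariants under `I`
have dimension `χ(1)`. -/
theorem IsTrivialOn.rep_eq_one (h : χ.IsTrivialOn I) {g : Γ} (hg : g ∈ I) : χ.rep g = 1 := by
  have := Fintype.ofFinite I
  have hc : (Nat.card I : K) ≠ 0 := Nat.cast_ne_zero.2 Nat.card_pos.ne'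
  have h1 := χ.finrank_invariants_restrict I
  rw [finsum_eq_sum_of_fintype, Finset.sum_congr rfl fun (g : I) _ => h g g.2, Finset.sum_const,
    Finset.card_univ, ← Nat.card_eq_fintype_card, nsmul_eq_mul, inv_mul_cancel_left₀ hc,
    apply_one, Nat.cast_inj] at h1
  have h2 : Representation.invariants (χ.rep.comp I.subtype) = ⊤ := by
    apply Submodule.eq_top_of_finrank_eq
    rw [← h1, Module.finrank_fin_fun]
  refine LinearMap.ext fun v => ?_
  have h3 : v ∈ Representation.invariants (χ.rep.comp I.subtype) := by
    rw [h2]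
    trivial
  exact h3 ⟨g, hg⟩

/-- There are no invariants under a normal subgroup in an irreducible representation on which that
subgroup acts non-trivially. -/
theorem sum_rep_eq_zero [I.Normal] (h : ¬ χ.IsTrivialOn I) : ∑ᶠ g : I, χ.rep g = 0 := by
  have := Fintype.ofFinite I
  let W : Subrepresentation χ.rep := ⟨Representation.invariants (χ.rep.comp I.subtype), by
    intro g v hv k
    have h1 := hv ⟨g⁻¹ * k * g, by
      simpa using Subgroup.Normal.conj_mem (inferInstance : I.Normal) _ k.2 g⁻¹⟩
    change χ.rep (g⁻¹ * k * g) v = v at h1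
    change χ.rep k (χ.rep g v) = χ.rep g v
    conv_rhs => rw [← h1]
    rw [← Module.End.mul_apply, ← Module.End.mul_apply, ← map_mul, ← map_mul]
    congr 2
    group⟩
  have hW : W = ⊥ := by
    refine (χ.isIrreducible_rep.eq_bot_or_eq_top W).resolve_right fun ht => h fun g hg => ?_
    have h1 : χ.rep g = χ.rep 1 := by
      rw [map_one]
      refine LinearMap.ext fun v => ?_
      have h2 : v ∈ W := by
        rw [ht]
        trivial
      exact h2 ⟨g, hg⟩
    rw [← χ.character_rep, Representation.character, Representation.character, h1]
  rw [finsum_eq_sum_of_fintype]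
  refine LinearMap.ext fun v => ?_
  have h1 : (∑ g : I, χ.rep g) v ∈ W := by
    intro k
    change χ.rep k _ = _
    rw [LinearMap.sum_apply, map_sum]
    refine Fintype.sum_equiv (Equiv.mulLeft k) _ _ fun g => ?_
    rw [← Module.End.mul_apply, ← map_mul]
    rfl
  rw [hW] at h1
  exact h1

end IrrChar

section Frobenius

variable {K : Type*} [Field K] [CharZero K] [IsAlgClosed K] {Γ : Type*} [Group Γ] [Fintype Γ]
  {I : Subgroup Γ} {σ : Γ} (hσ : ∀ g : Γ, ∃ k : ℕ, ∃ h ∈ I, g = σ ^ k * h)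
  {χ : IrrChar K Γ}
include hσ

/-- When `Γ/I` is cyclic, the irreducible characters that are trivial on `I` are linear. -/
theorem IrrChar.IsTrivialOn.degree_eq_one (h : χ.IsTrivialOn I) :
    χ.degree = 1 ∧ ∀ g, χ.rep g = χ g • 1 := by
  have h1 : ∀ g, ∃ k : ℕ, χ.rep g = χ.rep σ ^ k := fun g => by
    obtain ⟨k, i, hi, rfl⟩ := hσ g
    exact ⟨k, by rw [map_mul, h.rep_eq_one χ hi, mul_one, map_pow]⟩
  refine χ.degree_eq_one_of_commute fun g k => ?_
  obtain ⟨a, ha⟩ := h1 g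
  obtain ⟨b, hb⟩ := h1 k
  rw [ha, hb, ← pow_add, ← pow_add, add_comm]

theorem IrrChar.IsTrivialOn.map_mul (h : χ.IsTrivialOn I) (g k : Γ) : χ (g * k) = χ g * χ k :=
  χ.map_mul_of_rep_eq (h.degree_eq_one hσ).2 g k

theorem IrrChar.IsTrivialOn.map_one (h : χ.IsTrivialOn I) : χ 1 = 1 := by
  rw [χ.apply_one, (h.degree_eq_one hσ).1, Nat.cast_one]

/-- An unramified irreducible character, as a homomorphism. -/
noncomputable def IrrChar.IsTrivialOn.toMonoidHom (h : χ.IsTrivialOn I) : Γ →* K where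
  toFun := χ
  map_one' := h.map_one hσ
  map_mul' := h.map_mul hσ

theorem IrrChar.IsTrivialOn.ne_zero (h : χ.IsTrivialOn I) (g : Γ) : χ g ≠ 0 :=
  ((Group.isUnit g).map (h.toMonoidHom hσ)).ne_zero

theorem IrrChar.IsTrivialOn.apply_inv (h : χ.IsTrivialOn I) (g : Γ) : χ g⁻¹ = (χ g)⁻¹ := by
  apply eq_inv_of_mul_eq_one_left
  rw [← h.map_mul hσ, inv_mul_cancel, h.map_one hσ]

theorem IrrChar.IsTrivialOn.det_eq (h : χ.IsTrivialOn I) (g : Γ) : χ.det g = χ g := by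
  rw [IrrChar.det, (h.degree_eq_one hσ).2, LinearMap.det_smul, Module.finrank_fin_fun,
    (h.degree_eq_one hσ).1, pow_one, _root_.map_one, mul_one]

open scoped Classical in
/-- The `χ`-component of `(1 - ψ_{2,*})(y)` at an unramified character is `χ(σ)⁻¹`, as
`ψ₂ χ = χ²` is irreducible and unramified. -/
theorem IrrChar.IsTrivialOn.mul_virtualValue_inv (h : χ.IsTrivialOn I) :
    let y : IrrChar K Γ → K := fun μ => if μ.IsTrivialOn I then -μ σ else 1
    y χ ^ (1 : ℤ) * virtualValue y (adams 2 χ) ^ (-1 : ℤ) = (χ σ)⁻¹ := by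
  intro y
  obtain ⟨χ₂, h₂⟩ := IrrChar.exists_eq_monoidHom ((h.toMonoidHom hσ) ^ 2)
  have h₂' : ∀ g, χ₂ g = χ g ^ 2 := h₂
  have hfun : adams 2 χ = χ₂ := by
    funext g
    rw [h₂', adams, pow_two, pow_two, h.map_mul hσ]
  have ht : χ₂.IsTrivialOn I := fun g hg => by rw [h₂', h₂', h g hg]
  have h0 := h.ne_zero hσ σ
  rw [hfun, virtualValue_irrChar]
  simp only [y, if_pos h, if_pos ht, h₂', zpow_one, zpow_neg]
  field_simp

open scoped Classical in
omit hσ in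
/-- At a ramified character `χ` the value is `1` if no unramified character occurs in `ψ₂ χ`. -/
theorem mul_virtualValue_inv_eq_one (h : ¬ χ.IsTrivialOn I)
    (hm : ∀ μ : IrrChar K Γ, μ.IsTrivialOn I → ∑ g, χ (g ^ 2) * μ g⁻¹ = 0) :
    let y : IrrChar K Γ → K := fun μ => if μ.IsTrivialOn I then -μ σ else 1
    y χ ^ (1 : ℤ) * virtualValue y (adams 2 χ) ^ (-1 : ℤ) = 1 := by
  intro y
  have h1 : virtualValue y (adams 2 χ) = 1 := by
    rw [virtualValue]
    refine finprod_eq_one_of_forall_eq_one fun μ => ?_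
    by_cases hμ : μ.IsTrivialOn I
    · have : multiplicity (adams 2 χ) μ = 0 := multiplicity_eq <| by
        rw [show ∑ g, adams 2 χ g * μ g⁻¹ = 0 from hm μ hμ, mul_zero, Int.cast_zero]
      rw [this, zpow_zero]
    · simp only [y, if_neg hμ, one_zpow]
  rw [h1]
  simp [y, if_neg h]

/-- For an abelian group, no unramified character occurs in `ψ₂ χ = χ²` if `χ` is ramified and `I`
has odd order, since `χ²` is then ramified as well. -/
theorem sum_sq_mul_inv_eq_zero_of_comm (hI : Odd (Nat.card I)) (hc : ∀ g h : Γ, g * h = h * g)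
    (h : ¬ χ.IsTrivialOn I) {μ : IrrChar K Γ} (hμ : μ.IsTrivialOn I) :
    ∑ g, χ (g ^ 2) * μ g⁻¹ = 0 := by
  have h1 := χ.degree_eq_one_of_commute fun g k => by rw [← map_mul, ← map_mul, hc]
  have hχ := χ.map_mul_of_rep_eq h1.2
  have hχ1 : χ 1 = 1 := by rw [χ.apply_one, h1.1, Nat.cast_one]
  let f : Γ →* K := ⟨⟨χ, hχ1⟩, hχ⟩
  obtain ⟨i, hi, hi1⟩ : ∃ i ∈ I, χ i ≠ 1 := by
    by_contra hn
    push Not at hn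
    exact h fun g hg => by rw [hn g hg, hχ1]
  have hi2 : f i ^ 2 ≠ 1 := by
    intro h2
    have h3 : f i ^ Nat.card I = 1 := by
      have h4 : i ^ Nat.card I = 1 :=
        congrArg Subtype.val (pow_card_eq_one' (x := (⟨i, hi⟩ : I)))
      rw [← map_pow, h4, _root_.map_one]
    obtain ⟨m, hm⟩ := hI
    rw [hm, pow_succ, pow_mul, h2, one_pow, one_mul] at h3
    exact hi1 h3
  have h3 : ∑ g, χ (g ^ 2) * μ g⁻¹ = f i ^ 2 * ∑ g, χ (g ^ 2) * μ g⁻¹ := by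
    rw [Finset.mul_sum]
    refine (Fintype.sum_equiv (Equiv.mulRight i) _ _ fun g => ?_).symm
    change f i ^ 2 * (f (g ^ 2) * μ g⁻¹) = f ((g * i) ^ 2) * μ (g * i)⁻¹
    have h4 : μ (g * i)⁻¹ = μ g⁻¹ := by
      rw [mul_inv_rev, hμ.map_mul hσ, hμ _ (inv_mem hi), hμ.map_one hσ, one_mul]
    rw [h4, map_pow, map_pow, _root_.map_mul]
    ring
  have h4 : (1 - f i ^ 2) * ∑ g, χ (g ^ 2) * μ g⁻¹ = 0 := by
    rw [sub_mul, one_mul, ← h3, sub_self]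
  exact (mul_eq_zero.1 h4).resolve_left (sub_ne_zero.2 hi2.symm)

/-- For a group of odd order, `⟨ψ₂ χ, ψ₂ ν⟩ = ⟨χ, ν⟩`, and each unramified character is of the form
`ψ₂ ν = ν²` with `ν` unramified. -/
theorem sum_sq_mul_inv_eq_zero_of_odd (hΓ : Odd (Nat.card Γ))
    (h : ¬ χ.IsTrivialOn I) {μ : IrrChar K Γ} (hμ : μ.IsTrivialOn I) :
    ∑ g, χ (g ^ 2) * μ g⁻¹ = 0 := by
  classical
  obtain ⟨m, hm⟩ := hΓ
  have hpow : ∀ g : Γ, (g ^ 2) ^ (m + 1) = g := fun g => by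
    rw [← pow_mul, show 2 * (m + 1) = Nat.card Γ + 1 by omega, pow_succ, pow_card_eq_one', one_mul]
  obtain ⟨ν, hν⟩ := IrrChar.exists_eq_monoidHom ((hμ.toMonoidHom hσ) ^ (m + 1))
  have hν' : ∀ g, ν g = hμ.toMonoidHom hσ g ^ (m + 1) := hν
  have hνt : ν.IsTrivialOn I := fun g hg => by
    rw [hν', hν']
    exact congrArg (· ^ (m + 1)) (hμ g hg)
  have hne : χ ≠ ν := fun he => h (he ▸ hνt)
  have hbij : Function.Bijective (fun g : Γ => g ^ 2) := by
    refine (Finite.injective_iff_bijective).1 fun a b hab => ?_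
    rw [← hpow a, ← hpow b]
    exact congrArg (· ^ (m + 1)) hab
  have h1 := IrrChar.card_inv_mul_sum_mul χ ν
  rw [if_neg hne, mul_eq_zero] at h1
  have h2 := h1.resolve_left (inv_ne_zero (Nat.cast_ne_zero.2 Fintype.card_ne_zero))
  rw [← h2]
  refine Fintype.sum_bijective _ hbij _ _ fun g => ?_
  have h3 : ν (g ^ 2)⁻¹ = μ g⁻¹ := by
    rw [hν', ← map_pow, ← inv_pow, hpow]
    rfl
  rw [h3]

end Frobenius

end LocalExt

/-! ### The components of the twisted unramified characteristic -/

namespace LocalExt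

open Finset

section Average

variable {K : Type*} [Field K] [CharZero K] [IsAlgClosed K] {Γ : Type*} [Group Γ] [Fintype Γ]
  {I : Subgroup Γ} (χ : IrrChar K Γ)

/-- The idempotent `e_I` acts as the average over `I`. -/
theorem asAlgebraHom_subgroupIdempotent :
    χ.rep.asAlgebraHom (MonoidAlgebra.mapRingHom Γ (algebraMap ℚ K) (subgroupIdempotent I)) =
      (Nat.card I : K)⁻¹ • ∑ᶠ g : I, χ.rep g := by
  classical
  have h1 : MonoidAlgebra.mapRingHom Γ (algebraMap ℚ K) (subgroupIdempotent I) =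
      (Nat.card I : K)⁻¹ • ∑ g : Γ with g ∈ I, MonoidAlgebra.single g 1 := by
    have h2 : subgroupIdempotent I = ∑ g : Γ with g ∈ I,
        MonoidAlgebra.single g (Nat.card I : ℚ)⁻¹ := by
      rw [subgroupIdempotent, Finset.smul_sum]
      refine Finset.sum_congr (by congr) fun g _ => ?_
      simp
    rw [h2, map_sum, Finset.smul_sum]
    refine Finset.sum_congr rfl fun g _ => ?_
    simp
  have := Fintype.ofFinite I
  rw [h1, map_smul, map_sum, finsum_eq_sum_of_fintype]
  congr 1
  refine (Finset.sum_subtype (F := this) _ (p := (· ∈ I)) (fun g => by simp) _).trans ?_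
  refine Fintype.sum_congr _ _ fun g => ?_
  rw [Representation.asAlgebraHom_single_one]

theorem IrrChar.IsTrivialOn.asAlgebraHom_subgroupIdempotent (h : χ.IsTrivialOn I) :
    χ.rep.asAlgebraHom (MonoidAlgebra.mapRingHom Γ (algebraMap ℚ K) (subgroupIdempotent I)) =
      1 := by
  have := Fintype.ofFinite I
  have hc : (Nat.card I : K) ≠ 0 := Nat.cast_ne_zero.2 Nat.card_pos.ne'
  rw [LocalExt.asAlgebraHom_subgroupIdempotent, finsum_eq_sum_of_fintype,
    Fintype.sum_congr _ _ fun g : I => h.rep_eq_one χ g.2, Finset.sum_const, Finset.card_univ,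
    ← Nat.card_eq_fintype_card, ← Nat.cast_smul_eq_nsmul K, smul_smul, inv_mul_cancel₀ hc, one_smul]

theorem IrrChar.asAlgebraHom_subgroupIdempotent_eq_zero [I.Normal] (h : ¬ χ.IsTrivialOn I) :
    χ.rep.asAlgebraHom (MonoidAlgebra.mapRingHom Γ (algebraMap ℚ K) (subgroupIdempotent I)) =
      0 := by
  rw [LocalExt.asAlgebraHom_subgroupIdempotent, χ.sum_rep_eq_zero h, smul_zero]

open scoped Classical in
/-- The action of `(1 - e_I) + σ⁻¹ e_I` in the irreducible representations. -/
theorem asAlgebraHom_one_sub_add [I.Normal] {σ : Γ}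
    (hσ : ∀ g : Γ, ∃ k : ℕ, ∃ h ∈ I, g = σ ^ k * h) :
    χ.rep.asAlgebraHom (MonoidAlgebra.mapRingHom Γ (algebraMap ℚ K)
      ((1 - subgroupIdempotent I) + MonoidAlgebra.single σ⁻¹ 1 * subgroupIdempotent I)) =
      (if χ.IsTrivialOn I then (χ σ)⁻¹ else 1) • 1 := by
  simp only [map_add, map_sub, map_mul, map_one, MonoidAlgebra.mapRingHom_single,
    Representation.asAlgebraHom_single_one]
  split_ifs with h
  · rw [h.asAlgebraHom_subgroupIdempotent χ, sub_self, zero_add, mul_one,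
      (h.degree_eq_one hσ).2, h.apply_inv hσ]
  · rw [χ.asAlgebraHom_subgroupIdempotent_eq_zero h, sub_zero, mul_zero, add_zero, one_smul]

end Average

section LocalFields

variable (ℓ : ℕ) [Fact ℓ.Prime] (F E : Type*) [Field F] [Field E] [Algebra ℚ_[ℓ] F]
  [Algebra ℚ_[ℓ] E] [Algebra F E] [IsScalarTower ℚ_[ℓ] F E] [FiniteDimensional ℚ_[ℓ] E]
  [FiniteDimensional F E] [IsGalois F E]

open scoped Classical in
theorem unramifiedChar_eq {σ : E ≃ₐ[F] E} (hσ : IsFrobeniusLift ℓ F E σ) :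
    unramifiedChar ℓ F E =
      fun μ => if μ.IsTrivialOn (inertiaGroup ℓ F E) then -μ σ else 1 := by
  have hgen := exists_pow_mul_of_isFrobeniusLift ℓ F E hσ
  funext μ
  by_cases h : μ.IsTrivialOn (inertiaGroup ℓ F E)
  · have h1 : μ (frobenius ℓ F E) = μ σ := by
      have h2 := inv_mul_mem_inertiaGroup ℓ F E hσ (isFrobeniusLift_frobenius ℓ F E)
      rw [← mul_inv_cancel_left σ (frobenius ℓ F E), h.map_mul hgen, h _ h2, h.map_one hgen,
        mul_one]
    refine (if_pos h).trans (Eq.trans ?_ (if_pos h).symm)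
    rw [h.det_eq hgen, (h.degree_eq_one hgen).1, h1, pow_one, neg_one_mul]
  · exact (if_neg h).trans (if_neg h).symm

open scoped Classical in
theorem twistedCentral_eq {σ : E ≃ₐ[F] E} (hσ : IsFrobeniusLift ℓ F E σ) :
    twistedCentral ℓ F E = centralElement fun χ =>
      (fun μ : IrrChar QBar (E ≃ₐ[F] E) =>
        if μ.IsTrivialOn (inertiaGroup ℓ F E) then -μ σ else 1) χ ^ (1 : ℤ) *
      virtualValue (fun μ : IrrChar QBar (E ≃ₐ[F] E) =>
        if μ.IsTrivialOn (inertiaGroup ℓ F E) then -μ σ else 1) (adams 2 χ) ^ (-1 : ℤ) := by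
  rw [twistedCentral, equivariantUnramifiedChar, unramifiedChar_eq ℓ F E hσ, adamsEndo]
  simp only [IrrChar.coeff_centralElement]

theorem twistedCentralUnit_eq {z : CenterUnits ℚ (E ≃ₐ[F] E)}
    (h : z.extend QBar = twistedCentral ℓ F E) : twistedCentralUnit ℓ F E = z := by
  rw [twistedCentralUnit, ← h]
  exact Function.leftInverse_invFun CenterUnits.extend_injective z

/-- If `Γ` is abelian or of odd order, then `(1 - ψ_{2,*})(y) = (1 - e_I) + σ⁻¹ e_I`. -/
theorem twistedCentralUnit_eq_of_odd_or_comm (hI : Odd (Nat.card (inertiaGroup ℓ F E)))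
    (h : Odd (Nat.card (E ≃ₐ[F] E)) ∨ ∀ g h : E ≃ₐ[F] E, g * h = h * g)
    {σ : E ≃ₐ[F] E} (hσ : IsFrobeniusLift ℓ F E σ) :
    (twistedCentralUnit ℓ F E).extend QBar = twistedCentral ℓ F E ∧
      ((twistedCentralUnit ℓ F E : Subring.center (MonoidAlgebra ℚ (E ≃ₐ[F] E))) :
        MonoidAlgebra ℚ (E ≃ₐ[F] E)) =
      (1 - subgroupIdempotent (inertiaGroup ℓ F E)) +
        MonoidAlgebra.single σ⁻¹ 1 * subgroupIdempotent (inertiaGroup ℓ F E) := by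
  classical
  have hgen := exists_pow_mul_of_isFrobeniusLift ℓ F E hσ
  obtain ⟨z, hz, hz'⟩ := exists_centerUnits_eq (K := QBar)
    (c := fun χ => if χ.IsTrivialOn (inertiaGroup ℓ F E) then (χ σ)⁻¹ else 1)
    (fun χ => by
      split_ifs with hχ
      · exact inv_ne_zero (hχ.ne_zero hgen σ)
      · exact one_ne_zero)
    (fun χ => asAlgebraHom_one_sub_add χ hgen)
  have h1 : z.extend QBar = twistedCentral ℓ F E := by
    rw [hz', twistedCentral_eq ℓ F E hσ]
    congr 1
    funext χ
    by_cases hχ : χ.IsTrivialOn (inertiaGroup ℓ F E)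
    · rw [if_pos hχ]
      exact (hχ.mul_virtualValue_inv hgen).symm
    · rw [if_neg hχ]
      refine (mul_virtualValue_inv_eq_one (σ := σ) hχ fun μ hμ => ?_).symm
      rcases h with h | h
      · exact sum_sq_mul_inv_eq_zero_of_odd hgen h hχ hμ
      · exact sum_sq_mul_inv_eq_zero_of_comm hgen hI h hχ hμ
  rw [twistedCentralUnit_eq ℓ F E h1]
  exact ⟨h1, hz⟩

end LocalFields

end LocalExt

/-! ### Interpolation at roots of unity -/

namespace LocalExt

open Polynomial

/-- The cyclotomic polynomials `Φ_f`, `f ∣ e`, are pairwise coprime over a ring in which `e` is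
invertible, so that the values of a polynomial at the `e`-th roots of unity can be prescribed
independently for the different orders. -/
theorem exists_polynomial_aeval_eq {R : Type*} [CommRing R] {e : ℕ} (he0 : e ≠ 0)
    (he : IsUnit (e : R)) (p : ℕ → R[X]) :
    ∃ P : R[X], ∀ {K : Type} [CommRing K] [IsDomain K] [Algebra R K] (ξ : K) (f : ℕ),
      IsPrimitiveRoot ξ f → f ∣ e → aeval ξ P = aeval ξ (p f) := by
  have hsep : (X ^ e - 1 : R[X]).Separable := by
    simpa using separable_X_pow_sub_C_unit (1 : Rˣ) he
  have hcop : Pairwise (Function.onFun IsCoprime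
      fun f : e.divisors => Ideal.span {cyclotomic (f : ℕ) R}) := by
    intro f g hfg
    rw [Function.onFun, Ideal.isCoprime_span_singleton_iff]
    have h1 : cyclotomic (f : ℕ) R * cyclotomic (g : ℕ) R ∣ X ^ e - 1 := by
      rw [← prod_cyclotomic_eq_X_pow_sub_one (Nat.pos_of_ne_zero he0) R,
        ← Finset.mul_prod_erase _ _ f.2]
      exact mul_dvd_mul_left _ (Finset.dvd_prod_of_mem _
        (Finset.mem_erase.2 ⟨fun h => hfg (Subtype.ext h.symm), g.2⟩))
    exact (hsep.of_dvd h1).isCoprime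
  obtain ⟨P, hP⟩ := Ideal.exists_forall_sub_mem_ideal hcop fun f => p f
  refine ⟨P, fun {K} _ _ _ ξ f hξ hf => ?_⟩
  have h1 := hP ⟨f, Nat.mem_divisors.2 ⟨hf, he0⟩⟩
  obtain ⟨q, hq⟩ := Ideal.mem_span_singleton.1 h1
  have h2 : aeval ξ (cyclotomic f R) = 0 := by
    have h3 := hξ.isRoot_cyclotomic (Nat.pos_of_dvd_of_pos hf (Nat.pos_of_ne_zero he0))
    rwa [← map_cyclotomic f (algebraMap R K), IsRoot, eval_map_algebraMap] at h3
  rw [← sub_eq_zero, ← map_sub, hq, map_mul, h2, zero_mul]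

end LocalExt

/-! ### Integral units in the relative `K`-group -/

namespace LocalExt

/-- The class of an invertible matrix in `K₁(A)`. -/
def K1.mk {A : Type*} [Ring A] (M : K1Gen A) : K1 A := QuotientAddGroup.mk (.of M)

section Boundary

variable {R : Type*} [CommRing R] {E : Type*} [CommRing E] [Algebra R E] {Γ : Type*} [Group Γ]

theorem boundary_mk (M : K1Gen (MonoidAlgebra E Γ)) :
    boundary R (K1.mk M) = K0.mk (boundaryGen R M) :=
  FreeAbelianGroup.lift_apply_of _ _

/-- For `N ∈ GL_n(R[Γ])` the map `v ↦ v N` is an isomorphism from the triple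
`(R[Γ]^n, N, R[Γ]^n)` to `(R[Γ]^n, 1, R[Γ]^n)`. -/
theorem boundary_mk_map {n : ℕ} (N : (Matrix (Fin n) (Fin n) (MonoidAlgebra R Γ))ˣ)
    (M : (Matrix (Fin n) (Fin n) (MonoidAlgebra E Γ))ˣ)
    (h : ∀ i j, M.val i j = MonoidAlgebra.mapRingHom Γ (algebraMap R E) (N.val i j)) :
    boundary R (K1.mk ⟨n, M⟩) = 0 := by
  rw [boundary_mk]
  let f : (Fin 0 → MonoidAlgebra R Γ) →ₗ[MonoidAlgebra R Γ] (Fin n → MonoidAlgebra R Γ) := 0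
  let g : (Fin n → MonoidAlgebra R Γ) ≃ₗ[MonoidAlgebra R Γ] (Fin n → MonoidAlgebra R Γ) :=
    rowEquiv N
  have hf : Function.Injective f := Function.injective_of_subsingleton f
  have hexact : ∀ k : (Fin n → MonoidAlgebra R Γ) ≃ₗ[MonoidAlgebra R Γ]
      (Fin n → MonoidAlgebra R Γ), Function.Exact f k := by
    intro k v
    constructor
    · intro hv
      exact ⟨0, ((map_eq_zero_iff k k.injective).1 hv).symm⟩
    · rintro ⟨w, rfl⟩
      exact map_zero k
  have hg : ∀ x : TensorProduct R E (Fin n → MonoidAlgebra R Γ),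
      freeBaseChange R E Γ n ((g.toLinearMap.restrictScalars R).baseChange E x) =
        Matrix.vecMul (freeBaseChange R E Γ n x) M.val := by
    intro x
    induction x with
    | zero => simp
    | add x y hx hy => simp only [map_add, hx, hy, Matrix.add_vecMul]
    | tmul e v =>
      ext1 i
      rw [LinearMap.baseChange_tmul, freeBaseChange_tmul]
      have h1 : (g.toLinearMap.restrictScalars R) v i = Matrix.vecMul v N.val i := rfl
      rw [h1, Matrix.vecMul, dotProduct, map_sum, Finset.smul_sum, Matrix.vecMul, dotProduct]
      refine Finset.sum_congr rfl fun j _ => ?_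
      rw [freeBaseChange_tmul, h, map_mul, smul_mul_assoc]
      rfl
  have hr := K0Rel.exact (boundaryGen R (⟨0, 1⟩ : K1Gen (MonoidAlgebra E Γ)))
    (boundaryGen R ⟨n, M⟩) (boundaryGen R (⟨n, 1⟩ : K1Gen (MonoidAlgebra E Γ)))
    f g.toLinearMap f LinearMap.id hf (hexact g) g.surjective hf
    (hexact (LinearEquiv.refl _ _)) Function.surjective_id
    (fun x => by
      have hs : Subsingleton (TensorProduct R E (Fin 0 → MonoidAlgebra R Γ)) :=
        (freeBaseChange R E Γ 0).injective.subsingleton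
      have hx : x = 0 := hs.elim x 0
      rw [hx]
      simp only [map_zero])
    (fun x => by
      apply (freeBaseChange R E Γ n).injective
      refine (freeBaseChange_boundaryIso R E Γ 1 _).trans ?_
      rw [Units.val_one, Matrix.vecMul_one]
      refine (hg x).trans ((freeBaseChange_boundaryIso R E Γ M x).symm.trans ?_)
      congr 1
      exact (LinearMap.congr_fun (LinearMap.baseChange_id (R := R) (A := E)
        (M := Fin n → MonoidAlgebra R Γ)) _).symm)
  have h2 := (QuotientAddGroup.eq_zero_iff _).2 (AddSubgroup.subset_closure hr)
  rw [QuotientAddGroup.mk_sub, QuotientAddGroup.mk_add, sub_eq_zero] at h2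
  have h3 : K0.mk (boundaryGen R ⟨n, M⟩) =
      K0.mk (boundaryGen R (⟨0, 1⟩ : K1Gen (MonoidAlgebra E Γ))) +
        K0.mk (boundaryGen R (⟨n, 1⟩ : K1Gen (MonoidAlgebra E Γ))) := h2
  rw [h3, boundaryGen_one, boundaryGen_one, add_zero]

end Boundary

section Det

variable {F : Type*} [Field F] {K : Type*} [Field K] [Algebra F K] {Γ : Type*} [Group Γ]

/-- The invertible `1 × 1` matrix with a given entry. -/
def unitMatrix {A : Type*} [Semiring A] (u : Aˣ) : (Matrix (Fin 1) (Fin 1) A)ˣ where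
  val := Matrix.of fun _ _ => u.val
  inv := Matrix.of fun _ _ => u.inv
  val_inv := by
    ext i j
    obtain rfl := Subsingleton.elim i j
    simp [Matrix.mul_apply]
  inv_val := by
    ext i j
    obtain rfl := Subsingleton.elim i j
    simp [Matrix.mul_apply]

theorem boundary_mk_unitMatrix {R : Type*} [CommRing R] {E : Type*} [CommRing E] [Algebra R E]
    (u : (MonoidAlgebra R Γ)ˣ) (w : (MonoidAlgebra E Γ)ˣ)
    (h : w.val = MonoidAlgebra.mapRingHom Γ (algebraMap R E) u.val) :
    boundary R (K1.mk ⟨1, unitMatrix w⟩) = 0 := by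
  have h1 : ∀ i j, (unitMatrix w).val i j =
      MonoidAlgebra.mapRingHom Γ (algebraMap R E) ((unitMatrix u).val i j) := by
    intro i j
    exact h
  exact boundary_mk_map (unitMatrix u) (unitMatrix w) h1

theorem IrrChar.Det_unitMatrix (χ : IrrChar K Γ) (u : (MonoidAlgebra F Γ)ˣ) :
    (χ.Det F 1 (unitMatrix u) : K) = LinearMap.det
      (χ.rep.asAlgebraHom (MonoidAlgebra.mapRingHom Γ (algebraMap F K) u)) := by
  rw [← LinearMap.det_toMatrix']
  rw [← Matrix.det_reindex_self (Equiv.uniqueProd (Fin χ.degree) (Fin 1)).symm]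
  rfl

theorem detComponents_mk (χ : IrrChar K Γ) (M : K1Gen (MonoidAlgebra F Γ)) :
    detComponents F K Γ (K1.mk M) χ = Additive.ofMul (χ.Det F M.1 M.2) :=
  congrFun (FreeAbelianGroup.lift_apply_of _ _) χ

end Det

theorem deltaMap_eq_zero {ℓ : ℕ} [Fact ℓ.Prime] {Γ : Type*} [Group Γ] [Fintype Γ]
    {z : CenterUnits ℚ_[ℓ] Γ} {v : K1 (MonoidAlgebra ℚ_[ℓ] Γ)} (h : reducedNorm ℚ_[ℓ] Γ v = z)
    (hv : boundary ℤ_[ℓ] v = 0) : deltaMap ℓ z = 0 := by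
  rw [deltaMap]
  split_ifs with hb
  · rwa [← h, show reducedNorm ℚ_[ℓ] Γ v = Equiv.ofBijective _ hb v from rfl,
      Equiv.symm_apply_apply]
  · rfl

section Comparison

variable {Γ : Type*} [Group Γ] [Fintype Γ]

/-- A central unit of `ℚ[Γ]` whose components over `ℚ_ℓ` are the determinants of a unit of
`ℤ_ℓ[Γ]` is the reduced norm of the class of that unit, which lies in the kernel of `∂¹`. -/
theorem exists_reducedNorm_eq_of_det_eq {ℓ : ℕ} [Fact ℓ.Prime]
    (z : CenterUnits ℚ Γ) (u : (MonoidAlgebra ℤ_[ℓ] Γ)ˣ)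
    (h : ∀ χ : IrrChar (AlgebraicClosure ℚ_[ℓ]) Γ,
      χ.rep.asAlgebraHom (MonoidAlgebra.mapRingHom Γ (algebraMap ℚ (AlgebraicClosure ℚ_[ℓ]))
          (z : Subring.center (MonoidAlgebra ℚ Γ))) =
        LinearMap.det (χ.rep.asAlgebraHom
          (MonoidAlgebra.mapRingHom Γ (algebraMap ℤ_[ℓ] (AlgebraicClosure ℚ_[ℓ])) u)) • 1) :
    ∃ v : K1 (MonoidAlgebra ℚ_[ℓ] Γ),
      reducedNorm ℚ_[ℓ] Γ v = CenterUnits.map ℚ_[ℓ] z ∧ boundary ℤ_[ℓ] v = 0 := by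
  have : CharZero (AlgebraicClosure ℚ_[ℓ]) := charZero_of_injective_algebraMap
    (algebraMap ℚ_[ℓ] (AlgebraicClosure ℚ_[ℓ])).injective
  let w : (MonoidAlgebra ℚ_[ℓ] Γ)ˣ :=
    Units.map (MonoidAlgebra.mapRingHom Γ (algebraMap ℤ_[ℓ] ℚ_[ℓ])).toMonoidHom u
  refine ⟨K1.mk ⟨1, unitMatrix w⟩, reducedNorm_eq fun χ => ?_, ?_⟩
  · rw [detComponents_mk, toMul_ofMul, χ.Det_unitMatrix]
    apply χ.coeff_eq_of_asAlgebraHom_eq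
    have h1 : (CenterUnits.map ℚ_[ℓ] z).extend (AlgebraicClosure ℚ_[ℓ]) =
        MonoidAlgebra.mapRingHom Γ (algebraMap ℚ (AlgebraicClosure ℚ_[ℓ]))
          (z : Subring.center (MonoidAlgebra ℚ Γ)) := by
      change MonoidAlgebra.mapRingHom Γ (algebraMap ℚ_[ℓ] (AlgebraicClosure ℚ_[ℓ]))
        (MonoidAlgebra.mapRingHom Γ (algebraMap ℚ ℚ_[ℓ])
          (z : Subring.center (MonoidAlgebra ℚ Γ))) = _
      rw [← RingHom.comp_apply, ← MonoidAlgebra.mapRingHom_comp,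
        ← IsScalarTower.algebraMap_eq ℚ ℚ_[ℓ] (AlgebraicClosure ℚ_[ℓ])]
    have h2 : MonoidAlgebra.mapRingHom Γ (algebraMap ℚ_[ℓ] (AlgebraicClosure ℚ_[ℓ])) w =
        MonoidAlgebra.mapRingHom Γ (algebraMap ℤ_[ℓ] (AlgebraicClosure ℚ_[ℓ])) u := by
      change MonoidAlgebra.mapRingHom Γ (algebraMap ℚ_[ℓ] (AlgebraicClosure ℚ_[ℓ]))
        (MonoidAlgebra.mapRingHom Γ (algebraMap ℤ_[ℓ] ℚ_[ℓ]) u) = _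
      rw [← RingHom.comp_apply, ← MonoidAlgebra.mapRingHom_comp,
        ← IsScalarTower.algebraMap_eq ℤ_[ℓ] ℚ_[ℓ] (AlgebraicClosure ℚ_[ℓ])]
    rw [h1, h2, h]
  · exact boundary_mk_unitMatrix u w rfl

end Comparison

end LocalExt

/-! ### Irreducible representations of metacyclic groups -/

namespace LocalExt

open Module

/-- The group `Γ` is the product of the cyclic groups generated by `τ` and `h`, and
`τ⁻¹ h τ = h ^ q`. The Galois group of a tamely ramified extension is of this form, where `h`
generates the inertia group, `τ` is the inverse of a Frobenius lift, and `q` is the order of the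
residue field. -/
structure IsMetacyclic {Γ : Type*} [Group Γ] (h τ : Γ) (q : ℕ) : Prop where
  mul_eq : h * τ = τ * h ^ q
  exists_eq : ∀ g : Γ, ∃ k j : ℕ, g = τ ^ k * h ^ j
  coprime : q.Coprime (orderOf h)

/-- A basis `w 0, …, w (d - 1)` of a representation of a metacyclic group that is permuted by `τ` up
to the scalar `α` by which `τ ^ d` acts, and consists of eigenvectors of `h`, where `h` acts on
`w i` by `ζ ^ q ^ i`. Here `ζ` is a primitive `f`-th root of unity and `d` is the order of `q`
modulo `f`. The sequence `w` is continued to all of `ℕ` by `w (i + d) = α • w i`. -/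
structure EigenBasis {K : Type*} [Field K] {Γ : Type*} [Group Γ] {V : Type*} [AddCommGroup V]
    [Module K V] (ρ : Representation K Γ V) (h τ : Γ) (q : ℕ) where
  f : ℕ
  ζ : K
  α : K
  w : ℕ → V
  basis : Basis (Fin (orderOf (q : ZMod f))) K V
  isPrimitiveRoot : IsPrimitiveRoot ζ f
  dvd : f ∣ orderOf h
  apply_gen : ∀ i, ρ h (w i) = ζ ^ q ^ i • w i
  apply_succ : ∀ i, ρ τ (w i) = w (i + 1)
  add_period : ∀ i, w (i + orderOf (q : ZMod f)) = α • w i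
  basis_apply : ∀ i, basis i = w i

theorem orderOf_natCast_pos {q f : ℕ} (hf : f ≠ 0) (hq : q.Coprime f) :
    0 < orderOf (q : ZMod f) := by
  have : NeZero f := ⟨hf⟩
  rw [← ZMod.coe_unitOfCoprime q hq, orderOf_units]
  exact orderOf_pos _

theorem pow_pow_eq_pow_pow_iff {K : Type*} [Field K] {ζ : K} (hζ : ζ ≠ 0) (q i j : ℕ) :
    ζ ^ q ^ i = ζ ^ q ^ j ↔ (q : ZMod (orderOf ζ)) ^ i = q ^ j := by
  obtain ⟨u, rfl⟩ := hζ.isUnit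
  rw [orderOf_units, ← Nat.cast_pow, ← Nat.cast_pow, ZMod.natCast_eq_natCast_iff,
    ← pow_eq_pow_iff_modEq, ← Units.val_pow_eq_pow_val, ← Units.val_pow_eq_pow_val, Units.val_inj]

section Existence

variable {K : Type*} [Field K] [IsAlgClosed K] {Γ : Type*} [Group Γ] [Finite Γ]
  {V : Type*} [AddCommGroup V] [Module K V] [FiniteDimensional K V]
  {h τ : Γ} {q : ℕ}

/-- Each irreducible representation of a metacyclic group has an eigenbasis: the span of the
translates `τ ^ i v` of a common eigenvector `v` of `h` and `τ ^ d` is stable. -/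
theorem IsMetacyclic.nonempty_eigenBasis (hm : IsMetacyclic h τ q) (ρ : Representation K Γ V)
    [hirr : ρ.IsIrreducible] : Nonempty (EigenBasis ρ h τ q) := by
  have := nontrivial_of_isIrreducible ρ
  obtain ⟨ζ, hζ⟩ := Module.End.exists_eigenvalue (ρ h)
  obtain ⟨v₀, hv₀⟩ := hζ.exists_hasEigenvector
  have hζe : ζ ^ orderOf h = 1 := by
    have h1 : ∀ n : ℕ, ρ (h ^ n) v₀ = ζ ^ n • v₀ := fun n => by
      induction n with
      | zero => simp
      | succ n ih =>
        rw [pow_succ', map_mul, Module.End.mul_apply, ih, map_smul, hv₀.apply_eq_smul, smul_smul,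
          pow_succ]
    have h2 := h1 (orderOf h)
    rw [pow_orderOf_eq_one, map_one, Module.End.one_apply] at h2
    have h3 : (ζ ^ orderOf h - 1) • v₀ = 0 := by rw [sub_smul, one_smul, ← h2, sub_self]
    exact sub_eq_zero.1 ((smul_eq_zero.1 h3).resolve_right hv₀.2)
  have hfd : orderOf ζ ∣ orderOf h := orderOf_dvd_of_pow_eq_one hζe
  have hf0 : orderOf ζ ≠ 0 := fun h0 => (orderOf_pos h).ne' (Nat.eq_zero_of_zero_dvd (h0 ▸ hfd))
  have hcop : q.Coprime (orderOf ζ) := hm.coprime.coprime_dvd_right hfd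
  have hd0 := orderOf_natCast_pos hf0 hcop
  set d := orderOf (q : ZMod (orderOf ζ)) with hd
  -- `τ` carries eigenvectors of `h` to eigenvectors
  have hstep : ∀ (c : K) (v : V), ρ h v = c • v → ρ h (ρ τ v) = c ^ q • ρ τ v := by
    intro c v hv
    have h1 : ∀ n : ℕ, ρ (h ^ n) v = c ^ n • v := fun n => by
      induction n with
      | zero => simp
      | succ n ih =>
        rw [pow_succ', map_mul, Module.End.mul_apply, ih, map_smul, hv, smul_smul, pow_succ]
    rw [← Module.End.mul_apply, ← map_mul, hm.mul_eq, map_mul, Module.End.mul_apply, h1, map_smul]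
  have hpow : ∀ v : V, ρ h v = ζ • v → ∀ i : ℕ, ρ h (ρ (τ ^ i) v) = ζ ^ q ^ i • ρ (τ ^ i) v := by
    intro v hv i
    induction i with
    | zero => simpa using hv
    | succ i ih =>
      have h1 := hstep _ _ ih
      rwa [← Module.End.mul_apply (ρ τ), ← map_mul, ← pow_succ', ← pow_mul, ← pow_succ] at h1
  have hmod : ∀ i j : ℕ, ζ ^ q ^ i = ζ ^ q ^ j ↔ (q : ZMod (orderOf ζ)) ^ i = q ^ j :=
    pow_pow_eq_pow_pow_iff (fun h0 => by simp [h0, (orderOf_pos h).ne'] at hζe) q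
  have hζd : ζ ^ q ^ d = ζ := by
    have h1 := (hmod d 0).2 (by rw [pow_orderOf_eq_one, pow_zero])
    rwa [pow_zero, pow_one] at h1
  -- a common eigenvector of `h` and `τ ^ d`
  have hmaps : ∀ v ∈ Module.End.eigenspace (ρ h) ζ,
      ρ (τ ^ d) v ∈ Module.End.eigenspace (ρ h) ζ := by
    intro v hv
    rw [Module.End.mem_eigenspace_iff] at hv ⊢
    rw [hpow v hv d, hζd]
  have hW : Nontrivial (Module.End.eigenspace (ρ h) ζ) :=
    Submodule.nontrivial_iff_ne_bot.2 hζ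
  obtain ⟨α, hα⟩ := Module.End.exists_eigenvalue ((ρ (τ ^ d)).restrict hmaps)
  obtain ⟨⟨v, hvW⟩, hv⟩ := hα.exists_hasEigenvector
  have hv0 : v ≠ 0 := fun h0 => hv.2 (Subtype.ext h0)
  have hvα : ρ (τ ^ d) v = α • v := congrArg Subtype.val hv.apply_eq_smul
  have hvζ : ρ h v = ζ • v := Module.End.mem_eigenspace_iff.1 hvW
  let w : ℕ → V := fun i => ρ (τ ^ i) v
  have hw0 : ∀ i, w i ≠ 0 := by
    intro i h0
    apply hv0
    have h1 : ρ (τ ^ i)⁻¹ (w i) = v := by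
      rw [← Module.End.mul_apply, ← map_mul, inv_mul_cancel, map_one, Module.End.one_apply]
    rw [← h1, h0, map_zero]
  have hsucc : ∀ i, ρ τ (w i) = w (i + 1) := fun i => by
    rw [← Module.End.mul_apply, ← map_mul, ← pow_succ']
  have hper : ∀ i, w (i + d) = α • w i := fun i => by
    change ρ (τ ^ (i + d)) v = α • ρ (τ ^ i) v
    rw [pow_add, map_mul, Module.End.mul_apply, hvα, map_smul]
  have hli : LinearIndependent K fun i : Fin d => w i := by
    refine Module.End.eigenvectors_linearIndependent' (ρ h) (fun i : Fin d => ζ ^ q ^ (i : ℕ))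
      (fun i j hij => ?_) _ fun i => ⟨Module.End.mem_eigenspace_iff.2 (hpow v hvζ i), hw0 i⟩
    exact Fin.ext (pow_injOn_Iio_orderOf i.2 j.2 ((hmod i j).1 hij))
  have hmem : ∀ i, w i ∈ Submodule.span K (Set.range fun i : Fin d => w i) := by
    intro i
    induction i using Nat.strong_induction_on with
    | _ i ih =>
      by_cases hi : i < d
      · exact Submodule.subset_span ⟨⟨i, hi⟩, rfl⟩
      · have h1 := hper (i - d)
        rw [Nat.sub_add_cancel (not_lt.1 hi)] at h1
        rw [h1]
        exact Submodule.smul_mem _ _ (ih _ (by omega))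
  have hspan : ∀ g : Γ, ∀ x ∈ Submodule.span K (Set.range fun i : Fin d => w i),
      ρ g x ∈ Submodule.span K (Set.range fun i : Fin d => w i) := by
    intro g x hx
    have hτ : ∀ x ∈ Submodule.span K (Set.range fun i : Fin d => w i),
        ρ τ x ∈ Submodule.span K (Set.range fun i : Fin d => w i) := by
      intro x hx
      induction hx using Submodule.span_induction with
      | mem x hx =>
        obtain ⟨i, rfl⟩ := hx
        rw [hsucc]
        exact hmem _
      | zero => rw [map_zero]; exact zero_mem _
      | add x y _ _ hx hy => rw [map_add]; exact add_mem hx hy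
      | smul c x _ hx => rw [map_smul]; exact Submodule.smul_mem _ _ hx
    have hh : ∀ x ∈ Submodule.span K (Set.range fun i : Fin d => w i),
        ρ h x ∈ Submodule.span K (Set.range fun i : Fin d => w i) := by
      intro x hx
      induction hx using Submodule.span_induction with
      | mem x hx =>
        obtain ⟨i, rfl⟩ := hx
        rw [hpow v hvζ i]
        exact Submodule.smul_mem _ _ (hmem _)
      | zero => rw [map_zero]; exact zero_mem _
      | add x y _ _ hx hy => rw [map_add]; exact add_mem hx hy
      | smul c x _ hx => rw [map_smul]; exact Submodule.smul_mem _ _ hx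
    have hp : ∀ a : Γ, (∀ x ∈ Submodule.span K (Set.range fun i : Fin d => w i),
        ρ a x ∈ Submodule.span K (Set.range fun i : Fin d => w i)) → ∀ n : ℕ,
        ∀ x ∈ Submodule.span K (Set.range fun i : Fin d => w i),
        ρ (a ^ n) x ∈ Submodule.span K (Set.range fun i : Fin d => w i) := by
      intro a ha n
      induction n with
      | zero => intro x hx; simpa using hx
      | succ n ih =>
        intro x hx
        rw [pow_succ, map_mul, Module.End.mul_apply]
        exact ih _ (ha x hx)
    obtain ⟨k, j, rfl⟩ := hm.exists_eq g
    rw [map_mul, Module.End.mul_apply]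
    exact hp τ hτ k _ (hp h hh j x hx)
  let S : Subrepresentation ρ := ⟨_, fun g x hx => hspan g x hx⟩
  have hS : S = ⊤ := (hirr.eq_bot_or_eq_top S).resolve_left fun hb => hw0 0 <| by
    have h1 : w 0 ∈ S.toSubmodule := hmem 0
    rw [hb] at h1
    exact h1
  have htop : Submodule.span K (Set.range fun i : Fin d => w i) = ⊤ :=
    congrArg Subrepresentation.toSubmodule hS
  exact ⟨{
    f := orderOf ζ
    ζ := ζ
    α := α
    w := w
    basis := Basis.mk hli htop.ge
    isPrimitiveRoot := IsPrimitiveRoot.orderOf ζ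
    dvd := hfd
    apply_gen := hpow v hvζ
    apply_succ := hsucc
    add_period := hper
    basis_apply := fun i => Basis.mk_apply hli htop.ge i }⟩

end Existence

namespace EigenBasis

open Polynomial

variable {K : Type*} [Field K] {Γ : Type*} [Group Γ]
  {V : Type*} [AddCommGroup V] [Module K V] {ρ : Representation K Γ V}
  {h τ : Γ} {q : ℕ} (B : EigenBasis ρ h τ q)

/-- The length of the basis: the order of `q` modulo `f`. -/
noncomputable abbrev d : ℕ := orderOf (q : ZMod B.f)

theorem ext_of_apply {φ ψ : Module.End K V} (hφ : ∀ i, φ (B.w i) = ψ (B.w i)) : φ = ψ :=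
  B.basis.ext fun i => by rw [B.basis_apply, hφ]

theorem apply_gen_pow (n i : ℕ) : ρ (h ^ n) (B.w i) = (B.ζ ^ q ^ i) ^ n • B.w i := by
  induction n with
  | zero => simp
  | succ n ih =>
    rw [pow_succ', map_mul, Module.End.mul_apply, ih, map_smul, B.apply_gen, smul_smul, pow_succ]

theorem apply_pow (n i : ℕ) : ρ (τ ^ n) (B.w i) = B.w (i + n) := by
  induction n with
  | zero => simp
  | succ n ih =>
    rw [pow_succ', map_mul, Module.End.mul_apply, ih, B.apply_succ, add_assoc]

theorem add_mul_period (k i : ℕ) : B.w (i + B.d * k) = B.α ^ k • B.w i := by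
  induction k with
  | zero => simp
  | succ k ih => rw [mul_add, mul_one, ← add_assoc, B.add_period, ih, smul_smul, pow_succ']

/-- Polynomials in `h` act diagonally on the basis. -/
theorem asAlgebraHom_aeval {R : Type*} [CommRing R] [Algebra R K] (P : R[X]) (i : ℕ) :
    ρ.asAlgebraHom (MonoidAlgebra.mapRingHom Γ (algebraMap R K)
      (aeval (MonoidAlgebra.single h (1 : R)) P)) (B.w i) = aeval (B.ζ ^ q ^ i) P • B.w i := by
  induction P using Polynomial.induction_on' with
  | add P Q hP hQ => simp only [map_add, LinearMap.add_apply, hP, hQ, add_smul]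
  | monomial n r =>
    rw [aeval_monomial, aeval_monomial, MonoidAlgebra.single_pow, one_pow,
      ← Algebra.smul_def, MonoidAlgebra.smul_single, smul_eq_mul, mul_one,
      MonoidAlgebra.mapRingHom_single, Representation.asAlgebraHom_single, LinearMap.smul_apply,
      B.apply_gen_pow, smul_smul]

variable [Finite Γ] (hq : q.Coprime (orderOf h))

include hq
theorem coprime : q.Coprime B.f := hq.coprime_dvd_right B.dvd

omit hq in
theorem f_ne_zero : B.f ≠ 0 := fun h0 => (orderOf_pos h).ne' (Nat.eq_zero_of_zero_dvd (h0 ▸ B.dvd))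

theorem d_pos : 0 < B.d := orderOf_natCast_pos B.f_ne_zero (B.coprime hq)

theorem isPrimitiveRoot_pow (i : ℕ) : IsPrimitiveRoot (B.ζ ^ q ^ i) B.f :=
  B.isPrimitiveRoot.pow_of_coprime _ ((B.coprime hq).pow_left i)

theorem w_ne_zero (i : ℕ) : B.w i ≠ 0 := by
  intro h0
  have h1 : B.w 0 = 0 := by
    have h2 : ρ (τ ^ i)⁻¹ (B.w i) = B.w 0 := by
      rw [← zero_add i, ← B.apply_pow, ← Module.End.mul_apply, ← map_mul]
      simp
    rw [← h2, h0, map_zero]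
  have h2 := B.basis.ne_zero ⟨0, B.d_pos hq⟩
  rw [B.basis_apply] at h2
  exact h2 h1

theorem α_ne_zero : B.α ≠ 0 := fun h0 => B.w_ne_zero hq (0 + B.d) (by
  rw [B.add_period, h0, zero_smul])

/-- The power `τ ^ k` permutes the lines of the eigenbasis cyclically by `k` steps, without fixed
lines unless `d` divides `k`. -/
theorem trace_pow (k : ℕ) :
    LinearMap.trace K V (ρ (τ ^ k)) = if B.d ∣ k then B.d * B.α ^ (k / B.d) else 0 := by
  have hfd : FiniteDimensional K V := B.basis.finiteDimensional_of_finite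
  split_ifs with hk
  · obtain ⟨c, rfl⟩ := hk
    have h1 : ρ (τ ^ (B.d * c)) = B.α ^ c • 1 := B.ext_of_apply fun i => by
      rw [B.apply_pow, B.add_mul_period, LinearMap.smul_apply, Module.End.one_apply]
    rw [h1, map_smul, LinearMap.trace_one, Module.finrank_eq_card_basis B.basis, Fintype.card_fin,
      Nat.mul_div_cancel_left _ (B.d_pos hq), smul_eq_mul, mul_comm]
  · rw [LinearMap.trace_eq_matrix_trace K B.basis, Matrix.trace]
    refine Finset.sum_eq_zero fun i _ => ?_
    rw [Matrix.diag_apply, LinearMap.toMatrix_apply, B.basis_apply, B.apply_pow]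
    have h1 : B.w (i + k) = B.α ^ ((i + k) / B.d) • B.basis ⟨(i + k) % B.d,
        Nat.mod_lt _ (B.d_pos hq)⟩ := by
      rw [B.basis_apply, ← B.add_mul_period, Nat.mod_add_div]
    rw [h1, map_smul, Finsupp.smul_apply, Basis.repr_self, Finsupp.single_apply, if_neg, smul_zero]
    intro h2
    apply hk
    have h3 : (i + k) % B.d = i := congrArg Fin.val h2
    have h4 : (i + k : ℕ) ≡ i + 0 [MOD B.d] := by
      rw [Nat.ModEq, h3, add_zero, Nat.mod_eq_of_lt i.2]
    exact (Nat.modEq_zero_iff_dvd).1 (Nat.ModEq.add_left_cancel' _ h4)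

/-- The determinant of a polynomial in `h`. -/
theorem det_asAlgebraHom_aeval {R : Type*} [CommRing R] [Algebra R K] (P : R[X]) :
    LinearMap.det (ρ.asAlgebraHom (MonoidAlgebra.mapRingHom Γ (algebraMap R K)
      (aeval (MonoidAlgebra.single h (1 : R)) P))) =
      ∏ i ∈ Finset.range B.d, aeval (B.ζ ^ q ^ i) P := by
  rw [← LinearMap.det_toMatrix B.basis]
  have h1 : LinearMap.toMatrix B.basis B.basis (ρ.asAlgebraHom
      (MonoidAlgebra.mapRingHom Γ (algebraMap R K) (aeval (MonoidAlgebra.single h (1 : R)) P))) =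
      Matrix.diagonal fun i : Fin (orderOf (q : ZMod B.f)) => aeval (B.ζ ^ q ^ (i : ℕ)) P := by
    ext i j
    rw [LinearMap.toMatrix_apply, B.basis_apply, B.asAlgebraHom_aeval, ← B.basis_apply, map_smul,
      Finsupp.smul_apply, Basis.repr_self, Finsupp.single_apply, Matrix.diagonal_apply]
    by_cases hij : i = j
    · subst hij; simp
    · rw [if_neg (Ne.symm hij), if_neg hij, smul_zero]
  rw [h1, Matrix.det_diagonal, Finset.prod_range]

end EigenBasis

end LocalExt

/-! ### The second Adams operator on characters of metacyclic groups -/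

namespace LocalExt

open Finset

section Arithmetic

/-- If `-1` is a power of `q` modulo the odd number `f ≠ 1`, then `q` has even order `2 m` modulo
`f` and `q ^ k ≡ -1` exactly for `k ≡ m` modulo `2 m`. -/
theorem exists_orderOf_eq_two_mul {q f : ℕ} (hf1 : f ≠ 1) (hf : Odd f) (hq : q.Coprime f)
    (hk : ∃ k, f ∣ q ^ k + 1) :
    ∃ m, 0 < m ∧ orderOf (q : ZMod f) = 2 * m ∧ ∀ k, f ∣ q ^ k + 1 ↔ k ≡ m [MOD 2 * m] := by
  have hf0 : f ≠ 0 := by rintro rfl; simp at hf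
  have hd := orderOf_natCast_pos hf0 hq
  have hiff : ∀ k, f ∣ q ^ k + 1 ↔ (q : ZMod f) ^ k = -1 := fun k => by
    rw [← ZMod.natCast_eq_zero_iff, eq_neg_iff_add_eq_zero]
    push_cast
    rfl
  have hne : (1 : ZMod f) ≠ -1 := by
    intro h
    have h2 : ((2 : ℕ) : ZMod f) = 0 := by
      rw [eq_neg_iff_add_eq_zero] at h
      push_cast
      rw [← h]
      norm_num
    rw [ZMod.natCast_eq_zero_iff, Nat.dvd_prime Nat.prime_two] at h2
    rcases h2 with h2 | h2
    · exact hf1 h2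
    · rw [h2] at hf
      exact absurd hf (by decide)
  obtain ⟨k, hk⟩ := hk
  rw [hiff] at hk
  have h2k : orderOf (q : ZMod f) ∣ 2 * k :=
    orderOf_dvd_of_pow_eq_one (by rw [mul_comm, pow_mul, hk, neg_one_sq])
  have hnk : ¬ orderOf (q : ZMod f) ∣ k := fun h => hne (by
    rw [← hk, orderOf_dvd_iff_pow_eq_one.1 h])
  obtain ⟨m, hm⟩ : 2 ∣ orderOf (q : ZMod f) := by
    by_contra h2
    exact hnk (((Nat.prime_two.coprime_iff_not_dvd).2 h2).symm.dvd_of_dvd_mul_left h2k)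
  have hm0 : 0 < m := by omega
  rw [hm] at h2k hnk
  obtain ⟨t, rfl⟩ : m ∣ k := Nat.dvd_of_mul_dvd_mul_left two_pos h2k
  obtain ⟨s, rfl | rfl⟩ := Nat.even_or_odd' t
  · exact absurd ⟨s, by ring⟩ hnk
  have hqm : (q : ZMod f) ^ m = -1 := by
    rw [← hk, show m * (2 * s + 1) = 2 * m * s + m by ring, pow_add, pow_mul, ← hm,
      pow_orderOf_eq_one, one_pow, one_mul]
  refine ⟨m, hm0, hm, fun k => ?_⟩
  rw [hiff, ← hqm, ← hm]
  have : NeZero f := ⟨hf0⟩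
  rw [← ZMod.coe_unitOfCoprime q hq, orderOf_units, ← pow_eq_pow_iff_modEq,
    ← Units.val_pow_eq_pow_val, ← Units.val_pow_eq_pow_val, Units.val_inj]

theorem sum_range_modEq {M : Type*} [AddCommMonoid M] {d m N : ℕ} (hm : m < d) (F : ℕ → M) :
    ∑ k ∈ range (d * N) with k ≡ m [MOD d], F k = ∑ j ∈ range N, F (m + d * j) := by
  symm
  refine Finset.sum_nbij (fun j => m + d * j) ?_ ?_ ?_ fun _ _ => rfl
  · intro j hj
    rw [mem_range] at hj
    rw [mem_filter, mem_range]
    refine ⟨?_, by simp [Nat.ModEq]⟩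
    calc m + d * j < d + d * j := by omega
      _ = d * (j + 1) := by ring
      _ ≤ d * N := Nat.mul_le_mul_left _ hj
  · intro i _ j _ hij
    have h1 : d * i = d * j := Nat.add_left_cancel hij
    exact Nat.eq_of_mul_eq_mul_left (by omega) h1
  · intro k hk
    rw [mem_coe, mem_filter, mem_range] at hk
    refine ⟨k / d, ?_, ?_⟩
    · rw [mem_coe, mem_range]
      exact Nat.div_lt_of_lt_mul hk.1
    · have h1 : k % d = m := by rw [hk.2, Nat.mod_eq_of_lt hm]
      change m + d * (k / d) = k
      rw [← h1, Nat.mod_add_div]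

theorem sum_range_pow_of_pow_eq_one {K : Type*} [Field K] [DecidableEq K] {x : K} {N : ℕ}
    (hx : x ^ N = 1) : ∑ j ∈ range N, x ^ j = if x = 1 then (N : K) else 0 := by
  split_ifs with h
  · simp [h]
  · have h1 := geom_sum_mul x N
    rw [hx, sub_self] at h1
    exact (mul_eq_zero.1 h1).resolve_right (sub_ne_zero.2 h)

open Polynomial in
/-- By Vieta's formula the product of the numbers `-ω`, for `ω ^ m = a`, does not depend on the
parity of `m`. -/
theorem prod_nthRoots_neg {K : Type*} [Field K] [IsAlgClosed K] [CharZero K] [DecidableEq K]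
    {m : ℕ} (hm : 0 < m) {a : K} (ha : a ≠ 0) :
    ∏ ω ∈ (nthRoots m a).toFinset, (-ω) = -a := by
  have hmon : (X ^ m - C a : K[X]).Monic := monic_X_pow_sub_C a hm.ne'
  have hdeg : (X ^ m - C a : K[X]).natDegree = m := natDegree_X_pow_sub_C
  have hsplits : (X ^ m - C a : K[X]).Splits := IsAlgClosed.splits _
  have hnodup : (nthRoots m a).Nodup := by
    rw [nthRoots]
    exact nodup_roots (separable_X_pow_sub_C a (Nat.cast_ne_zero.2 hm.ne') ha)
  have hcard : Multiset.card (nthRoots m a) = m := by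
    rw [nthRoots, ← hsplits.natDegree_eq_card_roots, hdeg]
  have h1 := hsplits.coeff_zero_eq_prod_roots_of_monic hmon
  rw [hdeg] at h1
  have h2 : ∏ ω ∈ (nthRoots m a).toFinset, ω = (nthRoots m a).prod := by
    rw [Finset.prod_eq_multiset_prod, Multiset.toFinset_val, hnodup.dedup, Multiset.map_id']
  rw [Finset.prod_neg, h2, Multiset.toFinset_card_of_nodup hnodup, hcard]
  refine h1.symm.trans ?_
  simp [hm.ne]

end Arithmetic

namespace IsMetacyclic

variable {Γ : Type*} [Group Γ] {h τ : Γ} {q : ℕ} (hm : IsMetacyclic h τ q)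
include hm

theorem exists_mem_zpowers (g : Γ) : ∃ k : ℕ, ∃ x ∈ Subgroup.zpowers h, g = τ ^ k * x := by
  obtain ⟨k, j, rfl⟩ := hm.exists_eq g
  exact ⟨k, h ^ j, Subgroup.npow_mem_zpowers h j, rfl⟩

variable [Fintype Γ] [hN : (Subgroup.zpowers h).Normal]

/-- Each element is uniquely of the form `τ ^ k h ^ j`, where `k` is bounded by the index of `⟨h⟩`
and `j` by the order of `h`. -/
theorem sum_eq {M : Type*} [AddCommMonoid M] (Φ : Γ → M) :
    ∑ g, Φ g = ∑ k ∈ range (Subgroup.zpowers h).index, ∑ j ∈ range (orderOf h),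
      Φ (τ ^ k * h ^ j) := by
  rw [← Finset.sum_product']
  have hbij : Function.Bijective (fun p : Fin (Subgroup.zpowers h).index × Fin (orderOf h) =>
      τ ^ (p.1 : ℕ) * h ^ (p.2 : ℕ)) := by
    rw [Fintype.bijective_iff_surjective_and_card]
    constructor
    · intro g
      obtain ⟨k, x, hx, rfl⟩ := hm.exists_mem_zpowers g
      have h1 : τ ^ k = τ ^ (k % (Subgroup.zpowers h).index) *
          (τ ^ (Subgroup.zpowers h).index) ^ (k / (Subgroup.zpowers h).index) := by
        rw [← pow_mul, ← pow_add, Nat.mod_add_div]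
      have h2 : (τ ^ (Subgroup.zpowers h).index) ^ (k / (Subgroup.zpowers h).index) * x ∈
          Subgroup.zpowers h :=
        mul_mem (pow_mem (Subgroup.pow_index_mem _ τ) _) hx
      obtain ⟨j, hj⟩ := (mem_powers_iff_mem_zpowers.2 h2)
      refine ⟨⟨⟨k % (Subgroup.zpowers h).index,
        Nat.mod_lt _ (Nat.pos_of_ne_zero Subgroup.index_ne_zero_of_finite)⟩,
        ⟨j % orderOf h, Nat.mod_lt _ (orderOf_pos h)⟩⟩, ?_⟩
      change τ ^ (k % _) * h ^ (j % _) = _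
      rw [pow_mod_orderOf, h1, mul_assoc, ← hj]
    · rw [Fintype.card_prod, Fintype.card_fin, Fintype.card_fin, ← Nat.card_eq_fintype_card,
        ← Nat.card_zpowers, mul_comm, Subgroup.card_mul_index]
  rw [← Fintype.sum_bijective _ hbij _ Φ fun _ => rfl, Fintype.sum_prod_type, Finset.sum_product,
    Finset.sum_range]
  refine Fintype.sum_congr _ _ fun k => ?_
  rw [Finset.sum_range]

variable {K : Type*} [Field K] [CharZero K] [IsAlgClosed K]

omit hm hN in
theorem isTrivialOn_iff {χ : IrrChar K Γ} (B : EigenBasis χ.rep h τ q) :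
    χ.IsTrivialOn (Subgroup.zpowers h) ↔ B.f = 1 := by
  constructor
  · intro ht
    have h1 := B.apply_gen 0
    rw [ht.rep_eq_one χ (Subgroup.mem_zpowers h), Module.End.one_apply, pow_zero, pow_one] at h1
    by_contra hf
    have hζ : B.ζ - 1 ≠ 0 := sub_ne_zero.2 fun h2 => hf
      (IsPrimitiveRoot.eq_orderOf B.isPrimitiveRoot ▸ by rw [h2, orderOf_one])
    have h2 : (B.ζ - 1) • B.w 0 = 0 := by rw [sub_smul, one_smul, ← h1, sub_self]
    have h0 : B.w 0 = 0 := (smul_eq_zero.1 h2).resolve_left hζ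
    have h3 : ∀ i, B.w i = 0 := fun i => by
      rw [← zero_add i, ← B.apply_pow, h0, map_zero]
    have h4 : (1 : Module.End K (Fin χ.degree → K)) = 0 := B.ext_of_apply fun i => by
      rw [h3, map_zero, map_zero]
    exact one_ne_zero h4
  · intro hf g hg
    have hζ : B.ζ = 1 := by
      have h1 := B.isPrimitiveRoot.pow_eq_one
      rwa [hf, pow_one] at h1
    obtain ⟨j, rfl⟩ := mem_powers_iff_mem_zpowers.2 hg
    have h1 : χ.rep (h ^ j) = χ.rep 1 := B.ext_of_apply fun i => by
      rw [B.apply_gen_pow, hζ, one_pow, one_pow, one_smul, map_one, Module.End.one_apply]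
    change χ (h ^ j) = χ 1
    rw [← χ.character_rep, Representation.character, Representation.character, h1]

omit hN in
/-- The sum of `χ(g²)` over a coset of `⟨h⟩`. -/
theorem sum_range_sq {χ : IrrChar K Γ} (B : EigenBasis χ.rep h τ q) (k : ℕ) :
    ∑ j ∈ range (orderOf h), χ ((τ ^ k * h ^ j) ^ 2) =
      if B.f ∣ q ^ k + 1 then orderOf h * LinearMap.trace K _ (χ.rep (τ ^ (2 * k))) else 0 := by
  classical
  have h1 : ∑ j ∈ range (orderOf h), χ.rep ((τ ^ k * h ^ j) ^ 2) =
      (if B.f ∣ q ^ k + 1 then (orderOf h : K) else 0) • χ.rep (τ ^ (2 * k)) := by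
    refine B.ext_of_apply fun i => ?_
    have hξ := B.isPrimitiveRoot_pow hm.coprime i
    set ξ := B.ζ ^ q ^ i with hξdef
    have h2 : ∀ j, χ.rep ((τ ^ k * h ^ j) ^ 2) (B.w i) =
        (ξ ^ (q ^ k + 1)) ^ j • B.w (i + 2 * k) := by
      intro j
      rw [pow_two, map_mul, map_mul, Module.End.mul_apply, Module.End.mul_apply,
        Module.End.mul_apply, B.apply_gen_pow, map_smul, B.apply_pow, map_smul, B.apply_gen_pow,
        map_smul, map_smul, B.apply_pow, smul_smul, ← mul_pow, pow_add q, pow_mul, ← hξdef,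
        ← pow_succ']
      congr 2
      ring
    rw [LinearMap.sum_apply, Finset.sum_congr rfl fun j _ => h2 j, ← Finset.sum_smul,
      sum_range_pow_of_pow_eq_one, LinearMap.smul_apply, B.apply_pow]
    · simp only [hξ.pow_eq_one_iff_dvd]
    · obtain ⟨c, hc⟩ := B.dvd
      rw [← pow_mul, mul_comm, pow_mul, hc, pow_mul ξ, hξ.pow_eq_one, one_pow, one_pow]
  have h2 := congrArg (LinearMap.trace K (Fin χ.degree → K)) h1
  rw [map_sum, map_smul, smul_eq_mul] at h2
  rw [← χ.character_rep]
  refine h2.trans ?_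
  split_ifs
  · rfl
  · rw [zero_mul]

/-- The cosets of `⟨h⟩` that contribute to the multiplicity of the unramified character `μ` in
`ψ₂ χ`. -/
theorem sum_sq_mul_inv {χ μ : IrrChar K Γ} (B : EigenBasis χ.rep h τ q)
    (hμ : μ.IsTrivialOn (Subgroup.zpowers h)) :
    ∑ g, χ (g ^ 2) * μ g⁻¹ = ∑ k ∈ range (Subgroup.zpowers h).index with B.f ∣ q ^ k + 1,
      orderOf h * LinearMap.trace K _ (χ.rep (τ ^ (2 * k))) * (μ τ ^ k)⁻¹ := by
  rw [hm.sum_eq, Finset.sum_filter]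
  refine Finset.sum_congr rfl fun k _ => ?_
  have h1 : ∀ j, μ (τ ^ k * h ^ j)⁻¹ = (μ τ ^ k)⁻¹ := fun j => by
    rw [hμ.apply_inv hm.exists_mem_zpowers, hμ.map_mul hm.exists_mem_zpowers,
      hμ _ (Subgroup.npow_mem_zpowers h j), hμ.map_one hm.exists_mem_zpowers, mul_one]
    congr 1
    exact map_pow (hμ.toMonoidHom hm.exists_mem_zpowers) τ k
  rw [Finset.sum_congr rfl fun j _ => by rw [h1 j], ← Finset.sum_mul, hm.sum_range_sq B]
  split_ifs
  · rfl
  · rw [zero_mul]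

/-- The period divides the index of `⟨h⟩`, as `τ` to that index commutes with `h`. -/
theorem dvd_index {χ : IrrChar K Γ} (B : EigenBasis χ.rep h τ q) :
    B.d ∣ (Subgroup.zpowers h).index := by
  set n := (Subgroup.zpowers h).index
  obtain ⟨j, hj⟩ := mem_powers_iff_mem_zpowers.2 (Subgroup.pow_index_mem (Subgroup.zpowers h) τ)
  have hj' : h ^ j = τ ^ n := hj
  have h1 : χ.rep h (B.w n) = B.ζ • B.w n := by
    rw [← zero_add n, ← B.apply_pow, ← hj', ← Module.End.mul_apply, ← map_mul, ← pow_succ',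
      pow_succ, map_mul, Module.End.mul_apply, B.apply_gen, map_smul, pow_zero, pow_one]
  rw [B.apply_gen] at h1
  have h2 : B.ζ ^ q ^ n = B.ζ ^ q ^ 0 := by
    rw [pow_zero, pow_one]
    exact smul_left_injective K (B.w_ne_zero hm.coprime n) h1
  have h3 : (q : ZMod (orderOf B.ζ)) ^ n = q ^ 0 :=
    (pow_pow_eq_pow_pow_iff (B.isPrimitiveRoot.ne_zero B.f_ne_zero) q n 0).1 h2
  rw [← B.isPrimitiveRoot.eq_orderOf, pow_zero] at h3
  exact orderOf_dvd_of_pow_eq_one h3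

/-- As `τ ^ (d N)` is a power `h ^ j`, the scalar `α ^ N` by which it acts is `(ζ ^ q ^ i) ^ j` for
each `i`, and the product of these scalars for `i = 0` and `i = m` is `1`. -/
theorem α_pow_eq_one {χ : IrrChar K Γ} (B : EigenBasis χ.rep h τ q) {m N : ℕ}
    (hfm : B.f ∣ q ^ m + 1) (hN : (Subgroup.zpowers h).index = B.d * N) :
    B.α ^ (2 * N) = 1 := by
  obtain ⟨j, hj⟩ := mem_powers_iff_mem_zpowers.2 (Subgroup.pow_index_mem (Subgroup.zpowers h) τ)
  have hj' : h ^ j = τ ^ (B.d * N) := by rw [← hN]; exact hj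
  have h1 : ∀ i, B.α ^ N = (B.ζ ^ q ^ i) ^ j := fun i => by
    have h2 := B.apply_gen_pow j i
    rw [hj', B.apply_pow, B.add_mul_period] at h2
    exact smul_left_injective K (B.w_ne_zero hm.coprime i) h2
  obtain ⟨c, hc⟩ := hfm
  rw [mul_comm, pow_mul, pow_two]
  have h2 : B.α ^ N * B.α ^ N = (B.ζ ^ q ^ m) ^ j * (B.ζ ^ q ^ 0) ^ j := by rw [← h1, ← h1]
  rw [h2, ← mul_pow, pow_zero, pow_one, ← pow_succ, hc, pow_mul, B.isPrimitiveRoot.pow_eq_one,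
    one_pow, one_pow]

open scoped Classical in
/-- The multiplicity of the unramified character `μ` in `ψ₂ χ`, where `d = 2 m` and
`q ^ m ≡ -1` modulo `f`. -/
theorem multiplicity_adams_two {χ μ : IrrChar K Γ} (B : EigenBasis χ.rep h τ q)
    (hμ : μ.IsTrivialOn (Subgroup.zpowers h)) {m : ℕ} (hm0 : 0 < m) (hd : B.d = 2 * m)
    (hf : ∀ k, B.f ∣ q ^ k + 1 ↔ k ≡ m [MOD 2 * m]) :
    multiplicity (adams 2 χ) μ =
      if μ τ ^ m = B.α then 1 else if μ τ ^ m = -B.α then -1 else 0 := by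
  obtain ⟨N, hN⟩ := hm.dvd_index B
  have hα := hm.α_pow_eq_one B ((hf m).2 rfl) hN
  have hω0 : μ τ ≠ 0 := hμ.ne_zero hm.exists_mem_zpowers τ
  set ω := μ τ with hω
  have hωn : ω ^ (2 * m * N) = 1 := by
    have h1 := Subgroup.pow_index_mem (Subgroup.zpowers h) τ
    rw [hN, hd] at h1
    have h2 := hμ _ h1
    rw [hμ.map_one hm.exists_mem_zpowers] at h2
    rw [← h2]
    exact (map_pow (hμ.toMonoidHom hm.exists_mem_zpowers) τ _).symm
  -- the multiplicity is `N⁻¹ β ∑ j < N, β ^ (2 j)`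
  let β : K := B.α / ω ^ m
  have hβN : (β ^ 2) ^ N = 1 := by
    rw [div_pow, div_pow, ← pow_mul, hα, ← pow_mul, ← pow_mul, show m * (2 * N) = 2 * m * N by ring,
      hωn, div_one]
  have hsum : ∑ g, adams 2 χ g * μ g⁻¹ =
      orderOf h * B.d * β * if β ^ 2 = 1 then (N : K) else 0 := by
    refine (hm.sum_sq_mul_inv B hμ).trans ?_
    rw [← sum_range_pow_of_pow_eq_one hβN, Finset.mul_sum, hN, hd]
    simp only [hf]
    rw [sum_range_modEq (by omega)]
    refine Finset.sum_congr rfl fun j _ => ?_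
    rw [B.trace_pow hm.coprime, hd, if_pos ⟨1 + 2 * j, by ring⟩,
      show 2 * (m + 2 * m * j) = 2 * m * (1 + 2 * j) by ring,
      Nat.mul_div_cancel_left _ (by omega), ← hω]
    simp only [β, pow_add, pow_mul, div_pow]
    field_simp
    rw [← pow_mul ω m 2, ← pow_mul ω 2 m, mul_comm m 2]
  apply multiplicity_eq
  have hcard : (Fintype.card Γ : K) = orderOf h * B.d * N := by
    rw [← Nat.card_eq_fintype_card, ← (Subgroup.zpowers h).card_mul_index, hN, Nat.card_zpowers]
    push_cast
    ring
  have hcard0 : (orderOf h * B.d * N : K) ≠ 0 := by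
    rw [← hcard]
    exact Nat.cast_ne_zero.2 Fintype.card_ne_zero
  have hα0 := B.α_ne_zero hm.coprime
  have hωm : ω ^ m ≠ 0 := pow_ne_zero m hω0
  rw [hsum, hcard]
  by_cases h1 : ω ^ m = B.α
  · have hβ : β = 1 := by rw [← div_self hωm]; simp only [β, h1]
    rw [if_pos h1, hβ, one_pow, if_pos rfl, mul_one, inv_mul_cancel₀ hcard0, Int.cast_one]
  rw [if_neg h1]
  by_cases h2 : ω ^ m = -B.α
  · have hβ : β = -1 := by
      simp only [β]
      rw [h2, div_neg, div_self hα0]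
    rw [if_pos h2, hβ, neg_one_sq, if_pos rfl, mul_neg_one, neg_mul, mul_neg,
      inv_mul_cancel₀ hcard0, Int.cast_neg, Int.cast_one]
  · rw [if_neg h2, if_neg, mul_zero, mul_zero, Int.cast_zero]
    intro h3
    rcases mul_self_eq_one_iff.1 ((pow_two β).symm.trans h3) with h3 | h3
    · exact h1 ((div_eq_one_iff_eq hωm).1 h3).symm
    · rw [div_eq_iff hωm, neg_one_mul] at h3
      exact h2 (by rw [h3, neg_neg])

omit hN in
theorem ext_of_apply {χ μ : IrrChar K Γ} (hχ : χ.IsTrivialOn (Subgroup.zpowers h))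
    (hμ : μ.IsTrivialOn (Subgroup.zpowers h)) (heq : χ τ = μ τ) : χ = μ := by
  apply Subtype.ext
  funext g
  obtain ⟨k, x, hx, rfl⟩ := hm.exists_mem_zpowers g
  have h1 : ∀ {ν : IrrChar K Γ}, ν.IsTrivialOn (Subgroup.zpowers h) → ν (τ ^ k * x) = ν τ ^ k := by
    intro ν hν
    rw [hν.map_mul hm.exists_mem_zpowers, hν x hx, hν.map_one hm.exists_mem_zpowers, mul_one]
    exact map_pow (hν.toMonoidHom hm.exists_mem_zpowers) τ k
  exact (h1 hχ).trans ((congrArg (· ^ k) heq).trans (h1 hμ).symm)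

theorem exists_irrChar {ω : K} (hω : ω ^ (Subgroup.zpowers h).index = 1) :
    ∃ μ : IrrChar K Γ, μ.IsTrivialOn (Subgroup.zpowers h) ∧ μ τ = ω := by
  let π := QuotientGroup.mk' (Subgroup.zpowers h)
  have hgen : ∀ x : Γ ⧸ Subgroup.zpowers h, x ∈ Subgroup.zpowers (π τ) := by
    intro x
    obtain ⟨g, rfl⟩ := QuotientGroup.mk'_surjective _ x
    obtain ⟨k, x, hx, rfl⟩ := hm.exists_mem_zpowers g
    have h1 : QuotientGroup.mk' (Subgroup.zpowers h) x = 1 := (QuotientGroup.eq_one_iff x).2 hx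
    rw [map_mul, h1, mul_one, map_pow]
    exact Subgroup.npow_mem_zpowers _ k
  have hord : orderOf (π τ) = (Subgroup.zpowers h).index := by
    rw [orderOf_eq_card_of_forall_mem_zpowers hgen]
    rfl
  have hu : IsUnit ω := IsUnit.of_pow_eq_one hω Subgroup.index_ne_zero_of_finite
  obtain ⟨u, rfl⟩ := hu
  have hu1 : orderOf u ∣ orderOf (π τ) := by
    rw [hord]
    apply orderOf_dvd_of_pow_eq_one
    exact Units.ext (by rw [Units.val_pow_eq_pow_val, hω, Units.val_one])
  let f : Γ →* K := (Units.coeHom K).comp ((monoidHomOfForallMemZpowers hgen hu1).comp π)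
  obtain ⟨μ, hμ⟩ := IrrChar.exists_eq_monoidHom f
  refine ⟨μ, fun g hg => ?_, ?_⟩
  · have h1 : π g = 1 := (QuotientGroup.eq_one_iff g).2 hg
    rw [hμ, hμ, map_one]
    change ((monoidHomOfForallMemZpowers hgen hu1 (π g) : Kˣ) : K) = 1
    rw [h1, map_one, Units.val_one]
  · rw [hμ]
    change ((monoidHomOfForallMemZpowers hgen hu1 (π τ) : Kˣ) : K) = u
    rw [monoidHomOfForallMemZpowers_apply_gen]

open scoped Classical in
/-- The `χ`-component of `(1 - ψ_{2,*})(y)` at a ramified character `χ` of a metacyclic group, when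
`-1` is a power of `q` modulo `f`: the unramified characters in `ψ₂ χ` are the `μ` with
`μ(τ) ^ m = α` (of multiplicity `1`) and `μ(τ) ^ m = -α` (of multiplicity `-1`). -/
theorem mul_virtualValue_inv_eq_neg_one {χ : IrrChar K Γ} (B : EigenBasis χ.rep h τ q)
    (hodd : Odd (orderOf h)) (hf1 : B.f ≠ 1) (hk : ∃ k, B.f ∣ q ^ k + 1) :
    let y : IrrChar K Γ → K :=
      fun μ => if μ.IsTrivialOn (Subgroup.zpowers h) then -μ τ⁻¹ else 1
    y χ ^ (1 : ℤ) * virtualValue y (adams 2 χ) ^ (-1 : ℤ) = -1 := by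
  intro y
  obtain ⟨m, hm0, (hd : B.d = 2 * m), hf⟩ := exists_orderOf_eq_two_mul hf1 (hodd.of_dvd_nat B.dvd)
    (B.coprime hm.coprime) hk
  obtain ⟨N, hN⟩ := hm.dvd_index B
  have hα := hm.α_pow_eq_one B ((hf m).2 rfl) hN
  have hα0 := B.α_ne_zero hm.coprime
  have hmult := fun {μ : IrrChar K Γ} (hμ : μ.IsTrivialOn (Subgroup.zpowers h)) =>
    hm.multiplicity_adams_two B hμ hm0 hd hf
  have hy : ∀ {μ : IrrChar K Γ}, μ.IsTrivialOn (Subgroup.zpowers h) → y μ = -(μ τ)⁻¹ := by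
    intro μ hμ
    simp only [y, if_pos hμ, hμ.apply_inv hm.exists_mem_zpowers]
  have hne : B.α ≠ -B.α := fun h0 => hα0 (self_eq_neg.1 h0)
  let S : K → Finset K := fun a => (Polynomial.nthRoots m a).toFinset
  have hS : ∀ {a ω : K}, ω ∈ S a ↔ ω ^ m = a := by
    intro a ω
    rw [Multiset.mem_toFinset, Polynomial.mem_nthRoots hm0]
  have hSn : ∀ ω ∈ S B.α ∪ S (-B.α), ω ^ (Subgroup.zpowers h).index = 1 := by
    intro ω hω
    have h1 : (ω ^ m) ^ 2 = B.α ^ 2 := by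
      rw [Finset.mem_union, hS, hS] at hω
      rcases hω with hω | hω <;> rw [hω]
      rw [neg_sq]
    rw [hN, hd, show 2 * m * N = m * 2 * N by ring, pow_mul, pow_mul, h1, ← pow_mul, hα]
  -- the unramified character with value `ω` at `τ`; the value `χ` is never used
  let c : K → IrrChar K Γ := fun ω =>
    if hω : ω ^ (Subgroup.zpowers h).index = 1 then (hm.exists_irrChar hω).choose else χ
  have hc : ∀ ω ∈ S B.α ∪ S (-B.α), (c ω).IsTrivialOn (Subgroup.zpowers h) ∧ c ω τ = ω := by
    intro ω hω
    simp only [c, dif_pos (hSn ω hω)]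
    exact (hm.exists_irrChar (hSn ω hω)).choose_spec
  have hdisj : Disjoint (S B.α) (S (-B.α)) := by
    rw [Finset.disjoint_left]
    intro ω h1 h2
    exact hne ((hS.1 h1).symm.trans (hS.1 h2))
  have hval : virtualValue y (adams 2 χ) = -1 := by
    rw [virtualValue, finprod_eq_prod_of_mulSupport_subset (s := (S B.α ∪ S (-B.α)).image c)]
    · rw [Finset.prod_image, Finset.prod_union hdisj]
      · have h1 : ∏ ω ∈ S B.α, y (c ω) ^ multiplicity (adams 2 χ) (c ω) = (-B.α)⁻¹ := by
          rw [← prod_nthRoots_neg hm0 hα0, ← Finset.prod_inv_distrib]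
          refine Finset.prod_congr rfl fun ω hω => ?_
          obtain ⟨h2, h3⟩ := hc ω (Finset.mem_union_left _ hω)
          rw [hmult h2, hy h2, h3, if_pos (hS.1 hω), zpow_one, inv_neg]
        have h2 : ∏ ω ∈ S (-B.α), y (c ω) ^ multiplicity (adams 2 χ) (c ω) = B.α := by
          conv_rhs => rw [← neg_neg B.α, ← prod_nthRoots_neg hm0 (neg_ne_zero.2 hα0)]
          refine Finset.prod_congr rfl fun ω hω => ?_
          obtain ⟨h2, h3⟩ := hc ω (Finset.mem_union_right _ hω)
          rw [hmult h2, hy h2, h3, hS.1 hω, if_neg hne.symm, if_pos rfl, zpow_neg, zpow_one,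
            inv_neg, inv_inv]
        rw [h1, h2, inv_neg, neg_mul, inv_mul_cancel₀ hα0]
      · intro ω₁ h1 ω₂ h2 h12
        rw [← (hc ω₁ h1).2, ← (hc ω₂ h2).2, h12]
    · intro μ hμ
      rw [Function.mem_mulSupport] at hμ
      have ht : μ.IsTrivialOn (Subgroup.zpowers h) := by
        by_contra hn
        exact hμ (by simp only [y, if_neg hn, one_zpow])
      have hmem : μ τ ∈ S B.α ∪ S (-B.α) := by
        rw [Finset.mem_union, hS, hS]
        by_contra hn
        rw [not_or] at hn
        exact hμ (by rw [hmult ht, if_neg hn.1, if_neg hn.2, zpow_zero])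
      rw [Finset.mem_coe, Finset.mem_image]
      exact ⟨μ τ, hmem, hm.ext_of_apply (hc _ hmem).1 ht (hc _ hmem).2⟩
  have hχ : ¬ χ.IsTrivialOn (Subgroup.zpowers h) := fun ht => hf1 ((isTrivialOn_iff B).1 ht)
  rw [hval]
  simp [y, if_neg hχ]

end IsMetacyclic

end LocalExt

/-! ### A group ring unit with the determinants of the twisted unramified characteristic -/

namespace LocalExt

open Finset Polynomial

/-- The polynomials of norm `-1` are units at the roots of unity in question, with inverse minus the
product of the other conjugates. -/
theorem exists_polynomial_prod_aeval_eq_neg_one_and_mul_eq_one (ℓ : ℕ) [Fact ℓ.Prime] {f : ℕ}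
    (hf0 : f ≠ 0) (hf : ¬ ℓ ∣ f) {a : ℕ} (ha : 0 < a) :
    ∃ p p' : ℤ_[ℓ][X], ∀ {K : Type} [CommRing K] [IsDomain K] [Algebra ℤ_[ℓ] K] (ζ : K),
      IsPrimitiveRoot ζ f →
        ∏ i ∈ range (orderOf ((ℓ ^ a : ℕ) : ZMod f)), aeval (ζ ^ (ℓ ^ a) ^ i) p = -1 ∧
        aeval ζ p * aeval ζ p' = 1 := by
  obtain ⟨p, hp⟩ := exists_polynomial_prod_aeval_eq_neg_one ℓ hf0 hf ha
  refine ⟨p, -∏ i ∈ range (orderOf ((ℓ ^ a : ℕ) : ZMod f) - 1), p.comp (X ^ (ℓ ^ a) ^ (i + 1)),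
    fun {K} _ _ _ ζ hζ => ⟨hp ζ hζ, ?_⟩⟩
  have hcop : (ℓ ^ a).Coprime f :=
    (((Fact.out : ℓ.Prime).coprime_iff_not_dvd).2 hf).pow_left a
  have hd := orderOf_natCast_pos hf0 hcop
  have h1 := hp ζ hζ
  rw [← Nat.sub_add_cancel hd, prod_range_succ', pow_zero, pow_one] at h1
  rw [map_neg, map_prod, mul_neg, mul_comm, neg_eq_iff_eq_neg, ← h1]
  congr 1
  refine Finset.prod_congr rfl fun i _ => ?_
  rw [aeval_comp, map_pow, aeval_X]

namespace EigenBasis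

variable {K : Type*} [Field K] {Γ : Type*} [Group Γ]
  {V : Type*} [AddCommGroup V] [Module K V] {ρ : Representation K Γ V}
  {h τ : Γ} {q : ℕ} (B : EigenBasis ρ h τ q)

open scoped Classical in
/-- The component of `(1 - ψ_{2,*})(y)` at the character of a representation with a given
eigenbasis, for `τ` the inverse of a Frobenius lift. -/
noncomputable def component : K :=
  if B.f = 1 then B.α else if ∃ k, B.f ∣ q ^ k + 1 then -1 else 1

theorem d_eq_one (hf : B.f = 1) : B.d = 1 := by
  have h1 : ∀ f : ℕ, f = 1 → orderOf (q : ZMod f) = 1 := by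
    rintro f rfl
    rw [orderOf_eq_one_iff]
    exact Subsingleton.elim _ _
  exact h1 _ hf

theorem rep_eq_smul_one (hf : B.f = 1) : ρ τ = B.α • 1 := B.ext_of_apply fun i => by
  have h1 := B.add_period i
  change B.w (i + B.d) = _ at h1
  rw [B.d_eq_one hf] at h1
  rw [B.apply_succ, h1, LinearMap.smul_apply, Module.End.one_apply]

variable {R : Type*} [CommRing R] [Algebra R K]

/-- If `A` is `1` at `1` and `0` at the other roots of unity, then `A(h)` is the idempotent that
projects to the invariants of `h`. -/
theorem asAlgebraHom_one_sub_add {A : R[X]} {g : Γ} {c : K} (hg : B.f = 1 → ρ g = c • 1)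
    (hA : ∀ i, aeval (B.ζ ^ q ^ i) A = if B.f = 1 then 1 else 0) :
    ρ.asAlgebraHom (MonoidAlgebra.mapRingHom Γ (algebraMap R K)
      (1 - aeval (MonoidAlgebra.single h (1 : R)) A +
        MonoidAlgebra.single g 1 * aeval (MonoidAlgebra.single h (1 : R)) A)) =
      (if B.f = 1 then c else 1) • 1 := by
  refine B.ext_of_apply fun i => ?_
  rw [map_add, map_sub, map_mul, map_one, map_add, map_sub, map_mul, map_one, LinearMap.add_apply,
    LinearMap.sub_apply, Module.End.mul_apply, B.asAlgebraHom_aeval, hA,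
    MonoidAlgebra.mapRingHom_single, map_one, Representation.asAlgebraHom_single_one]
  split_ifs with hf
  · rw [one_smul, hg hf, Module.End.one_apply, sub_self, zero_add]
  · rw [zero_smul, map_zero, sub_zero, add_zero, one_smul]

theorem asAlgebraHom_aeval_eq_smul {P : R[X]} {c : K} (hP : ∀ i, aeval (B.ζ ^ q ^ i) P = c) :
    ρ.asAlgebraHom (MonoidAlgebra.mapRingHom Γ (algebraMap R K)
      (aeval (MonoidAlgebra.single h (1 : R)) P)) = c • 1 := B.ext_of_apply fun i => by
  rw [B.asAlgebraHom_aeval, hP, LinearMap.smul_apply, Module.End.one_apply]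

end EigenBasis

namespace IsMetacyclic

variable {Γ : Type*} [Group Γ] [Fintype Γ] {h τ : Γ} {q : ℕ} (hm : IsMetacyclic h τ q)
  [hN : (Subgroup.zpowers h).Normal]
include hm

open scoped Classical in
theorem mul_virtualValue_inv_eq_component {K : Type*} [Field K] [CharZero K] [IsAlgClosed K]
    {χ : IrrChar K Γ} (B : EigenBasis χ.rep h τ q) (hodd : Odd (orderOf h)) :
    let y : IrrChar K Γ → K :=
      fun μ => if μ.IsTrivialOn (Subgroup.zpowers h) then -μ τ⁻¹ else 1
    y χ ^ (1 : ℤ) * virtualValue y (adams 2 χ) ^ (-1 : ℤ) = B.component := by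
  intro y
  rw [EigenBasis.component]
  split_ifs with hf hk
  · have ht := (isTrivialOn_iff B).2 hf
    have hgen : ∀ g : Γ, ∃ k : ℕ, ∃ x ∈ Subgroup.zpowers h, g = τ⁻¹ ^ k * x := by
      intro g
      obtain ⟨k, x, hx, hg⟩ := hm.exists_mem_zpowers g⁻¹
      refine ⟨k, τ ^ k * x⁻¹ * (τ ^ k)⁻¹, hN.conj_mem _ (inv_mem hx) _, ?_⟩
      rw [← inv_inv g, hg]
      group
    refine (ht.mul_virtualValue_inv hgen).trans ?_
    rw [ht.apply_inv hm.exists_mem_zpowers, inv_inv]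
    have h1 := B.rep_eq_smul_one hf
    rw [(ht.degree_eq_one hm.exists_mem_zpowers).2] at h1
    exact smul_left_injective K (one_ne_zero (α := Module.End K (Fin χ.degree → K))) h1
  · exact hm.mul_virtualValue_inv_eq_neg_one B hodd hf hk
  · refine mul_virtualValue_inv_eq_one (fun ht => hf ((isTrivialOn_iff B).1 ht)) fun μ hμ => ?_
    rw [hm.sum_sq_mul_inv B hμ, Finset.filter_false_of_mem fun k _ hk' => hk ⟨k, hk'⟩,
      Finset.sum_empty]

theorem component_ne_zero {K : Type*} [Field K] [CharZero K] [IsAlgClosed K]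
    {χ : IrrChar K Γ} (B : EigenBasis χ.rep h τ q) : B.component ≠ 0 := by
  rw [EigenBasis.component]
  split_ifs
  · exact B.α_ne_zero hm.coprime
  · exact neg_ne_zero.2 one_ne_zero
  · exact one_ne_zero

/-- The elements of `K[Γ]` that act in the irreducible representations by the components of the
twisted unramified characteristic come from `ℚ[Γ]`. -/
theorem exists_rat_forall_asAlgebraHom_eq :
    ∃ x : MonoidAlgebra ℚ Γ, ∀ {K : Type} [Field K] [CharZero K] [IsAlgClosed K]
      (χ : IrrChar K Γ) (B : EigenBasis χ.rep h τ q),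
      χ.rep.asAlgebraHom (MonoidAlgebra.mapRingHom Γ (algebraMap ℚ K) x) = B.component • 1 := by
  classical
  have he0 : orderOf h ≠ 0 := (orderOf_pos h).ne'
  have he : IsUnit ((orderOf h : ℕ) : ℚ) := isUnit_iff_ne_zero.2 (Nat.cast_ne_zero.2 he0)
  obtain ⟨A, hA⟩ := exists_polynomial_aeval_eq he0 he fun f => if f = 1 then 1 else 0
  obtain ⟨C, hC⟩ := exists_polynomial_aeval_eq he0 he
    fun f => if f ≠ 1 ∧ ∃ k, f ∣ q ^ k + 1 then -1 else 1
  refine ⟨(1 - aeval (MonoidAlgebra.single h (1 : ℚ)) A +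
    MonoidAlgebra.single τ 1 * aeval (MonoidAlgebra.single h (1 : ℚ)) A) *
      aeval (MonoidAlgebra.single h (1 : ℚ)) C, fun {K} _ _ _ χ B => ?_⟩
  have hA' : ∀ i, aeval (B.ζ ^ q ^ i) A = if B.f = 1 then 1 else 0 := fun i => by
    rw [hA _ _ (B.isPrimitiveRoot_pow hm.coprime i) B.dvd]
    split_ifs <;> simp
  have hC' : ∀ i, aeval (B.ζ ^ q ^ i) C = if B.f ≠ 1 ∧ ∃ k, B.f ∣ q ^ k + 1 then -1 else 1 :=
    fun i => by
      rw [hC _ _ (B.isPrimitiveRoot_pow hm.coprime i) B.dvd]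
      split_ifs <;> simp
  rw [map_mul, map_mul, B.asAlgebraHom_one_sub_add B.rep_eq_smul_one hA',
    B.asAlgebraHom_aeval_eq_smul hC', smul_mul_smul_comm, one_mul, EigenBasis.component]
  congr 1
  by_cases hf : B.f = 1
  · simp [hf]
  · simp [hf]

/-- There is a unit of `ℤ_ℓ[Γ]` whose determinants in the irreducible representations are the
components of the twisted unramified characteristic. -/
theorem exists_unit_forall_det_eq {ℓ : ℕ} [Fact ℓ.Prime] {a : ℕ} (ha : 0 < a) (hq : q = ℓ ^ a)
    (hℓ : ¬ ℓ ∣ orderOf h) :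
    ∃ u : (MonoidAlgebra ℤ_[ℓ] Γ)ˣ, ∀ (χ : IrrChar (AlgebraicClosure ℚ_[ℓ]) Γ)
      (B : EigenBasis χ.rep h τ q), LinearMap.det (χ.rep.asAlgebraHom
        (MonoidAlgebra.mapRingHom Γ (algebraMap ℤ_[ℓ] (AlgebraicClosure ℚ_[ℓ])) u)) =
          B.component := by
  classical
  have hchar : CharZero (AlgebraicClosure ℚ_[ℓ]) := charZero_of_injective_algebraMap
    (algebraMap ℚ_[ℓ] (AlgebraicClosure ℚ_[ℓ])).injective
  have he0 : orderOf h ≠ 0 := (orderOf_pos h).ne'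
  have he : IsUnit ((orderOf h : ℕ) : ℤ_[ℓ]) := by
    rw [PadicInt.isUnit_iff, PadicInt.norm_natCast_eq_one_iff]
    exact ((Fact.out : ℓ.Prime).coprime_iff_not_dvd).2 hℓ
  -- the values of `p f` at the primitive `f`-th roots of unity are units of norm `-1`
  have hex : ∀ f : ℕ, ∃ p p' : ℤ_[ℓ][X], f ∣ orderOf h →
      ∀ ζ : AlgebraicClosure ℚ_[ℓ], IsPrimitiveRoot ζ f →
        ∏ i ∈ range (orderOf (q : ZMod f)), aeval (ζ ^ q ^ i) p = -1 ∧
        aeval ζ p * aeval ζ p' = 1 := by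
    intro f
    by_cases hf : f ∣ orderOf h
    · obtain ⟨p, p', hp⟩ := exists_polynomial_prod_aeval_eq_neg_one_and_mul_eq_one ℓ
        (fun h0 => he0 (Nat.eq_zero_of_zero_dvd (h0 ▸ hf))) (fun h0 => hℓ (h0.trans hf)) ha
      subst hq
      exact ⟨p, p', fun _ ζ hζ => hp ζ hζ⟩
    · exact ⟨0, 0, fun h0 => absurd h0 hf⟩
  choose p p' hp using hex
  -- `U(h)` has the determinants `-1` and `1` in the ramified representations and acts as `1` in the
  -- unramified ones; `s τ` is `(1 - e_I) + τ e_I`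
  obtain ⟨A, hA⟩ := exists_polynomial_aeval_eq he0 he fun f => if f = 1 then 1 else 0
  obtain ⟨U, hU⟩ := exists_polynomial_aeval_eq he0 he
    fun f => if f ≠ 1 ∧ ∃ k, f ∣ q ^ k + 1 then p f else 1
  obtain ⟨U', hU'⟩ := exists_polynomial_aeval_eq he0 he
    fun f => if f ≠ 1 ∧ ∃ k, f ∣ q ^ k + 1 then p' f else 1
  let H : MonoidAlgebra ℤ_[ℓ] Γ := MonoidAlgebra.single h 1
  let s : Γ → MonoidAlgebra ℤ_[ℓ] Γ := fun g =>
    1 - aeval H A + MonoidAlgebra.single g 1 * aeval H A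
  have hA' : ∀ {χ : IrrChar (AlgebraicClosure ℚ_[ℓ]) Γ} (B : EigenBasis χ.rep h τ q) (i : ℕ),
      aeval (B.ζ ^ q ^ i) A = if B.f = 1 then 1 else 0 := fun B i => by
    rw [hA _ _ (B.isPrimitiveRoot_pow hm.coprime i) B.dvd]
    split_ifs <;> simp
  have hs : ∀ {χ : IrrChar (AlgebraicClosure ℚ_[ℓ]) Γ} (B : EigenBasis χ.rep h τ q),
      χ.rep.asAlgebraHom (MonoidAlgebra.mapRingHom Γ
        (algebraMap ℤ_[ℓ] (AlgebraicClosure ℚ_[ℓ])) (s τ)) = (if B.f = 1 then B.α else 1) • 1 :=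
    fun B => B.asAlgebraHom_one_sub_add B.rep_eq_smul_one (hA' B)
  have hs' : ∀ {χ : IrrChar (AlgebraicClosure ℚ_[ℓ]) Γ} (B : EigenBasis χ.rep h τ q),
      χ.rep.asAlgebraHom (MonoidAlgebra.mapRingHom Γ
        (algebraMap ℤ_[ℓ] (AlgebraicClosure ℚ_[ℓ])) (s τ⁻¹)) =
        (if B.f = 1 then B.α⁻¹ else 1) • 1 := fun {χ} B =>
    B.asAlgebraHom_one_sub_add (fun hf => by
      have h1 : χ.rep τ⁻¹ * χ.rep τ = 1 := by rw [← map_mul, inv_mul_cancel, map_one]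
      rw [B.rep_eq_smul_one hf, mul_smul_comm, mul_one] at h1
      rw [← h1, smul_smul, inv_mul_cancel₀ (B.α_ne_zero hm.coprime), one_smul]) (hA' B)
  have hinj : Function.Injective (MonoidAlgebra.mapRingHom Γ
      (algebraMap ℤ_[ℓ] (AlgebraicClosure ℚ_[ℓ]))) := by
    refine MonoidAlgebra.map_injective
      (algebraMap ℤ_[ℓ] (AlgebraicClosure ℚ_[ℓ])).toAddMonoidHom ?_
    change Function.Injective (algebraMap ℤ_[ℓ] (AlgebraicClosure ℚ_[ℓ]))
    rw [IsScalarTower.algebraMap_eq ℤ_[ℓ] ℚ_[ℓ] (AlgebraicClosure ℚ_[ℓ])]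
    exact (algebraMap ℚ_[ℓ] _).injective.comp (IsFractionRing.injective ℤ_[ℓ] ℚ_[ℓ])
  have hUU : aeval H U * aeval H U' = 1 := by
    apply hinj
    refine ext_of_asAlgebraHom_rep fun χ => ?_
    obtain ⟨B⟩ := hm.nonempty_eigenBasis χ.rep
    rw [← map_mul (aeval H), map_one, map_one,
      ← one_smul (AlgebraicClosure ℚ_[ℓ]) (1 : Module.End _ _)]
    refine B.asAlgebraHom_aeval_eq_smul fun i => ?_
    have hξ := B.isPrimitiveRoot_pow hm.coprime i
    rw [map_mul, hU _ _ hξ B.dvd, hU' _ _ hξ B.dvd]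
    split_ifs
    · exact (hp _ B.dvd _ hξ).2
    · simp
  have hst : s τ * s τ⁻¹ = 1 ∧ s τ⁻¹ * s τ = 1 := by
    constructor <;>
    · apply hinj
      refine ext_of_asAlgebraHom_rep fun χ => ?_
      obtain ⟨B⟩ := hm.nonempty_eigenBasis χ.rep
      have hα := B.α_ne_zero hm.coprime
      rw [map_mul, map_mul, hs B, hs' B, smul_mul_smul_comm, one_mul, map_one, map_one]
      split_ifs <;> simp [hα]
  have hUU' : aeval H U' * aeval H U = 1 := by rw [← map_mul, mul_comm, map_mul, hUU]
  refine ⟨⟨s τ * aeval H U, aeval H U' * s τ⁻¹, ?_, ?_⟩, fun χ B => ?_⟩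
  · rw [mul_assoc, ← mul_assoc (aeval H U), hUU, one_mul, hst.1]
  · rw [mul_assoc, ← mul_assoc (s τ⁻¹), hst.2, one_mul, hUU']
  · change LinearMap.det (χ.rep.asAlgebraHom (MonoidAlgebra.mapRingHom Γ
      (algebraMap ℤ_[ℓ] (AlgebraicClosure ℚ_[ℓ])) (s τ * aeval H U))) = _
    rw [map_mul, map_mul, map_mul, hs B, B.det_asAlgebraHom_aeval hm.coprime, LinearMap.det_smul,
      map_one, mul_one, Module.finrank_eq_card_basis B.basis, Fintype.card_fin,
      EigenBasis.component]
    have h1 : ∀ i, aeval (B.ζ ^ q ^ i) U =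
        aeval (B.ζ ^ q ^ i) (if B.f ≠ 1 ∧ ∃ k, B.f ∣ q ^ k + 1 then p B.f else 1) :=
      fun i => hU _ _ (B.isPrimitiveRoot_pow hm.coprime i) B.dvd
    rw [Finset.prod_congr rfl fun i _ => h1 i]
    by_cases hf : B.f = 1
    · have hd : orderOf (q : ZMod B.f) = 1 := B.d_eq_one hf
      rw [if_pos hf, if_pos hf, if_neg (by simp [hf]), hd, pow_one]
      simp
    · rw [if_neg hf, if_neg hf, one_pow, one_mul]
      by_cases hk : ∃ k, B.f ∣ q ^ k + 1
      · rw [if_pos ⟨hf, hk⟩, if_pos hk]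
        exact (hp _ B.dvd _ B.isPrimitiveRoot).1
      · rw [if_neg fun h0 => hk h0.2, if_neg hk]
        simp

end IsMetacyclic

section LocalFields

variable (ℓ : ℕ) [Fact ℓ.Prime] (F E : Type*) [Field F] [Field E] [Algebra ℚ_[ℓ] F]
  [Algebra ℚ_[ℓ] E] [Algebra F E] [IsScalarTower ℚ_[ℓ] F E] [FiniteDimensional ℚ_[ℓ] E]
  [FiniteDimensional F E] [IsGalois F E]

/-- The Galois group of a tamely ramified extension is metacyclic. -/
theorem IsTame.exists_isMetacyclic (ht : IsTame ℓ F E) {σ : E ≃ₐ[F] E}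
    (hσ : IsFrobeniusLift ℓ F E σ) :
    ∃ h : E ≃ₐ[F] E, Subgroup.zpowers h = inertiaGroup ℓ F E ∧ ¬ ℓ ∣ orderOf h ∧
      IsMetacyclic h σ⁻¹ (residueCard ℓ F E) := by
  have hN : ¬ ℓ ∣ Nat.card (inertiaGroup ℓ F E) := by
    rw [card_inertiaGroup]
    exact ht
  have hcyc := isCyclic_inertiaGroup ℓ F E hN
  obtain ⟨⟨h, hI⟩, hgen⟩ := hcyc.exists_generator
  have hz : Subgroup.zpowers h = inertiaGroup ℓ F E := by
    apply le_antisymm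
    · rwa [Subgroup.zpowers_le]
    · intro g hg
      obtain ⟨k, hk⟩ := hgen ⟨g, hg⟩
      exact ⟨k, congrArg Subtype.val hk⟩
  have hord : ¬ ℓ ∣ orderOf h := by rwa [← Nat.card_zpowers, hz]
  obtain ⟨a, -, ha⟩ := exists_residueCard_eq_pow ℓ F E
  refine ⟨h, hz, hord, ?_, ?_, ?_⟩
  · rw [← conj_eq_pow_residueCard ℓ F E hN hσ hI]
    group
  · intro g
    obtain ⟨k, x, hx, hg⟩ := exists_pow_mul_of_isFrobeniusLift ℓ F E hσ g⁻¹
    have h1 : σ ^ k * x⁻¹ * (σ ^ k)⁻¹ ∈ inertiaGroup ℓ F E :=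
      (inertiaGroup_normal ℓ F E).conj_mem _ (inv_mem hx) _
    rw [← hz] at h1
    obtain ⟨j, hj⟩ := mem_powers_iff_mem_zpowers.2 h1
    refine ⟨k, j, ?_⟩
    change h ^ j = _ at hj
    rw [hj, ← inv_inv g, hg]
    group
  · rw [ha]
    exact (((Fact.out : ℓ.Prime).coprime_iff_not_dvd).2 hord).pow_left a

end LocalFields

end LocalExt

/-! ### The twisted unramified characteristic in the relative `K`-group -/

namespace LocalExt

theorem single_mul_subgroupIdempotent {Γ : Type*} [Group Γ] [Fintype Γ] {I : Subgroup Γ} {g : Γ}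
    (hg : g ∈ I) : MonoidAlgebra.single g 1 * subgroupIdempotent I = subgroupIdempotent I := by
  classical
  rw [subgroupIdempotent, mul_smul_comm, Finset.mul_sum]
  congr 1
  refine Finset.sum_equiv (Equiv.mulLeft g) (fun x => ?_) fun x _ => ?_
  · simp [Subgroup.mul_mem_cancel_left I hg]
  · rw [MonoidAlgebra.single_mul_single, one_mul]
    rfl

section LocalFields

variable (ℓ : ℕ) [Fact ℓ.Prime] (F E : Type*) [Field F] [Field E] [Algebra ℚ_[ℓ] F]
  [Algebra ℚ_[ℓ] E] [Algebra F E] [IsScalarTower ℚ_[ℓ] F E] [FiniteDimensional ℚ_[ℓ] E]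
  [FiniteDimensional F E] [IsGalois F E]

/-- For a tamely ramified extension, `(1 - ψ_{2,*})(y)` is the reduced norm of a unit of `ℤ_ℓ[Γ]`.
-/
theorem IsTame.exists_reducedNorm_eq (ht : IsTame ℓ F E)
    (hI : Odd (Nat.card (inertiaGroup ℓ F E))) :
    ∃ v : K1 (MonoidAlgebra ℚ_[ℓ] (E ≃ₐ[F] E)),
      reducedNorm ℚ_[ℓ] (E ≃ₐ[F] E) v = twistedCentralUnitPadic ℓ F E ∧
        boundary ℤ_[ℓ] v = 0 := by
  classical
  have hσ := isFrobeniusLift_frobenius ℓ F E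
  obtain ⟨h, hz, hℓ, hm⟩ := ht.exists_isMetacyclic ℓ F E hσ
  obtain ⟨a, ha, hq⟩ := exists_residueCard_eq_pow ℓ F E
  have hN : (Subgroup.zpowers h).Normal := by
    rw [hz]
    exact inertiaGroup_normal ℓ F E
  have hodd : Odd (orderOf h) := by rwa [← Nat.card_zpowers, hz]
  have hchar : CharZero (AlgebraicClosure ℚ_[ℓ]) := charZero_of_injective_algebraMap
    (algebraMap ℚ_[ℓ] (AlgebraicClosure ℚ_[ℓ])).injective
  obtain ⟨x, hx⟩ := hm.exists_rat_forall_asAlgebraHom_eq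
  obtain ⟨u, hu⟩ := hm.exists_unit_forall_det_eq ha hq hℓ
  let B : ∀ χ : IrrChar QBar (E ≃ₐ[F] E), EigenBasis χ.rep h (frobenius ℓ F E)⁻¹ _ :=
    fun χ => (hm.nonempty_eigenBasis χ.rep).some
  obtain ⟨z, hzx, hz'⟩ := exists_centerUnits_eq (K := QBar) (c := fun χ => (B χ).component)
    (fun χ => hm.component_ne_zero (B χ)) (fun χ => hx χ (B χ))
  have h1 : z.extend QBar = twistedCentral ℓ F E := by
    rw [hz', twistedCentral_eq ℓ F E hσ, ← hz]
    congr 1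
    funext χ
    have h2 := hm.mul_virtualValue_inv_eq_component (B χ) hodd
    rw [inv_inv] at h2
    exact h2.symm
  obtain ⟨v, hv, hv'⟩ := exists_reducedNorm_eq_of_det_eq z u fun χ => by
    obtain ⟨B⟩ := hm.nonempty_eigenBasis χ.rep
    rw [hu χ B, hzx, hx χ B]
  refine ⟨v, ?_, hv'⟩
  rw [hv, twistedCentralUnitPadic, twistedCentralUnit_eq ℓ F E h1]

/-- For a totally ramified extension of odd degree `(1 - ψ_{2,*})(y)` is trivial. -/
theorem IsTotallyRamified.twistedCentralUnit_eq_one (ht : IsTotallyRamified ℓ F E)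
    (hodd : Odd (Module.finrank F E)) : twistedCentralUnit ℓ F E = 1 := by
  have htop := inertiaGroup_eq_top ℓ F E ht
  have hΓ : Odd (Nat.card (E ≃ₐ[F] E)) := by rwa [IsGalois.card_aut_eq_finrank]
  have hI : Odd (Nat.card (inertiaGroup ℓ F E)) := by
    rw [htop]
    simpa using hΓ
  have hσ := isFrobeniusLift_frobenius ℓ F E
  have h1 := (twistedCentralUnit_eq_of_odd_or_comm ℓ F E hI (Or.inl hΓ) hσ).2
  rw [single_mul_subgroupIdempotent (by rw [htop]; trivial), sub_add_cancel] at h1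
  exact Units.ext (Subtype.ext h1)

theorem exists_reducedNorm_eq_and_boundary_eq_zero (hI : Odd (Nat.card (inertiaGroup ℓ F E)))
    (h : IsTame ℓ F E ∨ (IsTotallyRamified ℓ F E ∧ Odd (Module.finrank F E))) :
    ∃ v : K1 (MonoidAlgebra ℚ_[ℓ] (E ≃ₐ[F] E)),
      reducedNorm ℚ_[ℓ] (E ≃ₐ[F] E) v = twistedCentralUnitPadic ℓ F E ∧
        boundary ℤ_[ℓ] v = 0 := by
  rcases h with h | ⟨h, hodd⟩
  · exact h.exists_reducedNorm_eq ℓ F E hI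
  · refine ⟨0, reducedNorm_eq fun χ => ?_, map_zero _⟩
    rw [twistedCentralUnitPadic, h.twistedCentralUnit_eq_one ℓ F E hodd, map_one, map_zero]
    have : CharZero (AlgebraicClosure ℚ_[ℓ]) := charZero_of_injective_algebraMap
      (algebraMap ℚ_[ℓ] (AlgebraicClosure ℚ_[ℓ])).injective
    change χ.coeff (MonoidAlgebra.mapRingHom _ _ 1) = 1
    rw [map_one, χ.coeff_one]

end LocalFields

end LocalExt

theorem mainTheorem11 (ℓ : ℕ) [Fact ℓ.Prime] (F E : Type*) [Field F] [Field E]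
    [Algebra ℚ_[ℓ] F] [Algebra ℚ_[ℓ] E] [Algebra F E] [IsScalarTower ℚ_[ℓ] F E]
    [FiniteDimensional ℚ_[ℓ] E] [FiniteDimensional F E] [IsGalois F E]
    (hI : Odd (Nat.card (LocalExt.inertiaGroup ℓ F E))) :
    ((Odd (Nat.card (E ≃ₐ[F] E)) ∨ ∀ g h : E ≃ₐ[F] E, g * h = h * g) →
      (LocalExt.twistedCentralUnit ℓ F E).extend LocalExt.QBar =
          LocalExt.twistedCentral ℓ F E ∧
        ∀ σ : E ≃ₐ[F] E, LocalExt.IsFrobeniusLift ℓ F E σ →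
          ((LocalExt.twistedCentralUnit ℓ F E : Subring.center (MonoidAlgebra ℚ (E ≃ₐ[F] E))) :
              MonoidAlgebra ℚ (E ≃ₐ[F] E)) =
            (1 - LocalExt.subgroupIdempotent (LocalExt.inertiaGroup ℓ F E)) +
              MonoidAlgebra.single σ⁻¹ 1 *
                LocalExt.subgroupIdempotent (LocalExt.inertiaGroup ℓ F E)) ∧
    ((LocalExt.IsTame ℓ F E ∨
        (LocalExt.IsTotallyRamified ℓ F E ∧ Odd (Module.finrank F E))) →
      LocalExt.twistedUnramifiedChar ℓ F E = 0 ∧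
        ∃ v : LocalExt.K1 (MonoidAlgebra ℚ_[ℓ] (E ≃ₐ[F] E)),
          LocalExt.reducedNorm ℚ_[ℓ] (E ≃ₐ[F] E) v = LocalExt.twistedCentralUnitPadic ℓ F E ∧
            LocalExt.boundary ℤ_[ℓ] v = 0) := by
  refine ⟨fun h => ⟨?_, fun σ hσ => ?_⟩, fun h => ?_⟩
  · exact (LocalExt.twistedCentralUnit_eq_of_odd_or_comm ℓ F E hI h
      (LocalExt.isFrobeniusLift_frobenius ℓ F E)).1
  · exact (LocalExt.twistedCentralUnit_eq_of_odd_or_comm ℓ F E hI h hσ).2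
  · obtain ⟨v, hv, hv'⟩ := LocalExt.exists_reducedNorm_eq_and_boundary_eq_zero ℓ F E hI h
    exact ⟨LocalExt.deltaMap_eq_zero hv hv', v, hv, hv'⟩
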